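/- Let $D(\theta)=2\theta$ be the doubling map on the circle $S^1=\mathbb R/\mathbb Z$. A leaf is a geodesic of the closed unit disk, given by its unordered pair $\ell=(x,y)$ of endpoints in $S^1$ and degenerate (a point of $S^1$) if $x=y$; its image is $D(\ell)=(D(x),D(y))$ and its length is the length of the shorter arc of $S^1$ between its endpoints. An invariant quadratic lamination (in the sense of Thurston) is a set $\lambda$ of leaves, containing all degenerate ones, such that no two leaves cross inside the disk, the union of the leaves is closed, the image of each leaf is a leaf of $\lambda$, each leaf of $\lambda$ has two disjoint preimages in $\lambda$, and for each gap $G$ (closure of a component of the complement of the union of the leaves) the convex hull of $D(G\cap S^1)$ is a point, a leaf of $\lambda$, or a gap, where in the last case $\partial G$ is mapped to the boundary of the image gap preserving the orientation. A major leaf of $\lambda$ is a non-degenerate leaf of maximal length, and its image is the minor leaf. $QML$ is the set of the minor leaves of all invariant quadratic laminations. For leaves write $\ell_1<\ell_2$ if $\ell_1$ separates $\ell_2$ from $\{0\}$ (with $\{0\}<\ell$ for every $\ell\ne\{0\}$). The combinatorial vein of a leaf $\ell$ is $P(\ell)=\{\ell'\in QML : \{0\}<\ell'\le\ell\}$; for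 an angle $\theta$ write $P(\theta)=P(\{\theta\})$. Let $0<p<q$ be coprime integers. Let $C_{p/q}=\{x_1<\dots<x_q\}\subset[0,1)$ be the unique $q$-point set with $D(x_i)=x_{i+p}$ for all $i$ (indices mod $q$). Let $\Sigma_0$ (resp. $\Sigma_1$) be the word of the first $q-1$ digits of the itinerary of $p/q$ under the rotation by $p/q$ with respect to the partition $A_0=(0,1-\frac pq]$, $A_1=(1-\frac pq,1]$ (resp. $A_0=[0,1-\frac pq)$, $A_1=[1-\frac pq,1)$). Put $A(\theta)=0$, $\Sigma_0$, $\Sigma_1$, $1$ according as $\theta\in[0,\frac13)$, $(\frac13,\frac12)$, $[\frac12,\frac23)$, $(\frac23,1)$. The combinatorial surgery map $\Psi=\Psi_{p/q}:S^1\to S^1$ sends $\theta$ to the angle with binary expansion $0.s_0s_1s_2\dots$, where $s_k=A(D^k(\theta))$, if $D^k(\theta)\notin\{\frac13,\frac23\}$ for all $k\ge0$; otherwise, with $h$ the least integer such that $D^h(\theta)\in\{\frac13,\frac23\}$, to $0.s_0\dots s_{h-1}s_h$, where $s_k=A(D^k(\theta))$ for $k<h$ and $s_h$ is $\overline{\Sigma_0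 1}$ if $D^h(\theta)=\frac13$ and $\overline{\Sigma_1 0}$ if $D^h(\theta)=\frac23$. On leaves put $\Psi((x,y))=(\Psi(x),\Psi(y))$, and let $\tau_{p/q}=\Psi_{p/q}(\frac12)$. Then $\Psi_{p/q}$ maps the real combinatorial vein $P(\frac12)$ bijectively onto the principal combinatorial vein $P(\tau_{p/q})$ up to a countable set of prefixed leaves: $\Psi_{p/q}$ is injective on $P(\frac12)$, one has $$\{\ell\in P(\tau_{p/q}) : \text{no endpoint } x \text{ of } \ell \text{ satisfies } D^n(x)\in C_{p/q} \text{ for some } n\ge0\}\subseteq\Psi_{p/q}(P(\tfrac12))\subseteq P(\tau_{p/q}),$$ and $P(\tau_{p/q})\setminus\Psi_{p/q}(P(\frac12))$ is countable. -/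

import Mathlib

namespace Surgery

noncomputable section

/-- The circle `ℝ/ℤ` of external angles. -/
abbrev Angle : Type := AddCircle (1 : ℝ)

/-- The doubling map `D(θ) = 2θ mod 1`. -/
def doubling (x : Angle) : Angle := x + x

/-- The representative in `[0, 1)` of an angle. -/
def rep (x : Angle) : ℝ := (AddCircle.equivIco (1 : ℝ) 0 x : ℝ)

/-- A leaf (geodesic of the closed disk) is given by its unordered pair of endpoints on the circle;
it is degenerate (a single point of the circle) when the two endpoints agree. -/
abbrev Leaf : Type := Sym2 Angle

/-- The image of a leaf under doubling: the leaf joining the images of the endpoints. -/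
def Leaf.image (l : Leaf) : Leaf := Sym2.map doubling l

/-- The length of a leaf: the length along the circle of the shorter arc that it cuts off. -/
def Leaf.length (l : Leaf) : ℝ :=
  Sym2.lift ⟨fun x y : Angle => dist x y, fun x y => dist_comm x y⟩ l

/-- Two leaves intersect in the open disk without being equal: their endpoints strictly interlace. -/
def Leaf.Crosses (l l' : Leaf) : Prop :=
  ∃ a b c d : Angle, l = s(a, b) ∧ l' = s(c, d) ∧ sbtw a c b ∧ sbtw b d a

/-- `v` is the immediate counterclockwise successor of `u` in the set `X` of points of the circle. -/
def IsNext (X : Set Angle) (u v : Angle) : Prop :=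
  u ∈ X ∧ v ∈ X ∧ u ≠ v ∧ ∀ z ∈ X, ¬ sbtw u z v

/-- `X` is the trace on the circle of a gap of the lamination `L`. A gap is the closure of a
component of the complement of the union of the leaves; it is the convex hull of its trace `X` on
the circle, so `X` is closed with at least three points, the sides of the hull (the chords joining
consecutive points of `X`) are leaves, and no other chord between points of `X` is a leaf.
Conversely, since leaves do not cross, for such an `X` no leaf meets the interior of the
hull of `X`, so that this interior is a component of the complement. -/
def IsGap (L : Set Leaf) (X : Set Angle) : Prop :=
  IsClosed X ∧ 3 ≤ X.encard ∧
    ∀ u ∈ X, ∀ v ∈ X, u ≠ v → (s(u, v) ∈ L ↔ IsNext X u v ∨ IsNext X v u)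

/-- Invariant quadratic laminations in the sense of Thurston. All the points of the circle are
counted as degenerate leaves. -/
structure IsInvariantLamination (L : Set Leaf) : Prop where
  degenerate_mem : ∀ x : Angle, s(x, x) ∈ L
  not_crosses : ∀ l ∈ L, ∀ l' ∈ L, ¬ l.Crosses l'
  /-- The union of the leaves is a closed subset of the closed disk. -/
  closed : IsClosed {z : Angle × Angle | s(z.1, z.2) ∈ L}
  forward : ∀ l ∈ L, l.image ∈ L
  /-- Every leaf has two disjoint preimage leaves. -/
  backward : ∀ l ∈ L, ∃ l₁ ∈ L, ∃ l₂ ∈ L, l₁.image = l ∧ l₂.image = l ∧ ∀ x ∈ l₁, x ∉ l₂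
  /-- The convex hull of the image of the trace of a gap is a point, a leaf or a gap. In the last
  case the boundary of the gap is mapped to the boundary of the image gap preserving the
  orientation: each side is collapsed or goes to a side, with the same orientation. -/
  gap : ∀ X : Set Angle, IsGap L X →
    (∃ u, doubling '' X = {u}) ∨
    (∃ u v, u ≠ v ∧ doubling '' X = {u, v} ∧ s(u, v) ∈ L) ∨
    (IsGap L (doubling '' X) ∧
      ∀ u v, IsNext X u v →
        doubling u = doubling v ∨ IsNext (doubling '' X) (doubling u) (doubling v))

/-- A major leaf of a lamination: a (non-degenerate) leaf of maximal length. -/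
def IsMajor (L : Set Leaf) (M : Leaf) : Prop :=
  M ∈ L ∧ ¬ M.IsDiag ∧ ∀ l ∈ L, l.length ≤ M.length

/-- The quadratic minor lamination: all minor leaves (images of major leaves) of all
invariant quadratic laminations. -/
def QML : Set Leaf :=
  {m | ∃ L : Set Leaf, IsInvariantLamination L ∧ ∃ M, IsMajor L M ∧ m = M.image}

/-- The root `{0}`. -/
def root : Leaf := s(0, 0)

/-- The order on leaves: `l < l'` if `l` separates `l'` from the root `{0}`, i.e. `l ≠ l'` and
either `l` is the root itself, or `l'` lies in the closed part cut off by `l` away from `0`. -/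
def Leaf.Below (l l' : Leaf) : Prop :=
  l ≠ l' ∧ (l = root ∨ ∀ z ∈ l', ∃ a ∈ l, ∃ b ∈ l, rep a ≤ rep z ∧ rep z ≤ rep b)

/-- The combinatorial vein `P(l) = {l' ∈ QML : {0} < l' ≤ l}`. -/
def vein (l : Leaf) : Set Leaf :=
  {l' | l' ∈ QML ∧ root.Below l' ∧ (l' = l ∨ l'.Below l)}

/-- The `α`-portrait `C_{p/q}`: the points of the set `{x_0 < ⋯ < x_{q-1}} ⊆ [0, 1)` on which
doubling acts by `x_i ↦ x_{i+p}`, with indices mod `q`. -/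
def alphaPortrait (p q : ℕ) : Set Angle :=
  {y | ∃ x : Fin q → ℝ, StrictMono x ∧ (∀ i, x i ∈ Set.Ico (0 : ℝ) 1) ∧
    (∀ i j : Fin q, (j : ℕ) = ((i : ℕ) + p) % q →
      doubling ((x i : ℝ) : Angle) = ((x j : ℝ) : Angle)) ∧
    ∃ i, y = ((x i : ℝ) : Angle)}

/-- The word `Σ₀`: the first `q - 1` letters of the itinerary of `p/q` under the rotation by `p/q`
with respect to `A₀ = (0, 1 - p/q]`, `A₁ = (1 - p/q, 1]`. The `k`-th point of the orbit is
`((k + 1) p mod q) / q`, which is never `0` for `k < q - 1` when `p` and `q` are coprime. -/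
def sigma0 (p q : ℕ) : List (Fin 2) :=
  (List.range (q - 1)).map fun k => if q - p < (k + 1) * p % q then 1 else 0

/-- The word `Σ₁`: the same with the partition `A₀ = [0, 1 - p/q)`, `A₁ = [1 - p/q, 1)`. -/
def sigma1 (p q : ℕ) : List (Fin 2) :=
  (List.range (q - 1)).map fun k => if q - p ≤ (k + 1) * p % q then 1 else 0

/-- The coding `A_{p/q}`; its values at `1/3` and `2/3` are never used. -/
def code (p q : ℕ) (x : Angle) : List (Fin 2) :=
  if rep x < 1 / 3 then [0]
  else if rep x < 1 / 2 then sigma0 p q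
  else if rep x < 2 / 3 then sigma1 p q
  else [1]

/-- The angle `1/3`, an endpoint of the fixed leaf `(1/3, 2/3)`. -/
def oneThird : Angle := ((1 / 3 : ℝ) : Angle)

/-- The angle `2/3`, the other endpoint of the fixed leaf. -/
def twoThirds : Angle := ((2 / 3 : ℝ) : Angle)

open Classical in
/-- The sequence of words `s_0, s_1, s_2, …` whose concatenation is the binary expansion of
`Ψ_{p/q}(x)`: the codes of the points of the orbit of `x`; if `h` is the first time at which the
orbit meets `{1/3, 2/3}`, then from time `h` on the word is `Σ₀ 1` (if `1/3` is hit first) or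
`Σ₁ 0` (if `2/3` is hit first), repeated forever. -/
def surgeryWord (p q : ℕ) (x : Angle) (k : ℕ) : List (Fin 2) :=
  if H : ∃ n : ℕ, doubling^[n] x = oneThird ∨ doubling^[n] x = twoThirds then
    if k < Nat.find H then code p q (doubling^[k] x)
    else if doubling^[Nat.find H] x = oneThird then sigma0 p q ++ [1]
    else sigma1 p q ++ [0]
  else code p q (doubling^[k] x)

/-- The infinite concatenation `w_0 w_1 w_2 …` of non-empty words. -/
def concat (w : ℕ → List (Fin 2)) (n : ℕ) : Fin 2 :=
  ((List.range (n + 1)).flatMap w).getD n 0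

/-- The combinatorial surgery map `Ψ_{p/q}` on angles. -/
def surgery (p q : ℕ) (x : Angle) : Angle :=
  ((Real.ofDigits (concat (surgeryWord p q x)) : ℝ) : Angle)

/-- The combinatorial surgery map on leaves. -/
def surgeryLeaf (p q : ℕ) (l : Leaf) : Leaf := Sym2.map (surgery p q) l

/-- The angle `1/2`. -/
def oneHalf : Angle := ((1 / 2 : ℝ) : Angle)

/-- The angle `τ_{p/q} = Ψ_{p/q}(1/2)`. -/
def tau (p q : ℕ) : Angle := surgery p q oneHalf

end

end Surgery

/-! The proof rests on a description of non-degenerate minor leaves by itineraries. Halving the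
endpoints of a chord `(A, B)` cuts the circle into four arcs: a left arc around 0, an opposite right
arc, and two short arcs between them. If `(A, B)` is a minor leaf, then at every time the orbits of
`A` and `B` are both in the right arc or both in the left arc (`arcs_of_mem_QML`). Indeed a major
leaf comes with its half-turn (`IsMajor.add_oneHalf_mem`), and no image of the minor leaf can enter
the strip between the two majors: it would cross a major or have a forbidden length. Conversely, the
sides of the convex hulls of the sets of points with equal itineraries form a lamination with minor
leaf `(A, B)`, provided that no itinerary class which contains `A` and `B` has points on both sides
of this chord (`mem_QML_of_itinSet`).

Surgery is a conjugacy of return maps. For each `p/q`, a suitable return map to the sector of the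
`α`-portrait at 0 and to the sector `[θ₀, θ₁]` around `τ` is piecewise affine and increasing, with
six symbols (`Model`). For `1/2` it is doubling, stopped at `1/3` and `2/3`. The realizable
itineraries and the order of the points carrying them are the same for all `p/q`
(`IsItin.admissible`, `isItin_of_admissible`, `IsItin.lt`), and the digits of `Ψ(x)` spell out the
itinerary of `x`. Hence `Ψ` is the order-preserving conjugacy (`isItin_surgery`), and it is
injective.

Leaves of the real vein other than `{1/2}` have the form `(x, -x)`. Between returns the image orbits
stay in the right arc, and at return times the arcs correspond under `Ψ`; so the arc condition
passes to the image leaf (`sameArcs_surgery`), which is again minor (`surgery_mem_QML`). In the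
other direction, let `(A, B)` be a leaf of the vein of `τ` whose ends never meet the portrait.
Doubling rotates the sectors until an orbit reaches the outer half circle, which both ends do at the
same times. So ends on different sides of `τ` lie in one sector and stay in opposite pieces at all
returns (`Opposite.step`). Their itineraries are conjugate, hence they are `Ψ(x)` and `Ψ(-x)`
(`mem_image_of_not_isRot`). The leaves which are missed have both ends in the countable backward
orbit of the portrait. -/

namespace Surgery

/-! ### Representatives in `[0, 1)`, doubling, cyclic order and distance on the circle -/

theorem rep_nonneg (x : Angle) : 0 ≤ rep x := (AddCircle.equivIco (1 : ℝ) 0 x).2.1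

theorem rep_lt_one (x : Angle) : rep x < 1 :=
  (AddCircle.equivIco (1 : ℝ) 0 x).2.2.trans_eq (zero_add 1)

@[simp] theorem coe_rep (x : Angle) : ((rep x : ℝ) : Angle) = x := AddCircle.coe_equivIco

theorem rep_coe {t : ℝ} (h0 : 0 ≤ t) (h1 : t < 1) : rep (t : Angle) = t :=
  AddCircle.equivIco_coe_of_mem (p := (1 : ℝ)) (a := 0) (y := t) (by simp [h0, h1])

theorem rep_injective : Function.Injective rep := fun x y h => by
  rw [← coe_rep x, ← coe_rep y, h]

theorem rep_inj {x y : Angle} : rep x = rep y ↔ x = y := rep_injective.eq_iff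

@[simp] theorem rep_zero : rep 0 = 0 := by
  simpa using rep_coe (t := 0) le_rfl one_pos

theorem rep_pos {x : Angle} (h : x ≠ 0) : 0 < rep x :=
  lt_of_le_of_ne (rep_nonneg x) fun h' => h (rep_injective (by rw [rep_zero, ← h']))

theorem coe_add_int (t : ℝ) (n : ℤ) : ((t + n : ℝ) : Angle) = t := by
  rw [AddCircle.coe_add]
  have : ((n : ℝ) : Angle) = 0 := (AddCircle.coe_eq_zero_iff 1).2 ⟨n, by simp⟩
  rw [this, add_zero]

theorem coe_add_one (t : ℝ) : ((t + 1 : ℝ) : Angle) = t := by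
  have := coe_add_int t 1
  rwa [Int.cast_one] at this

theorem coe_sub_one (t : ℝ) : ((t - 1 : ℝ) : Angle) = t := by
  have := coe_add_int t (-1)
  rwa [Int.cast_neg, Int.cast_one, ← sub_eq_add_neg] at this

theorem rep_coe_add_int {t : ℝ} (n : ℤ) (h0 : 0 ≤ t) (h1 : t < 1) :
    rep ((t + n : ℝ) : Angle) = t := by
  rw [coe_add_int, rep_coe h0 h1]

theorem rep_sub (x y : Angle) :
    (rep y ≤ rep x ∧ rep (x - y) = rep x - rep y) ∨
      (rep x < rep y ∧ rep (x - y) = rep x - rep y + 1) := by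
  have hx := rep_nonneg x
  have hx' := rep_lt_one x
  have hy := rep_nonneg y
  have hy' := rep_lt_one y
  have e : x - y = ((rep x - rep y : ℝ) : Angle) := by simp
  rcases le_or_gt (rep y) (rep x) with h | h
  · left
    refine ⟨h, ?_⟩
    rw [e, rep_coe (by linarith) (by linarith)]
  · right
    refine ⟨h, ?_⟩
    rw [e, ← coe_add_one, rep_coe (by linarith) (by linarith)]

theorem rep_doubling (x : Angle) :
    (rep x < 1 / 2 ∧ rep (doubling x) = 2 * rep x) ∨
      (1 / 2 ≤ rep x ∧ rep (doubling x) = 2 * rep x - 1) := by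
  have hx := rep_nonneg x
  have hx' := rep_lt_one x
  have e : doubling x = ((2 * rep x : ℝ) : Angle) := by
    rw [two_mul, AddCircle.coe_add, coe_rep]; rfl
  rcases lt_or_ge (rep x) (1 / 2) with h | h
  · left
    refine ⟨h, ?_⟩
    rw [e, rep_coe (by linarith) (by linarith)]
  · right
    refine ⟨h, ?_⟩
    rw [e, ← coe_sub_one, rep_coe (by linarith) (by linarith)]

theorem rep_doubling_of_lt {x : Angle} (h : rep x < 1 / 2) : rep (doubling x) = 2 * rep x := by
  rcases rep_doubling x with h' | h'
  · exact h'.2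
  · linarith [h'.1]

theorem rep_doubling_of_le {x : Angle} (h : 1 / 2 ≤ rep x) :
    rep (doubling x) = 2 * rep x - 1 := by
  rcases rep_doubling x with h' | h'
  · linarith [h'.1]
  · exact h'.2

theorem rep_oneHalf : rep oneHalf = 1 / 2 := rep_coe (by norm_num) (by norm_num)

theorem rep_add_oneHalf (x : Angle) :
    (rep x < 1 / 2 ∧ rep (x + oneHalf) = rep x + 1 / 2) ∨
      (1 / 2 ≤ rep x ∧ rep (x + oneHalf) = rep x - 1 / 2) := by
  have hx := rep_nonneg x
  have hx' := rep_lt_one x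
  have e : x + oneHalf = ((rep x + 1 / 2 : ℝ) : Angle) := by
    rw [AddCircle.coe_add, coe_rep]; rfl
  rcases lt_or_ge (rep x) (1 / 2) with h | h
  · left
    refine ⟨h, ?_⟩
    rw [e, rep_coe (by linarith) (by linarith)]
  · right
    refine ⟨h, ?_⟩
    rw [e, ← coe_sub_one, rep_coe (by linarith) (by linarith)]
    ring

theorem oneHalf_add_oneHalf : oneHalf + oneHalf = 0 := by
  apply rep_injective
  rcases rep_add_oneHalf oneHalf with h | h <;> rw [rep_oneHalf] at h <;> rw [h.2] <;> norm_num at *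

@[simp] theorem add_oneHalf_add_oneHalf (x : Angle) : x + oneHalf + oneHalf = x := by
  rw [add_assoc, oneHalf_add_oneHalf, add_zero]

@[simp] theorem doubling_add_oneHalf (x : Angle) : doubling (x + oneHalf) = doubling x := by
  unfold doubling
  rw [add_add_add_comm, oneHalf_add_oneHalf, add_zero]

theorem add_oneHalf_ne (x : Angle) : x + oneHalf ≠ x := by
  intro h
  have := congrArg rep h
  rcases rep_add_oneHalf x with h' | h' <;> rw [h'.2] at this <;> linarith

theorem doubling_eq_iff {x y : Angle} : doubling x = doubling y ↔ x = y ∨ x = y + oneHalf := by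
  constructor
  · intro h
    have h' := congrArg rep h
    rw [← rep_inj (x := x) (y := y), ← rep_inj (x := x) (y := y + oneHalf)]
    rcases rep_doubling x with hx | hx <;> rcases rep_doubling y with hy | hy <;>
      rcases rep_add_oneHalf y with hz | hz <;> rw [hz.2] <;> rw [hx.2, hy.2] at h' <;>
      first
        | (left; linarith)
        | (right; linarith)
  · rintro (rfl | rfl) <;> simp

theorem sbtw_iff_rep {a b c : Angle} :
    sbtw a b c ↔ (rep a < rep b ∧ rep b < rep c) ∨ (rep b < rep c ∧ rep c < rep a) ∨
      (rep c < rep a ∧ rep a < rep b) := by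
  rw [sbtw_iff_not_btw]
  -- The order relation on the circle compares a representative in `[0, 1)` with one in `(0, 1]`, so
  -- a coincidence `a = c` counts as 1 rather than 0.
  have key : btw c b a ↔ rep (b - c) ≤ if a = c then 1 else rep (a - c) := by
    change ((QuotientAddGroup.equivIcoMod (one_pos : (0 : ℝ) < 1) 0 (b - c) : ℝ) ≤
      (QuotientAddGroup.equivIocMod (one_pos : (0 : ℝ) < 1) 0 (a - c) : ℝ)) ↔ _
    have e1 : (QuotientAddGroup.equivIcoMod (one_pos : (0 : ℝ) < 1) 0 (b - c) : ℝ) = rep (b - c) :=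
      rfl
    have e2 : (QuotientAddGroup.equivIocMod (one_pos : (0 : ℝ) < 1) 0 (a - c) : ℝ) =
        if a = c then 1 else rep (a - c) := by
      split_ifs with h
      · subst h
        have := AddCircle.equivIoc_coe_of_mem (p := (1 : ℝ)) (a := 0) (y := 1) (by simp)
        rw [sub_self]
        have h1 : ((1 : ℝ) : Angle) = 0 := AddCircle.coe_period 1
        rw [h1] at this
        exact this
      · have hne : a - c ≠ 0 := sub_ne_zero.2 h
        have := AddCircle.equivIoc_coe_of_mem (p := (1 : ℝ)) (a := 0) (y := rep (a - c))
            ⟨rep_pos hne, by simpa using (rep_lt_one _).le⟩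
        rw [coe_rep] at this
        exact this
    rw [e1, e2]
  rw [key]
  have ha := rep_nonneg a
  have ha' := rep_lt_one a
  have hb := rep_nonneg b
  have hb' := rep_lt_one b
  have hc := rep_nonneg c
  have hc' := rep_lt_one c
  split_ifs with h
  · subst h
    have := rep_lt_one (b - a)
    constructor
    · intro h; linarith
    · rintro (h | h | h) <;> linarith
  · have hne : rep a ≠ rep c := fun h' => h (rep_injective h')
    rcases rep_sub b c with h1 | h1 <;> rcases rep_sub a c with h2 | h2 <;> rw [h1.2, h2.2] <;>
      constructor <;> intro h3
    · have : rep c < rep a := lt_of_le_of_ne h2.1 (Ne.symm hne)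
      right; right; exact ⟨this, by linarith⟩
    · rcases h3 with h3 | h3 | h3 <;> linarith
    · exfalso; linarith
    · rcases h3 with h3 | h3 | h3 <;> linarith
    · right; left; exact ⟨h1.1, lt_of_le_of_ne h2.1 (Ne.symm hne)⟩
    · linarith
    · left; exact ⟨by linarith, by linarith⟩
    · rcases h3 with h3 | h3 | h3 <;> linarith

/-- Rotating `p` to 0 leaves one of the three cyclic cases; invariance under rotation follows at
once. -/
theorem sbtw_iff_sub {p u q : Angle} :
    sbtw p u q ↔ 0 < rep (u - p) ∧ rep (u - p) < rep (q - p) := by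
  rw [sbtw_iff_rep]
  have hp := rep_nonneg p
  have hp' := rep_lt_one p
  have hu := rep_nonneg u
  have hu' := rep_lt_one u
  have hq := rep_nonneg q
  have hq' := rep_lt_one q
  rcases rep_sub u p with h1 | h1 <;> rcases rep_sub q p with h2 | h2 <;> rw [h1.2, h2.2] <;>
    constructor <;> intro h3
  · rcases h3 with h3 | h3 | h3 <;> constructor <;> linarith
  · left; constructor <;> linarith
  · rcases h3 with h3 | h3 | h3 <;> constructor <;> linarith
  · right; right; constructor <;> linarith
  · rcases h3 with h3 | h3 | h3 <;> constructor <;> linarith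
  · exfalso; linarith
  · rcases h3 with h3 | h3 | h3 <;> constructor <;> linarith
  · right; left; constructor <;> linarith

theorem sbtw_add_right {p u q : Angle} (c : Angle) :
    sbtw (p + c) (u + c) (q + c) ↔ sbtw p u q := by
  simp [sbtw_iff_sub]

theorem sbtw_or_sbtw {a b c : Angle} (hab : a ≠ b) (hbc : b ≠ c) (hac : a ≠ c) :
    sbtw a b c ∨ sbtw c b a := by
  rw [sbtw_iff_rep, sbtw_iff_rep]
  rw [← rep_injective.ne_iff] at hab hbc hac
  rcases hab.lt_or_gt with h1 | h1 <;> rcases hbc.lt_or_gt with h2 | h2 <;>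
    rcases hac.lt_or_gt with h3 | h3 <;> simp [h1, h2, h3]

theorem sbtw_ne {a b c : Angle} (h : sbtw a b c) : a ≠ b ∧ b ≠ c ∧ a ≠ c := by
  refine ⟨?_, ?_, ?_⟩ <;> rintro rfl
  · exact sbtw_irrefl_left h
  · exact sbtw_irrefl_right h
  · exact sbtw_irrefl_left_right h

theorem dist_eq_rep (x y : Angle) :
    dist x y = min |rep x - rep y| (1 - |rep x - rep y|) := by
  have hx := rep_nonneg x
  have hx' := rep_lt_one x
  have hy := rep_nonneg y
  have hy' := rep_lt_one y
  have e : x - y = ((rep x - rep y : ℝ) : Angle) := by simp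
  rw [dist_eq_norm, e, AddCircle.norm_eq]
  simp only [inv_one, one_mul, mul_one]
  rw [abs_sub_round_eq_min]
  rcases le_or_gt (rep y) (rep x) with h | h
  · rw [Int.fract_eq_self.2 ⟨by linarith, by linarith⟩, abs_of_nonneg (by linarith)]
  · rw [← Int.fract_add_one, Int.fract_eq_self.2 ⟨by linarith, by linarith⟩,
      abs_of_neg (by linarith), min_comm]
    congr 1 <;> ring

theorem doubling_continuous : Continuous doubling := by
  unfold doubling; fun_prop

theorem continuousAt_rep {x : Angle} (h : x ≠ 0) : ContinuousAt rep x :=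
  continuous_subtype_val.continuousAt.comp
    (AddCircle.continuousAt_equivIco (1 : ℝ) 0 (by simpa using h))

/-- Written with differences, the relation evaluates `rep` only away from its jump at 0, so the
strict inequalities persist nearby. -/
theorem eventually_sbtw {p u q : Angle} (h : sbtw p u q) :
    ∀ᶠ z : Angle × Angle in nhds (p, q), sbtw z.1 u z.2 := by
  have hne := sbtw_ne h
  have h' := sbtw_iff_sub.1 h
  have c1 : ContinuousAt (fun z : Angle × Angle => rep (u - z.1)) (p, q) :=
    ContinuousAt.comp (f := fun z : Angle × Angle => u - z.1) (g := rep)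
      (continuousAt_rep (sub_ne_zero.2 hne.1.symm)) (by fun_prop)
  have c2 : ContinuousAt (fun z : Angle × Angle => rep (z.2 - z.1)) (p, q) :=
    ContinuousAt.comp (f := fun z : Angle × Angle => z.2 - z.1) (g := rep)
      (continuousAt_rep (sub_ne_zero.2 hne.2.2.symm)) (by fun_prop)
  filter_upwards [c1.eventually (lt_mem_nhds h'.1), c1.eventually_lt c2 h'.2] with z h1 h2
  exact sbtw_iff_sub.2 ⟨h1, h2⟩

end Surgery

/-! ### The gap condition for laminations symmetric under the half-turn -/

namespace Surgery

theorem Leaf.crosses_mk {a b c d : Angle} (h : sbtw a c b) (h' : sbtw b d a) :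
    Leaf.Crosses s(a, b) s(c, d) := ⟨a, b, c, d, rfl, rfl, h, h'⟩

theorem doubling_sub (x c : Angle) : doubling (x - c) = doubling x - doubling c := by
  unfold doubling; abel

theorem sbtw_sub_right {p u q : Angle} (c : Angle) :
    sbtw (p - c) (u - c) (q - c) ↔ sbtw p u q := by
  simpa [sub_eq_add_neg] using sbtw_add_right (-c)

/-- A point outside a closed set with at least two points lies in a complementary arc. -/
theorem exists_isNext_around {X : Set Angle} (hX : IsClosed X) {x₁ x₂ : Angle} (h₁ : x₁ ∈ X)
    (h₂ : x₂ ∈ X) (hne : x₁ ≠ x₂) {c : Angle} (hc : c ∉ X) :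
    ∃ u v, IsNext X u v ∧ sbtw u c v := by
  have hcont : ContinuousOn (fun z : Angle => rep (z - c)) X := by
    intro z hz
    have hzc : z - c ≠ 0 := sub_ne_zero.2 fun h => hc (h ▸ hz)
    exact (ContinuousAt.comp (f := fun z : Angle => z - c) (g := rep) (continuousAt_rep hzc)
      (by fun_prop)).continuousWithinAt
  have hcomp : IsCompact X := hX.isCompact
  obtain ⟨v, hv, hvmin⟩ := hcomp.exists_isMinOn ⟨x₁, h₁⟩ hcont
  obtain ⟨u, hu, humax⟩ := hcomp.exists_isMaxOn ⟨x₁, h₁⟩ hcont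
  rw [isMinOn_iff] at hvmin
  rw [isMaxOn_iff] at humax
  have hlt : rep (v - c) < rep (u - c) := by
    refine lt_of_le_of_ne (hvmin u hu) fun h => hne ?_
    have e1 := le_antisymm ((humax x₁ h₁).trans h.ge) (hvmin x₁ h₁)
    have e2 := le_antisymm ((humax x₂ h₂).trans h.ge) (hvmin x₂ h₂)
    have := rep_injective (e1.trans e2.symm)
    simpa using this
  have hv0 : 0 < rep (v - c) := rep_pos (sub_ne_zero.2 fun h => hc (h ▸ hv))
  refine ⟨u, v, ⟨hu, hv, ?_, ?_⟩, ?_⟩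
  · rintro rfl; exact lt_irrefl _ hlt
  · intro z hz h
    rw [← sbtw_sub_right c, sbtw_iff_rep] at h
    have h1 := hvmin z hz
    have h2 := humax z hz
    rcases h with h | h | h <;> linarith
  · rw [← sbtw_sub_right c, sbtw_iff_rep]
    simp only [sub_self, rep_zero]
    right; left; exact ⟨hv0, hlt⟩

/-- A leaf does not separate two points of the trace of a gap. -/
theorem IsGap.not_separated {L : Set Leaf} (hcross : ∀ l ∈ L, ∀ l' ∈ L, ¬ l.Crosses l')
    {X : Set Angle} (hX : IsGap L X) {c d z₁ z₂ : Angle} (hl : s(c, d) ∈ L) (h₁ : z₁ ∈ X)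
    (h₂ : z₂ ∈ X) (s₁ : sbtw c z₁ d) (s₂ : sbtw d z₂ c) : False := by
  -- If `c` is not in `X`, it lies in a complementary arc bounded by a side `uv` of the gap. Since
  -- `z₁` and `z₂` separate `d` from this arc, the leaf `cd` crosses that side.
  have aux : ∀ {c d z₁ z₂ : Angle}, s(c, d) ∈ L → z₁ ∈ X → z₂ ∈ X → sbtw c z₁ d → sbtw d z₂ c →
      c ∉ X → False := by
    intro c d z₁ z₂ hl h₁ h₂ s₁ s₂ hc
    have hne : z₁ ≠ z₂ := by
      rintro rfl
      exact sbtw_asymm s₁ s₂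
    obtain ⟨u, v, huv, hs⟩ := exists_isNext_around hX.1 h₁ h₂ hne hc
    have huvL : s(u, v) ∈ L := (hX.2.2 u huv.1 v huv.2.1 huv.2.2.1).2 (Or.inl huv)
    refine hcross _ huvL _ hl (Leaf.crosses_mk hs ?_)
    have n1 := huv.2.2.2 z₁ h₁
    have n2 := huv.2.2.2 z₂ h₂
    rw [← sbtw_sub_right c, sbtw_iff_rep] at *
    simp only [sub_self, rep_zero] at *
    have p1 := rep_nonneg (u - c)
    have p2 := rep_nonneg (v - c)
    have p3 := rep_nonneg (z₁ - c)
    have p4 := rep_nonneg (z₂ - c)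
    have p5 := rep_nonneg (d - c)
    push Not at n1 n2
    have e1 : rep (z₁ - c) < rep (d - c) := by rcases s₁ with h | h | h <;> linarith
    have e2 : rep (d - c) < rep (z₂ - c) := by rcases s₂ with h | h | h <;> linarith
    have e3 : rep (v - c) < rep (u - c) := by rcases hs with h | h | h <;> linarith
    have e4 : rep (v - c) ≤ rep (z₁ - c) := by
      by_contra h; push Not at h; linarith [n1.2.1 h]
    have e5 : rep (z₂ - c) ≤ rep (u - c) := by
      by_contra h; push Not at h; linarith [n2.2.2 e3]
    left; constructor <;> linarith
  by_cases hc : c ∈ X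
  · by_cases hd : d ∈ X
    · have hcd : c ≠ d := (sbtw_ne s₁).2.2
      rcases (hX.2.2 c hc d hd hcd).1 hl with h | h
      · exact h.2.2.2 _ h₁ s₁
      · exact h.2.2.2 _ h₂ s₂
    · exact aux (by rwa [Sym2.eq_swap]) h₂ h₁ s₂ s₁ hd
  · exact aux hl h₁ h₂ s₁ s₂ hc

/-- On a closed half-circle doubling is injective except that it identifies the two ends, so it
cannot reverse the cyclic order. The negative conclusion allows for this identification. -/
theorem not_sbtw_doubling_of_rep_le {x y z : Angle} (hx : rep x ≤ 1 / 2) (hy : rep y ≤ 1 / 2)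
    (hz : rep z ≤ 1 / 2) (h : sbtw x y z) : ¬ sbtw (doubling z) (doubling y) (doubling x) := by
  rw [sbtw_iff_rep] at *
  intro h'
  have := rep_nonneg x
  have := rep_nonneg y
  have := rep_nonneg z
  rcases rep_doubling x with h1 | h1 <;> rcases rep_doubling y with h2 | h2 <;>
    rcases rep_doubling z with h3 | h3 <;> rw [h1.2, h2.2, h3.2] at h' <;>
    rcases h with h | h | h <;> rcases h' with h' | h' | h' <;> linarith

theorem sbtw_doubling {u z v : Angle} (h : sbtw u z v) (hv : rep (v - u) < 1 / 2) :
    sbtw (doubling u) (doubling z) (doubling v) := by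
  rw [sbtw_iff_sub] at *
  rw [← doubling_sub, ← doubling_sub]
  rcases rep_doubling (z - u) with h1 | h1 <;> rcases rep_doubling (v - u) with h2 | h2 <;>
    rw [h1.2, h2.2] <;> constructor <;> linarith

/-- An arc shorter than a half-circle is mapped bijectively to its image, so a point of the image
arc has one of its two preimages in the arc. -/
theorem sbtw_of_sbtw_doubling {u z v : Angle} (h : sbtw (doubling u) (doubling z) (doubling v))
    (hv : rep (v - u) < 1 / 2) : sbtw u z v ∨ sbtw u (z + oneHalf) v := by
  rw [sbtw_iff_sub] at *
  rw [sbtw_iff_sub]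
  rw [← doubling_sub, ← doubling_sub, rep_doubling_of_lt hv] at h
  rw [add_sub_right_comm]
  rcases rep_doubling (z - u) with h1 | h1 <;> rcases rep_add_oneHalf (z - u) with h2 | h2 <;>
    rw [h1.2] at h <;> rw [h2.2]
  · left; constructor <;> linarith
  · linarith
  · linarith
  · right; constructor <;> linarith

/-- The hypothesis lists the two possible shapes of a gap. In the symmetric case `u + 1/2` belongs
to `X`, so consecutive points with distinct images are less than `1/2` apart, and a point between
the images lifts to a point of `X` between `u` and `v`. In a half-circle the cyclic order is not
reversed. -/
theorem image_isNext {X : Set Angle}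
    (hX : (∀ p ∈ X, p + oneHalf ∈ X) ∨ ∃ w, ∀ z ∈ X, rep (z - w) ≤ 1 / 2) {u v : Angle}
    (h : IsNext X u v) (hne : doubling u ≠ doubling v) :
    IsNext (doubling '' X) (doubling u) (doubling v) := by
  refine ⟨⟨u, h.1, rfl⟩, ⟨v, h.2.1, rfl⟩, hne, ?_⟩
  rintro _ ⟨z, hz, rfl⟩ hs
  rcases hX with hsym | ⟨w, hw⟩
  · have hv : rep (v - u) < 1 / 2 := by
      have h1 := h.2.2.2 _ (hsym u h.1)
      rw [← sbtw_sub_right u, sbtw_iff_rep] at h1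
      have e1 : u + oneHalf - u = oneHalf := by abel
      rw [e1, sub_self, rep_zero, rep_oneHalf] at h1
      push Not at h1
      refine lt_of_le_of_ne (h1.1 (by norm_num)) fun h2 => hne ?_
      rw [← rep_oneHalf] at h2
      have := rep_injective h2
      rw [doubling_eq_iff]
      right
      rw [← add_left_inj oneHalf, add_oneHalf_add_oneHalf, ← this]; abel
    rcases sbtw_of_sbtw_doubling hs hv with h1 | h1
    · exact h.2.2.2 _ hz h1
    · exact h.2.2.2 _ (hsym z hz) h1
  · have hn := sbtw_ne hs
    have huz : u ≠ z := fun e => hn.1 (by rw [e])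
    have hzv : z ≠ v := fun e => hn.2.1 (by rw [e])
    rcases sbtw_or_sbtw huz hzv h.2.2.1 with h1 | h1
    · exact h.2.2.2 _ hz h1
    · rw [← sbtw_sub_right w] at h1
      have := not_sbtw_doubling_of_rep_le (hw _ h.2.1) (hw _ hz) (hw _ h.1) h1
      simp only [doubling_sub, sbtw_sub_right] at this
      exact this hs

/-- Among the finitely many pairs of lifts of `U` and `V` in `X`, one with the shortest arc from `u`
to `v` has no point of `X` inside. -/
theorem exists_isNext_of_image {X : Set Angle}
    (hX : (∀ p ∈ X, p + oneHalf ∈ X) ∨ ∃ w, ∀ z ∈ X, rep (z - w) ≤ 1 / 2) {U V : Angle}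
    (h : IsNext (doubling '' X) U V) :
    ∃ u v, IsNext X u v ∧ doubling u = U ∧ doubling v = V := by
  obtain ⟨⟨u₀, hu₀, rfl⟩, ⟨v₀, hv₀, rfl⟩, hne, hno⟩ := h
  set F : Set (Angle × Angle) := {z | (z.1 ∈ X ∧ doubling z.1 = doubling u₀) ∧
    z.2 ∈ X ∧ doubling z.2 = doubling v₀} with hF
  have hfin : F.Finite := by
    have : F ⊆ ({u₀, u₀ + oneHalf} : Set Angle) ×ˢ ({v₀, v₀ + oneHalf} : Set Angle) := by
      rintro ⟨x, y⟩ ⟨⟨_, h1⟩, _, h2⟩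
      exact ⟨doubling_eq_iff.1 h1, doubling_eq_iff.1 h2⟩
    exact Set.Finite.subset (Set.Finite.prod (by simp) (by simp)) this
  obtain ⟨⟨u, v⟩, ⟨⟨hu, hDu⟩, hv, hDv⟩, hmin⟩ :=
    Set.exists_min_image F (fun z => rep (z.2 - z.1)) hfin ⟨(u₀, v₀), ⟨hu₀, rfl⟩, hv₀, rfl⟩
  simp only at hu hDu hv hDv hmin
  refine ⟨u, v, ⟨hu, hv, fun e => hne (by rw [← hDu, ← hDv, e]), ?_⟩, hDu, hDv⟩
  intro z hz hs
  have hs' := sbtw_iff_sub.1 hs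
  have hrev : ¬ sbtw (doubling v) (doubling z) (doubling u) := by
    rcases hX with hsym | ⟨w, hw⟩
    · have hlt : rep (v - u) < 1 / 2 := by
        have h1 := hmin (u, v + oneHalf) ⟨⟨hu, hDu⟩, hsym v hv, by simpa using hDv⟩
        simp only at h1
        rw [add_sub_right_comm] at h1
        rcases rep_add_oneHalf (v - u) with h2 | h2
        · exact h2.1
        · rw [h2.2] at h1; linarith
      exact sbtw_asymm (sbtw_doubling hs hlt)
    · rw [← sbtw_sub_right w] at hs
      have := not_sbtw_doubling_of_rep_le (hw _ hu) (hw _ hz) (hw _ hv) hs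
      simpa only [doubling_sub, sbtw_sub_right] using this
  have hs2 := sbtw_iff_sub.1 (sbtw_cyclic_right hs)
  by_cases h1 : doubling z = doubling u
  · have h2 := hmin (z, v) ⟨⟨hz, h1.trans hDu⟩, hv, hDv⟩
    simp only at h2
    rcases rep_sub (v - u) (z - u) with h3 | h3
    · rw [sub_sub_sub_cancel_right] at h3
      linarith
    · linarith
  by_cases h2 : doubling z = doubling v
  · have h3 := hmin (u, z) ⟨⟨hu, hDu⟩, hz, h2.trans hDv⟩
    simp only at h3
    linarith
  rcases sbtw_or_sbtw (Ne.symm h1) h2 (by rw [hDu, hDv]; exact hne) with h3 | h3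
  · rw [hDu, hDv] at h3
    exact hno _ ⟨z, hz, rfl⟩ h3
  · exact hrev h3

section GapImage

variable {L : Set Leaf} (hcross : ∀ l ∈ L, ∀ l' ∈ L, ¬ l.Crosses l')
  (hsymm : ∀ x y, s(x, y) ∈ L → s(x + oneHalf, y + oneHalf) ∈ L)
  (hpre : ∀ u v, s(u, v) ∈ L → ∃ x y, s(x, y) ∈ L ∧ doubling x = u ∧ doubling y = v)
  {X : Set Angle} (hX : IsGap L X)

include hcross hsymm hX in
/-- The trace of a gap is symmetric or contained in a closed half-circle. -/
theorem IsGap.symmetric_or_half :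
    (∀ p ∈ X, p + oneHalf ∈ X) ∨ ∃ v, ∀ z ∈ X, rep (z - v) ≤ 1 / 2 := by
  by_contra! hcon
  obtain ⟨⟨p, hp, hp'⟩, hhalf⟩ := hcon
  have h3 : ∃ x₂ ∈ X, p ≠ x₂ := by
    by_contra! h
    have : X ⊆ {p} := fun z hz => (h z hz).symm
    have h1 := (Set.encard_le_encard this).trans_eq (Set.encard_singleton p)
    have := hX.2.1.trans h1
    norm_num at this
  obtain ⟨x₂, hx₂, hne⟩ := h3
  -- The side `uv` faces the missing point `p + 1/2`. As `X` is in no half-circle, the arc from `v`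
  -- to `u` is longer than `1/2`, and the half-turn of this side separates `p` from `u`.
  obtain ⟨u, v, huv, hs⟩ := exists_isNext_around hX.1 hp hx₂ hne hp'
  have huvL : s(u, v) ∈ L := (hX.2.2 u huv.1 v huv.2.1 huv.2.2.1).2 (Or.inl huv)
  have hmax : ∀ z ∈ X, rep (z - v) ≤ rep (u - v) := by
    intro z hz
    by_contra! h
    apply huv.2.2.2 z hz
    rw [← sbtw_sub_right v, sbtw_iff_rep]
    right; right
    refine ⟨?_, h⟩
    simpa using rep_pos (sub_ne_zero.2 huv.2.2.1)
  obtain ⟨z, hz, hz'⟩ := hhalf v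
  have hlen : 1 / 2 < rep (u - v) := lt_of_lt_of_le hz' (hmax z hz)
  refine hX.not_separated hcross (hsymm u v huvL) hp huv.1 ?_ ?_
  · rw [← sbtw_add_right oneHalf]; simpa using hs
  · rw [← sbtw_sub_right v, sbtw_iff_rep]
    have e1 : v + oneHalf - v = oneHalf := by abel
    have e2 : u + oneHalf - v = (u - v) + oneHalf := by abel
    rw [e1, e2, rep_oneHalf]
    have := rep_lt_one (u - v)
    rcases rep_add_oneHalf (u - v) with h | h <;> rw [h.2]
    · linarith
    · right; right; constructor <;> linarith

include hcross hsymm hpre hX in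
-- If `uv` is not a leaf, the preimages of the image leaf join `u` to `v + 1/2` and `u + 1/2` to
-- `v`. Were the image chord not a side, `X` would have points over both of its sides, and one of
-- these two preimages would separate points of `X`.
theorem IsGap.image_isNext_of_mem {u v : Angle} (hu : u ∈ X) (hv : v ∈ X)
    (hne : doubling u ≠ doubling v) (hl : s(doubling u, doubling v) ∈ L) :
    IsNext (doubling '' X) (doubling u) (doubling v) ∨
      IsNext (doubling '' X) (doubling v) (doubling u) := by
  have huv : u ≠ v := fun e => hne (by rw [e])
  by_cases h : s(u, v) ∈ L
  · rcases (hX.2.2 u hu v hv huv).1 h with h | h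
    · exact Or.inl (image_isNext (hX.symmetric_or_half hcross hsymm) h hne)
    · exact Or.inr (image_isNext (hX.symmetric_or_half hcross hsymm) h hne.symm)
  have h' : s(u, v + oneHalf) ∈ L ∧ s(u + oneHalf, v) ∈ L := by
    obtain ⟨x, y, hxy, hx, hy⟩ := hpre _ _ hl
    have hxy' := hsymm _ _ hxy
    rcases doubling_eq_iff.1 hx with rfl | rfl <;> rcases doubling_eq_iff.1 hy with rfl | rfl
    · exact absurd hxy h
    · exact ⟨hxy, by simpa using hxy'⟩
    · exact ⟨by simpa using hxy', hxy⟩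
    · exact absurd (by simpa using hxy') h
  by_contra! hcon
  have sep := fun {c d z₁ z₂ : Angle} => hX.not_separated hcross (c := c) (d := d) (z₁ := z₁)
    (z₂ := z₂)
  obtain ⟨hc1, hc2⟩ := hcon
  have hz : ∃ z ∈ X, sbtw (doubling u) (doubling z) (doubling v) := by
    by_contra! h1
    exact hc1 ⟨⟨u, hu, rfl⟩, ⟨v, hv, rfl⟩, hne, by rintro _ ⟨z, hz, rfl⟩; exact h1 z hz⟩
  have hw : ∃ z ∈ X, sbtw (doubling v) (doubling z) (doubling u) := by
    by_contra! h1
    exact hc2 ⟨⟨v, hv, rfl⟩, ⟨u, hu, rfl⟩, hne.symm, by rintro _ ⟨z, hz, rfl⟩; exact h1 z hz⟩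
  obtain ⟨z, hz, hz'⟩ := hz
  obtain ⟨w, hw, hw'⟩ := hw
  have hvu : v - u ≠ 0 := sub_ne_zero.2 huv.symm
  have hvu0 := rep_pos hvu
  have hvu1 := rep_lt_one (v - u)
  have hw0 := rep_nonneg (w - u)
  have hw1' := rep_lt_one (w - u)
  have hvuh : rep (v - u) ≠ 1 / 2 := by
    intro h1
    rw [← rep_oneHalf, rep_inj] at h1
    apply hne
    rw [doubling_eq_iff]; right
    rw [← add_left_inj oneHalf, add_oneHalf_add_oneHalf, ← h1]; abel
  have e1 : v + oneHalf - u = v - u + oneHalf := by abel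
  have e2 : u + oneHalf - u = oneHalf := by abel
  have swp : s(v + oneHalf, u) ∈ L ∧ s(v, u + oneHalf) ∈ L :=
    ⟨by rw [Sym2.eq_swap]; exact h'.1, by rw [Sym2.eq_swap]; exact h'.2⟩
  rw [← sbtw_sub_right (doubling u), sbtw_iff_rep, sub_self, rep_zero, ← doubling_sub,
    ← doubling_sub] at hz' hw'
  rcases rep_doubling (v - u) with hv1 | hv1 <;> rw [hv1.2] at hz' hw' <;>
    rcases rep_add_oneHalf (v - u) with hv2 | hv2
  · rcases rep_doubling (w - u) with hw1 | hw1 <;> rw [hw1.2] at hw'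
    · refine sep swp.2 hw hu ?_ ?_ <;> rw [← sbtw_sub_right u, sbtw_iff_rep, e2, rep_oneHalf]
      · left
        exact ⟨by rcases hw' with h | h | h <;> linarith, by linarith⟩
      · simp only [sub_self, rep_zero]
        right; left; exact ⟨hvu0, by linarith⟩
    · refine sep swp.1 hw hv ?_ ?_ <;>
        rw [← sbtw_sub_right u, sbtw_iff_rep, e1, hv2.2, sub_self, rep_zero]
      · right; right
        exact ⟨by linarith, by rcases hw' with h | h | h <;> linarith⟩
      · left; exact ⟨hvu0, by linarith⟩
  · linarith
  · linarith
  · have hv3 : 1 / 2 < rep (v - u) := lt_of_le_of_ne hv1.1 (Ne.symm hvuh)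
    have := rep_lt_one (z - u)
    rcases rep_doubling (z - u) with hz1 | hz1 <;> rw [hz1.2] at hz'
    · refine sep h'.1 hz hv ?_ ?_ <;>
        rw [← sbtw_sub_right u, sbtw_iff_rep, e1, hv2.2, sub_self, rep_zero]
      · left; constructor <;> rcases hz' with h | h | h <;> linarith
      · right; right; constructor <;> linarith
    · refine sep h'.2 hz hu ?_ ?_ <;> rw [← sbtw_sub_right u, sbtw_iff_rep, e2, rep_oneHalf]
      · left
        exact ⟨by rcases hz' with h | h | h <;> linarith, by
          rcases hz' with h | h | h <;> linarith⟩
      · simp only [sub_self, rep_zero]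
        right; left; constructor <;> linarith

end GapImage

/-- For a lamination which is symmetric under the half-turn and in which every leaf has a preimage,
the condition on gaps is automatic. -/
theorem isInvariantLamination_of_symmetric {L : Set Leaf} (hdiag : ∀ x : Angle, s(x, x) ∈ L)
    (hcross : ∀ l ∈ L, ∀ l' ∈ L, ¬ l.Crosses l')
    (hclosed : IsClosed {z : Angle × Angle | s(z.1, z.2) ∈ L})
    (hfwd : ∀ l ∈ L, l.image ∈ L)
    (hsymm : ∀ x y, s(x, y) ∈ L → s(x + oneHalf, y + oneHalf) ∈ L)
    (hpre : ∀ u v, s(u, v) ∈ L → ∃ x y, s(x, y) ∈ L ∧ doubling x = u ∧ doubling y = v) :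
    IsInvariantLamination L where
  degenerate_mem := hdiag
  not_crosses := hcross
  closed := hclosed
  forward := hfwd
  backward := by
    intro l hl
    induction l using Sym2.ind with
    | _ u v =>
      -- Over a degenerate leaf the given preimage may be a diameter, which equals its own
      -- half-turn; the two points `x` and `x + 1/2` serve instead.
      by_cases huv : u = v
      · subst huv
        obtain ⟨x, -, -, hx, -⟩ := hpre u u hl
        refine ⟨s(x, x), hdiag x, s(x + oneHalf, x + oneHalf), hdiag _, ?_, ?_, ?_⟩
        · simp [Leaf.image, hx]
        · simp [Leaf.image, hx]
        · simpa using (add_oneHalf_ne x).symm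
      · obtain ⟨x, y, hxy, hx, hy⟩ := hpre u v hl
        refine ⟨s(x, y), hxy, s(x + oneHalf, y + oneHalf), hsymm _ _ hxy, ?_, ?_, ?_⟩
        · simp [Leaf.image, hx, hy]
        · simp [Leaf.image, hx, hy]
        · have h1 : doubling x ≠ doubling y := by rwa [hx, hy]
          have h2 : x ≠ y + oneHalf := fun e => h1 (doubling_eq_iff.2 (Or.inr e))
          have h3 : y ≠ x + oneHalf := fun e => h1 (doubling_eq_iff.2 (Or.inr e)).symm
          simp [h2, h3, (add_oneHalf_ne x).symm, (add_oneHalf_ne y).symm]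
  gap := by
    intro X hX
    have hnext : ∀ U V, IsNext (doubling '' X) U V → s(U, V) ∈ L := by
      intro U V h
      obtain ⟨u, v, huv, rfl, rfl⟩ := exists_isNext_of_image (hX.symmetric_or_half hcross hsymm) h
      exact hfwd _ ((hX.2.2 u huv.1 v huv.2.1 huv.2.2.1).2 (Or.inl huv))
    have hne : X.Nonempty := by
      rw [Set.nonempty_iff_ne_empty]
      rintro rfl
      have := hX.2.1
      simp at this
    obtain ⟨p, hp⟩ := hne
    by_cases h1 : ∀ z ∈ doubling '' X, z = doubling p
    · left
      exact ⟨doubling p, Set.eq_singleton_iff_unique_mem.2 ⟨⟨p, hp, rfl⟩, h1⟩⟩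
    push Not at h1
    obtain ⟨V, hV, hVne⟩ := h1
    by_cases h2 : ∀ z ∈ doubling '' X, z = doubling p ∨ z = V
    · right; left
      have heq : doubling '' X = {doubling p, V} := by
        ext z
        constructor
        · exact h2 z
        · rintro (rfl | rfl)
          · exact ⟨p, hp, rfl⟩
          · exact hV
      refine ⟨doubling p, V, hVne.symm, heq, hnext _ _ ⟨⟨p, hp, rfl⟩, hV, hVne.symm, ?_⟩⟩
      intro z hz hs
      rcases h2 z hz with rfl | rfl
      · exact sbtw_irrefl_left hs
      · exact sbtw_irrefl_right hs
    push Not at h2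
    obtain ⟨W, hW, hW1, hW2⟩ := h2
    right; right
    refine ⟨⟨(hX.1.isCompact.image doubling_continuous).isClosed, ?_, ?_⟩, ?_⟩
    · have h3 : ({doubling p, V, W} : Set Angle).encard = 3 :=
        Set.encard_eq_three.2 ⟨_, _, _, hVne.symm, hW1.symm, hW2.symm, rfl⟩
      rw [← h3]
      apply Set.encard_le_encard
      rintro z (rfl | rfl | rfl)
      · exact ⟨p, hp, rfl⟩
      · exact hV
      · exact hW
    · rintro _ ⟨u, hu, rfl⟩ _ ⟨v, hv, rfl⟩ huv
      constructor
      · exact hX.image_isNext_of_mem hcross hsymm hpre hu hv huv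
      · rintro (h | h)
        · exact hnext _ _ h
        · rw [Sym2.eq_swap]; exact hnext _ _ h
    · intro u v huv
      by_cases h : doubling u = doubling v
      · exact Or.inl h
      · exact Or.inr (image_isNext (hX.symmetric_or_half hcross hsymm) huv h)

end Surgery

/-! ### Itineraries with respect to four arcs, and the lamination they define -/

namespace Surgery

/-- The four arcs cut out by the preimages of the endpoints of a chord. -/
inductive ArcIndex
  | left
  | lower
  | right
  | upper

instance : Finite ArcIndex :=
  Finite.of_surjective ![ArcIndex.left, .lower, .right, .upper] fun i => by
    cases i
    exacts [⟨0, rfl⟩, ⟨1, rfl⟩, ⟨2, rfl⟩, ⟨3, rfl⟩]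

/-- The four closed arcs between consecutive points of `a/2 ≤ b/2 ≤ (a+1)/2 ≤ (b+1)/2`. -/
def arc (a b : ℝ) : ArcIndex → Set Angle
  | .left => {z | rep z ≤ a / 2 ∨ (b + 1) / 2 ≤ rep z}
  | .lower => {z | a / 2 ≤ rep z ∧ rep z ≤ b / 2}
  | .right => {z | b / 2 ≤ rep z ∧ rep z ≤ (a + 1) / 2}
  | .upper => {z | (a + 1) / 2 ≤ rep z ∧ rep z ≤ (b + 1) / 2}

/-- The antipodal arc. -/
def ArcIndex.opp : ArcIndex → ArcIndex
  | .left => .right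
  | .lower => .upper
  | .right => .left
  | .upper => .lower

/-- The image of an arc under doubling: the outer or the inner arc of the chord. -/
def arcImage (a b : ℝ) : ArcIndex → Set Angle
  | .left => {z | rep z ≤ a ∨ b ≤ rep z}
  | .lower => {z | a ≤ rep z ∧ rep z ≤ b}
  | .right => {z | rep z ≤ a ∨ b ≤ rep z}
  | .upper => {z | a ≤ rep z ∧ rep z ≤ b}

/-- The points with a given itinerary with respect to the four arcs. -/
def itinSet (a b : ℝ) (s : ℕ → ArcIndex) : Set Angle :=
  {x | ∀ n, doubling^[n] x ∈ arc a b (s n)}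

@[simp] theorem ArcIndex.opp_opp (i : ArcIndex) : i.opp.opp = i := by cases i <;> rfl

section Arcs

variable {a b : ℝ} (h0 : 0 < a) (hab : a ≤ b) (h1 : b < 1)

include h0 hab h1

theorem add_oneHalf_mem_arc_opp {z : Angle} {i : ArcIndex} (h : z ∈ arc a b i) :
    z + oneHalf ∈ arc a b i.opp := by
  have := rep_nonneg z
  have := rep_lt_one z
  rcases rep_add_oneHalf z with hz | hz <;> cases i <;>
    simp only [arc, ArcIndex.opp, Set.mem_ofPred_eq] at * <;> rw [hz.2]
  · rcases h with h | h <;> constructor <;> linarith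
  · constructor <;> linarith
  · right; linarith
  · constructor <;> linarith
  · rcases h with h | h <;> constructor <;> linarith
  · constructor <;> linarith
  · left; linarith
  · constructor <;> linarith

theorem exists_rep_sub_le_of_arc (i : ArcIndex) : ∃ w, ∀ z ∈ arc a b i, rep (z - w) ≤ 1 / 2 := by
  have key : ∀ i : ArcIndex, (∃ w, ∀ z ∈ arc a b i, rep (z - w) ≤ 1 / 2) →
      ∃ w, ∀ z ∈ arc a b i.opp, rep (z - w) ≤ 1 / 2 := by
    rintro i ⟨w, hw⟩
    refine ⟨w + oneHalf, fun z hz => ?_⟩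
    have h2 := hw _ (by simpa using add_oneHalf_mem_arc_opp h0 hab h1 hz)
    have e : z - (w + oneHalf) = z + oneHalf - w := by
      rw [← add_left_inj oneHalf]
      have : z + oneHalf - w + oneHalf = z + oneHalf + oneHalf - w := by abel
      rw [this, add_oneHalf_add_oneHalf]; abel
    rwa [e]
  have hR : ∃ w, ∀ z ∈ arc a b .right, rep (z - w) ≤ 1 / 2 := by
    refine ⟨((b / 2 : ℝ) : Angle), fun z hz => ?_⟩
    have e := rep_coe (t := b / 2) (by linarith) (by linarith)
    have hz1 := hz.1
    have hz2 := hz.2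
    rcases rep_sub z ((b / 2 : ℝ) : Angle) with h | h <;> rw [e] at h <;> rw [h.2] <;> linarith
  have hK : ∃ w, ∀ z ∈ arc a b .lower, rep (z - w) ≤ 1 / 2 := by
    refine ⟨((a / 2 : ℝ) : Angle), fun z hz => ?_⟩
    have e := rep_coe (t := a / 2) (by linarith) (by linarith)
    have hz1 := hz.1
    have hz2 := hz.2
    rcases rep_sub z ((a / 2 : ℝ) : Angle) with h | h <;> rw [e] at h <;> rw [h.2] <;> linarith
  cases i
  · exact key _ hR
  · exact hK
  · exact hR
  · exact key _ hK

theorem arc_not_cross {i j : ArcIndex} (hij : i ≠ j) {p q u v : Angle} (hp : p ∈ arc a b i)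
    (hq : q ∈ arc a b i) (hu : u ∈ arc a b j) (hv : v ∈ arc a b j) (s₁ : sbtw p u q)
    (s₂ : sbtw q v p) : False := by
  rw [sbtw_iff_rep] at s₁ s₂
  cases i <;> cases j <;> simp only [ne_eq, not_true_eq_false, reduceCtorEq,
    not_false_eq_true, arc, Set.mem_ofPred_eq] at * <;>
  first
  | (rcases s₁ with s₁ | s₁ | s₁ <;> rcases s₂ with s₂ | s₂ | s₂ <;> linarith)
  | (rcases hp with hp | hp <;> rcases hq with hq | hq <;>
      rcases s₁ with s₁ | s₁ | s₁ <;> rcases s₂ with s₂ | s₂ | s₂ <;> linarith)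
  | (rcases hu with hu | hu <;> rcases hv with hv | hv <;>
      rcases s₁ with s₁ | s₁ | s₁ <;> rcases s₂ with s₂ | s₂ | s₂ <;> linarith)

theorem doubling_mem_arcImage {z : Angle} {i : ArcIndex} (h : z ∈ arc a b i) :
    doubling z ∈ arcImage a b i := by
  have := rep_nonneg z
  have := rep_lt_one z
  rcases rep_doubling z with hz | hz <;> cases i <;>
    simp only [arc, arcImage, Set.mem_ofPred_eq] at * <;> rw [hz.2]
  · rcases h with h | h
    · left; linarith
    · linarith
  · constructor <;> linarith
  · right; linarith
  · constructor <;> linarith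
  · rcases h with h | h
    · linarith
    · right; linarith
  · constructor <;> linarith
  · left; linarith
  · constructor <;> linarith

theorem exists_mem_arc_of_mem_arcImage {y : Angle} {i : ArcIndex} (h : y ∈ arcImage a b i) :
    ∃ z ∈ arc a b i, doubling z = y := by
  have key : ∀ i : ArcIndex, (∃ z ∈ arc a b i, doubling z = y) →
      ∃ z ∈ arc a b i.opp, doubling z = y := by
    rintro i ⟨z, hz, rfl⟩
    exact ⟨z + oneHalf, add_oneHalf_mem_arc_opp h0 hab h1 hz, by simp⟩
  have hy0 := rep_nonneg y
  have hy1 := rep_lt_one y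
  have e1 : rep ((rep y / 2 : ℝ) : Angle) = rep y / 2 := rep_coe (by linarith) (by linarith)
  have e2 : rep (((rep y + 1) / 2 : ℝ) : Angle) = (rep y + 1) / 2 :=
    rep_coe (by linarith) (by linarith)
  have d1 : doubling ((rep y / 2 : ℝ) : Angle) = y := by
    apply rep_injective
    rw [rep_doubling_of_lt (by rw [e1]; linarith), e1]; ring
  have d2 : doubling (((rep y + 1) / 2 : ℝ) : Angle) = y := by
    apply rep_injective
    rw [rep_doubling_of_le (by rw [e2]; linarith), e2]; ring
  have hR : y ∈ arcImage a b .right → ∃ z ∈ arc a b .right, doubling z = y := by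
    rintro (h | h)
    · exact ⟨_, ⟨by rw [e2]; linarith, by rw [e2]; linarith⟩, d2⟩
    · exact ⟨_, ⟨by rw [e1]; linarith, by rw [e1]; linarith⟩, d1⟩
  have hK : y ∈ arcImage a b .lower → ∃ z ∈ arc a b .lower, doubling z = y := by
    rintro ⟨h, h'⟩
    exact ⟨_, ⟨by rw [e1]; linarith, by rw [e1]; linarith⟩, d1⟩
  cases i
  · exact key _ (hR h)
  · exact hK h
  · exact hR h
  · exact key _ (hK h)

/-- An arc contains two antipodal points only if it is a closed half-circle. This happens for the
left and right arcs when `a = b`, and the points are then the ends of the arc. -/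
theorem eq_of_doubling_eq_of_mem_arc {x y : Angle} {i : ArcIndex} (hx : x ∈ arc a b i)
    (hy : y ∈ arc a b i) (hne : x ≠ y) (h : doubling x = doubling y) :
    a = b ∧ rep (doubling x) = a := by
  have hxy : x = y + oneHalf := (doubling_eq_iff.1 h).resolve_left hne
  have hR : ∀ x y : Angle, x ∈ arc a b .right → y ∈ arc a b .right → x = y + oneHalf →
      a = b ∧ rep (doubling x) = a := by
    rintro x y ⟨hx1, hx2⟩ ⟨hy1, hy2⟩ hxy
    rcases rep_add_oneHalf y with h2 | h2 <;> rw [← hxy] at h2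
    · have e : a = b := by linarith
      refine ⟨e, ?_⟩
      rw [rep_doubling_of_le (by linarith)]; linarith
    · have e : a = b := by linarith
      refine ⟨e, ?_⟩
      rw [rep_doubling_of_lt (by linarith)]; linarith
  have hK : ∀ x y : Angle, x ∈ arc a b .lower → y ∈ arc a b .lower → x = y + oneHalf →
      a = b ∧ rep (doubling x) = a := by
    rintro x y ⟨hx1, hx2⟩ ⟨hy1, hy2⟩ hxy
    rcases rep_add_oneHalf y with h2 | h2 <;> rw [← hxy] at h2 <;> linarith
  cases i
  · simpa using hR _ _ (add_oneHalf_mem_arc_opp h0 hab h1 hx)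
      (add_oneHalf_mem_arc_opp h0 hab h1 hy) (by rw [hxy])
  · exact hK _ _ hx hy hxy
  · exact hR _ _ hx hy hxy
  · simpa using hK _ _ (add_oneHalf_mem_arc_opp h0 hab h1 hx)
      (add_oneHalf_mem_arc_opp h0 hab h1 hy) (by rw [hxy])

/-- Every point of the image of an arc lifts to the arc. So the image of a class is the class of the
shifted itinerary, cut off at the chord; `itinSet_subset_arcImage` controls this cut. -/
theorem image_itinSet (s : ℕ → ArcIndex) :
    doubling '' itinSet a b s = itinSet a b (fun n => s (n + 1)) ∩ arcImage a b (s 0) := by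
  ext y
  constructor
  · rintro ⟨x, hx, rfl⟩
    exact ⟨fun n => hx (n + 1), doubling_mem_arcImage h0 hab h1 (hx 0)⟩
  · rintro ⟨hy, hy'⟩
    obtain ⟨z, hz, rfl⟩ := exists_mem_arc_of_mem_arcImage h0 hab h1 hy'
    refine ⟨z, fun n => ?_, rfl⟩
    cases n with
    | zero => exact hz
    | succ n => exact hy n

theorem isClosed_arc (i : ArcIndex) : IsClosed (arc a b i) := by
  have hI : ∀ α β : ℝ, 0 ≤ α → β < 1 → IsClosed {z : Angle | α ≤ rep z ∧ rep z ≤ β} := by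
    intro α β hα hβ
    have : {z : Angle | α ≤ rep z ∧ rep z ≤ β} = (fun t : ℝ => (t : Angle)) '' Set.Icc α β := by
      ext z
      constructor
      · intro hz
        exact ⟨rep z, hz, coe_rep z⟩
      · rintro ⟨t, ht, rfl⟩
        have := rep_coe (t := t) (by linarith [ht.1]) (by linarith [ht.2])
        rw [Set.mem_ofPred_eq, this]
        exact ht
    rw [this]
    exact (isCompact_Icc.image (AddCircle.continuous_mk' 1)).isClosed
  cases i
  · have : arc a b .left = (fun z => z + oneHalf) ⁻¹' arc a b .right := by
      ext z
      constructor
      · exact add_oneHalf_mem_arc_opp h0 hab h1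
      · intro h
        have h2 : z + oneHalf ∈ arc a b .right := h
        have h3 := add_oneHalf_mem_arc_opp h0 hab h1 h2
        rwa [add_oneHalf_add_oneHalf] at h3
    rw [this]
    exact (hI (b / 2) ((a + 1) / 2) (by linarith) (by linarith)).preimage (by fun_prop)
  · exact hI _ _ (by linarith) (by linarith)
  · exact hI _ _ (by linarith) (by linarith)
  · exact hI _ _ (by linarith) (by linarith)

end Arcs

theorem sbtw_doubling_of_half {w x y z : Angle} (hx : rep (x - w) ≤ 1 / 2)
    (hy : rep (y - w) ≤ 1 / 2) (hz : rep (z - w) ≤ 1 / 2) (h : sbtw x y z)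
    (hxy : doubling x ≠ doubling y) (hyz : doubling y ≠ doubling z)
    (hxz : doubling x ≠ doubling z) : sbtw (doubling x) (doubling y) (doubling z) := by
  rw [← sbtw_sub_right w] at h
  have := not_sbtw_doubling_of_rep_le hx hy hz h
  simp only [doubling_sub, sbtw_sub_right] at this
  exact (sbtw_or_sbtw hxy hyz hxz).resolve_right this

section ArcLamination

variable {A B : Angle} (h0 : 0 < rep A) (hab : rep A ≤ rep B)
  (hU : A = B → ∀ s s', A ∈ itinSet (rep A) (rep B) s → A ∈ itinSet (rep A) (rep B) s' → s = s')

include h0 hab hU in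
-- Doubling preserves a crossing as long as both classes lie in the same arc, and at a time when the
-- symbols differ two distinct arcs would have to cross. The order could be lost only by identifying
-- the ends of a half-circle, which `hU` excludes.
theorem itinSet_not_cross {s s' : ℕ → ArcIndex} (hss : s ≠ s') {p q u v : Angle}
    (hp : p ∈ itinSet (rep A) (rep B) s) (hq : q ∈ itinSet (rep A) (rep B) s)
    (hu : u ∈ itinSet (rep A) (rep B) s') (hv : v ∈ itinSet (rep A) (rep B) s')
    (s₁ : sbtw p u q) (s₂ : sbtw q v p) : False := by
  have h1 := rep_lt_one B
  obtain ⟨n, hn⟩ := Function.ne_iff.1 hss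
  induction n generalizing s s' p q u v with
  | zero => exact arc_not_cross h0 hab h1 hn (hp 0) (hq 0) (hu 0) (hv 0) s₁ s₂
  | succ n ih =>
    by_cases h00 : s 0 = s' 0
    swap
    · exact arc_not_cross h0 hab h1 h00 (hp 0) (hq 0) (hu 0) (hv 0) s₁ s₂
    have hu' : u ∈ arc (rep A) (rep B) (s 0) := by rw [h00]; exact hu 0
    have hv' : v ∈ arc (rep A) (rep B) (s 0) := by rw [h00]; exact hv 0
    have hp' : p ∈ arc (rep A) (rep B) (s 0) := hp 0
    have hq' : q ∈ arc (rep A) (rep B) (s 0) := hq 0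
    obtain ⟨w, hw⟩ := exists_rep_sub_le_of_arc h0 hab h1 (s 0)
    have hsh : (fun n => s (n + 1)) ≠ fun n => s' (n + 1) := fun e => hn (congrFun e n)
    -- Points of different classes with the same image would have image `A = B`, and `A` would have
    -- two different itineraries.
    have hmix : ∀ x y : Angle, x ∈ itinSet (rep A) (rep B) s → y ∈ itinSet (rep A) (rep B) s' →
        x ≠ y → doubling x ≠ doubling y := by
      intro x y hx hy hne e
      obtain ⟨e1, e2⟩ := eq_of_doubling_eq_of_mem_arc h0 hab h1 (hx 0)
        (by rw [h00]; exact hy 0) hne e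
      have e3 : doubling x = A := rep_injective e2
      refine hsh (hU (rep_injective e1) _ _ (fun n => ?_) fun n => ?_)
      · have := hx (n + 1)
        rwa [Function.iterate_succ_apply, e3] at this
      · have := hy (n + 1)
        rwa [Function.iterate_succ_apply, ← e, e3] at this
    -- Antipodal points of a closed half-circle are its ends, so the half-circle cannot have points
    -- on both sides of them.
    have hsame : ∀ p q u v : Angle, p ∈ arc (rep A) (rep B) (s 0) →
        q ∈ arc (rep A) (rep B) (s 0) → u ∈ arc (rep A) (rep B) (s 0) →
        v ∈ arc (rep A) (rep B) (s 0) → sbtw p u q → sbtw q v p → doubling p ≠ doubling q := by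
      intro p q u v hp hq hu hv s₁ s₂ e
      have hpq : p = q + oneHalf := (doubling_eq_iff.1 e).resolve_left (sbtw_ne s₁).2.2
      rw [← sbtw_sub_right w, sbtw_iff_rep] at s₁ s₂
      have b1 := hw _ hp
      have b2 := hw _ hq
      have b3 := hw _ hu
      have b4 := hw _ hv
      have b5 := rep_nonneg (p - w)
      have b6 := rep_nonneg (q - w)
      have b7 := rep_nonneg (u - w)
      have b8 := rep_nonneg (v - w)
      have e2 : p - w = q - w + oneHalf := by rw [hpq]; abel
      rcases rep_add_oneHalf (q - w) with h | h <;> rw [← e2] at h <;>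
        rcases s₁ with s₁ | s₁ | s₁ <;> rcases s₂ with s₂ | s₂ | s₂ <;> linarith
    have n1 := sbtw_ne s₁
    have n2 := sbtw_ne s₂
    have d1 := hmix p u hp hu n1.1
    have d2 := hmix q u hq hu n1.2.1.symm
    have d3 := hmix q v hq hv n2.1
    have d4 := hmix p v hp hv n2.2.1.symm
    have d5 := hsame p q u v hp' hq' hu' hv' s₁ s₂
    exact ih hsh (fun n => hp (n + 1)) (fun n => hq (n + 1)) (fun n => hu (n + 1))
      (fun n => hv (n + 1))
      (sbtw_doubling_of_half (hw _ hp') (hw _ hu') (hw _ hq') s₁ d1 d2.symm d5)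
      (sbtw_doubling_of_half (hw _ hq') (hw _ hv') (hw _ hp') s₂ d3 d4.symm d5.symm) hn

variable {t : ℕ → ArcIndex} (hA : A ∈ itinSet (rep A) (rep B) t)
  (hB : B ∈ itinSet (rep A) (rep B) t)
  (hQ : ∀ s, A ∈ itinSet (rep A) (rep B) s → B ∈ itinSet (rep A) (rep B) s →
    ∀ z ∈ itinSet (rep A) (rep B) s, ∀ w ∈ itinSet (rep A) (rep B) s,
      sbtw A z B → sbtw B w A → False)

include h0 hab hU hA hB hQ in
/-- All the points with a given itinerary are on the same side of the chord. -/
theorem itinSet_subset_arcImage (s : ℕ → ArcIndex) :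
    itinSet (rep A) (rep B) s ⊆ arcImage (rep A) (rep B) .right ∨
      itinSet (rep A) (rep B) s ⊆ arcImage (rep A) (rep B) .lower := by
  by_contra! hcon
  simp only [Set.not_subset] at hcon
  obtain ⟨⟨z, hz, hz'⟩, w, hw, hw'⟩ := hcon
  simp only [arcImage, Set.mem_ofPred_eq] at hz' hw'
  push Not at hz'
  have s1 : sbtw A z B := by
    rw [sbtw_iff_rep]; exact Or.inl hz'
  have s2 : sbtw B w A := by
    rw [sbtw_iff_rep]
    rw [not_and_or] at hw'
    push Not at hw'
    rcases hw' with h | h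
    · right; left; exact ⟨h, by linarith⟩
    · right; right; exact ⟨by linarith, h⟩
  -- The class `t` of the chord is treated by `hQ`; any other class with points on both sides would
  -- cross this class.
  by_cases hs : s = t
  · subst hs
    exact hQ s hA hB z hz w hw s1 s2
  · exact itinSet_not_cross h0 hab hU (Ne.symm hs) hA hB hz hw s1 s2

/-- The lamination whose leaves are the sides of the convex hulls of the sets of points with the
same itinerary. -/
def arcLamination (A B : Angle) : Set Leaf :=
  {l | l.IsDiag ∨ ∃ s x y, l = s(x, y) ∧ IsNext (itinSet (rep A) (rep B) s) x y}

theorem mk_mem_arcLamination {x y : Angle} : s(x, y) ∈ arcLamination A B ↔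
    x = y ∨ ∃ s, IsNext (itinSet (rep A) (rep B) s) x y ∨ IsNext (itinSet (rep A) (rep B) s) y x := by
  unfold arcLamination
  simp only [Set.mem_ofPred_eq, Sym2.mk_isDiag_iff]
  constructor
  · rintro (h | ⟨s, u, v, he, h⟩)
    · exact Or.inl h
    · rcases Sym2.eq_iff.1 he with ⟨rfl, rfl⟩ | ⟨rfl, rfl⟩
      · exact Or.inr ⟨s, Or.inl h⟩
      · exact Or.inr ⟨s, Or.inr h⟩
  · rintro (h | ⟨s, h | h⟩)
    · exact Or.inl h
    · exact Or.inr ⟨s, _, _, rfl, h⟩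
    · exact Or.inr ⟨s, _, _, Sym2.eq_swap, h⟩

include h0 hab hU in
theorem arcLamination_not_crosses :
    ∀ l ∈ arcLamination A B, ∀ l' ∈ arcLamination A B, ¬ l.Crosses l' := by
  rintro l hl l' hl' ⟨p, q, u, v, rfl, rfl, s₁, s₂⟩
  have n1 := sbtw_ne s₁
  have huv : u ≠ v := by
    rintro rfl
    exact sbtw_asymm s₁ s₂
  rcases mk_mem_arcLamination.1 hl with h | ⟨s, h⟩
  · exact n1.2.2 h
  rcases mk_mem_arcLamination.1 hl' with h' | ⟨s', h'⟩
  · exact huv h'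
  have hp : p ∈ itinSet (rep A) (rep B) s := by rcases h with h | h; exacts [h.1, h.2.1]
  have hq : q ∈ itinSet (rep A) (rep B) s := by rcases h with h | h; exacts [h.2.1, h.1]
  have hu : u ∈ itinSet (rep A) (rep B) s' := by rcases h' with h | h; exacts [h.1, h.2.1]
  have hv : v ∈ itinSet (rep A) (rep B) s' := by rcases h' with h | h; exacts [h.2.1, h.1]
  by_cases hs : s = s'
  · subst hs
    rcases h with h | h
    · exact h.2.2.2 u hu s₁
    · exact h.2.2.2 v hv s₂
  · exact itinSet_not_cross h0 hab hU hs hp hq hu hv s₁ s₂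

include h0 hab hU in
-- Along an ultrafilter of leaves every letter of the itinerary is eventually constant, because the
-- alphabet is finite; so the limit points share an itinerary. If the limit chord were not a side of
-- their class, this class would have points strictly on both sides of leaves close to the limit.
theorem isClosed_arcLamination :
    IsClosed {z : Angle × Angle | s(z.1, z.2) ∈ arcLamination A B} := by
  have h1 := rep_lt_one B
  rw [isClosed_iff_ultrafilter]
  rintro ⟨x, y⟩ F hF hmem
  by_contra hnot
  simp only [Set.mem_ofPred_eq] at hnot
  rw [mk_mem_arcLamination] at hnot
  push Not at hnot
  obtain ⟨hxy, hno⟩ := hnot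
  have hne : ∀ᶠ z : Angle × Angle in (F : Filter (Angle × Angle)), z.1 ≠ z.2 := by
    have : IsOpen {z : Angle × Angle | z.1 ≠ z.2} := isOpen_ne_fun continuous_fst continuous_snd
    exact hF (this.mem_nhds hxy)
  have hex : ∀ z : Angle × Angle, ∃ s, (s(z.1, z.2) ∈ arcLamination A B ∧ z.1 ≠ z.2) →
      (IsNext (itinSet (rep A) (rep B) s) z.1 z.2 ∨
        IsNext (itinSet (rep A) (rep B) s) z.2 z.1) := by
    intro z
    by_cases h : s(z.1, z.2) ∈ arcLamination A B ∧ z.1 ≠ z.2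
    · obtain ⟨s, hs⟩ := (mk_mem_arcLamination.1 h.1).resolve_left h.2
      exact ⟨s, fun _ => hs⟩
    · exact ⟨fun _ => .left, fun h' => absurd h' h⟩
  choose S hS using hex
  have hconst : ∀ k, ∃ i, ∀ᶠ z in (F : Filter (Angle × Angle)), S z k = i := by
    intro k
    obtain ⟨i, hi⟩ := Ultrafilter.eq_pure_of_finite (F.map fun z => S z k)
    refine ⟨i, ?_⟩
    have : {i} ∈ F.map fun z => S z k := by rw [hi]; exact Ultrafilter.mem_pure.2 rfl
    exact this
  choose s hs using hconst
  have hleaf : ∀ᶠ z in (F : Filter (Angle × Angle)), IsNext (itinSet (rep A) (rep B) (S z)) z.1 z.2 ∨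
        IsNext (itinSet (rep A) (rep B) (S z)) z.2 z.1 := by
    have hmem' : ∀ᶠ z in (F : Filter (Angle × Angle)), s(z.1, z.2) ∈ arcLamination A B := hmem
    filter_upwards [hne, hmem'] with z h2 h3 using hS z ⟨h3, h2⟩
  have hfst : ∀ᶠ z in (F : Filter (Angle × Angle)), z.1 ∈ itinSet (rep A) (rep B) (S z) ∧
      z.2 ∈ itinSet (rep A) (rep B) (S z) := by
    filter_upwards [hleaf] with z hz
    rcases hz with h | h
    · exact ⟨h.1, h.2.1⟩
    · exact ⟨h.2.1, h.1⟩
  have hF' : Filter.Tendsto id (F : Filter (Angle × Angle)) (nhds (x, y)) := hF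
  have hx : x ∈ itinSet (rep A) (rep B) s := by
    intro k
    refine (isClosed_arc h0 hab h1 (s k)).mem_of_tendsto
      (f := fun z : Angle × Angle => doubling^[k] z.1) (b := (F : Filter (Angle × Angle))) ?_ ?_
    · exact (((doubling_continuous.iterate k).comp continuous_fst).tendsto (x, y)).comp hF'
    · filter_upwards [hfst, hs k] with z h2 h3
      rw [← h3]; exact h2.1 k
  have hy : y ∈ itinSet (rep A) (rep B) s := by
    intro k
    refine (isClosed_arc h0 hab h1 (s k)).mem_of_tendsto
      (f := fun z : Angle × Angle => doubling^[k] z.2) (b := (F : Filter (Angle × Angle))) ?_ ?_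
    · exact (((doubling_continuous.iterate k).comp continuous_snd).tendsto (x, y)).comp hF'
    · filter_upwards [hfst, hs k] with z h2 h3
      rw [← h3]; exact h2.2 k
  have hu : ∃ u ∈ itinSet (rep A) (rep B) s, sbtw x u y := by
    by_contra! h
    exact (hno s).1 ⟨hx, hy, hxy, h⟩
  have hv : ∃ u ∈ itinSet (rep A) (rep B) s, sbtw y u x := by
    by_contra! h
    exact (hno s).2 ⟨hy, hx, hxy.symm, h⟩
  obtain ⟨u, hu, hu'⟩ := hu
  obtain ⟨v, hv, hv'⟩ := hv
  have ev1 : ∀ᶠ z in (F : Filter (Angle × Angle)), sbtw z.1 u z.2 := hF (eventually_sbtw hu')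
  have ev2 : ∀ᶠ z in (F : Filter (Angle × Angle)), sbtw z.2 v z.1 := by
    have h2 := eventually_sbtw hv'
    have h3 : Filter.Tendsto Prod.swap (F : Filter (Angle × Angle)) (nhds (y, x)) :=
      (continuous_swap.tendsto (x, y)).comp hF'
    exact h3.eventually h2
  obtain ⟨z, hz1, hz2, hz3, hz4⟩ := (ev1.and (ev2.and (hleaf.and hfst))).exists
  by_cases hSs : S z = s
  · rw [hSs] at hz3
    rcases hz3 with h | h
    · exact h.2.2.2 u hu hz1
    · exact h.2.2.2 v hv hz2
  · exact itinSet_not_cross h0 hab hU hSs hz4.1 hz4.2 hu hv hz1 hz2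

include h0 hab hU hA hB hQ in
-- The shifted class lies on one side of the chord `AB`. If it is the side over which the arc `s 0`
-- lies, nothing is cut off. Otherwise only `A` and `B` can remain, and the image chord is `AB`, a
-- side of the shifted class.
theorem arcLamination_isNext_image {s : ℕ → ArcIndex} {x y : Angle}
    (h : IsNext (itinSet (rep A) (rep B) s) x y) :
    s(doubling x, doubling y) ∈ arcLamination A B := by
  have h1 := rep_lt_one B
  rw [mk_mem_arcLamination]
  by_cases hne : doubling x = doubling y
  · exact Or.inl hne
  right
  refine ⟨fun n => s (n + 1), ?_⟩
  obtain ⟨w, hw⟩ := exists_rep_sub_le_of_arc h0 hab h1 (s 0)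
  have himg := image_isNext (X := itinSet (rep A) (rep B) s)
    (Or.inr ⟨w, fun z hz => hw z (hz 0)⟩) h hne
  rw [image_itinSet h0 hab h1] at himg
  set Y := itinSet (rep A) (rep B) (fun n => s (n + 1)) with hY
  have hfull : Y ⊆ arcImage (rep A) (rep B) (s 0) → IsNext Y (doubling x) (doubling y) := by
    intro hs
    rwa [Set.inter_eq_left.2 hs] at himg
  have hside := itinSet_subset_arcImage h0 hab hU hA hB hQ (fun n => s (n + 1))
  have hends : doubling x ∈ arcImage (rep A) (rep B) .right →
      doubling y ∈ arcImage (rep A) (rep B) .right →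
      doubling x ∈ arcImage (rep A) (rep B) .lower →
      doubling y ∈ arcImage (rep A) (rep B) .lower →
      (doubling x = A ∧ doubling y = B) ∨ (doubling x = B ∧ doubling y = A) := by
    intro h2 h3 h4 h5
    have aux : ∀ z : Angle, z ∈ arcImage (rep A) (rep B) .right →
        z ∈ arcImage (rep A) (rep B) .lower → z = A ∨ z = B := by
      rintro z h6 ⟨h7, h8⟩
      rcases h6 with h6 | h6
      · left; exact rep_injective (le_antisymm h6 h7)
      · right; exact rep_injective (le_antisymm h8 h6)
    rcases aux _ h2 h4 with e1 | e1 <;> rcases aux _ h3 h5 with e2 | e2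
    · exact absurd (e1.trans e2.symm) hne
    · exact Or.inl ⟨e1, e2⟩
    · exact Or.inr ⟨e1, e2⟩
    · exact absurd (e1.trans e2.symm) hne
  have hmx : doubling x ∈ Y := himg.1.1
  have hmy : doubling y ∈ Y := himg.2.1.1
  have hix := himg.1.2
  have hiy := himg.2.1.2
  have nA : Y ⊆ arcImage (rep A) (rep B) .right → ∀ z ∈ Y, ¬ sbtw A z B := by
    intro hs z hz hb
    rw [sbtw_iff_rep] at hb
    rcases hs hz with h | h <;> rcases hb with hb | hb | hb <;> linarith
  have nB : Y ⊆ arcImage (rep A) (rep B) .lower → ∀ z ∈ Y, ¬ sbtw B z A := by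
    intro hs z hz hb
    rw [sbtw_iff_rep] at hb
    obtain ⟨h, h'⟩ := hs hz
    rcases hb with hb | hb | hb <;> linarith
  have fin : Y ⊆ arcImage (rep A) (rep B) .right ∨ Y ⊆ arcImage (rep A) (rep B) .lower →
      ((doubling x = A ∧ doubling y = B) ∨ (doubling x = B ∧ doubling y = A)) →
      IsNext Y (doubling x) (doubling y) ∨ IsNext Y (doubling y) (doubling x) := by
    rintro hs (⟨e1, e2⟩ | ⟨e1, e2⟩)
    · rcases hs with hs | hs
      · left; exact ⟨hmx, hmy, hne, by rw [e1, e2]; exact nA hs⟩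
      · right; exact ⟨hmy, hmx, Ne.symm hne, by rw [e1, e2]; exact nB hs⟩
    · rcases hs with hs | hs
      · right; exact ⟨hmy, hmx, Ne.symm hne, by rw [e1, e2]; exact nA hs⟩
      · left; exact ⟨hmx, hmy, hne, by rw [e1, e2]; exact nB hs⟩
  have hcase : arcImage (rep A) (rep B) (s 0) = arcImage (rep A) (rep B) .right ∨
      arcImage (rep A) (rep B) (s 0) = arcImage (rep A) (rep B) .lower := by
    cases s 0
    exacts [Or.inl rfl, Or.inr rfl, Or.inl rfl, Or.inr rfl]
  rcases hcase with hc | hc <;> rw [hc] at hix hiy hfull <;> rcases hside with hs | hs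
  · exact Or.inl (hfull hs)
  · exact fin (Or.inr hs) (hends hix hiy (hs hmx) (hs hmy))
  · exact fin (Or.inl hs) (hends (hs hmx) (hs hmy) hix hiy)
  · exact Or.inl (hfull hs)

end ArcLamination

end Surgery

/-! ### Invariance of the itinerary lamination, and a sufficient condition for minor leaves -/

namespace Surgery

theorem doubling_surjective : Function.Surjective doubling := by
  intro y
  have hy0 := rep_nonneg y
  have hy1 := rep_lt_one y
  have e1 : rep ((rep y / 2 : ℝ) : Angle) = rep y / 2 := rep_coe (by linarith) (by linarith)
  refine ⟨((rep y / 2 : ℝ) : Angle), rep_injective ?_⟩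
  rw [rep_doubling_of_lt (by rw [e1]; linarith), e1]; ring

section ArcLamination

variable {A B : Angle} (h0 : 0 < rep A) (hab : rep A ≤ rep B)
  (hU : A = B → ∀ s s', A ∈ itinSet (rep A) (rep B) s → A ∈ itinSet (rep A) (rep B) s' → s = s')
  {t : ℕ → ArcIndex} (hA : A ∈ itinSet (rep A) (rep B) t)
  (hB : B ∈ itinSet (rep A) (rep B) t)
  (hQ : ∀ s, A ∈ itinSet (rep A) (rep B) s → B ∈ itinSet (rep A) (rep B) s →
    ∀ z ∈ itinSet (rep A) (rep B) s, ∀ w ∈ itinSet (rep A) (rep B) s,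
      sbtw A z B → sbtw B w A → False)

include h0 hab in
theorem arcLamination_isNext_add_oneHalf {s : ℕ → ArcIndex} {x y : Angle}
    (h : IsNext (itinSet (rep A) (rep B) s) x y) :
    ∃ s', IsNext (itinSet (rep A) (rep B) s') (x + oneHalf) (y + oneHalf) := by
  have h1 := rep_lt_one B
  set s' : ℕ → ArcIndex := fun n => n.casesOn (s 0).opp (fun n => s (n + 1)) with hs'
  have hmem : ∀ z, z ∈ itinSet (rep A) (rep B) s → z + oneHalf ∈ itinSet (rep A) (rep B) s' := by
    intro z hz n
    cases n with
    | zero => exact add_oneHalf_mem_arc_opp h0 hab h1 (hz 0)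
    | succ n =>
      rw [Function.iterate_succ_apply, doubling_add_oneHalf]
      exact hz (n + 1)
  have hmem' : ∀ z, z ∈ itinSet (rep A) (rep B) s' → z + oneHalf ∈ itinSet (rep A) (rep B) s := by
    intro z hz n
    cases n with
    | zero =>
      have := add_oneHalf_mem_arc_opp h0 hab h1 (hz 0)
      simpa [hs'] using this
    | succ n =>
      rw [Function.iterate_succ_apply, doubling_add_oneHalf]
      exact hz (n + 1)
  refine ⟨s', hmem _ h.1, hmem _ h.2.1, by simpa using h.2.2.1, fun z hz hb => ?_⟩
  apply h.2.2.2 _ (hmem' z hz)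
  rw [← sbtw_add_right oneHalf]
  simpa using hb

include h0 hab hU hA hB hQ in
-- A class lies on one side of the chord, so it is the full image of the class obtained by prefixing
-- an arc over that side.
theorem arcLamination_isNext_preimage {s : ℕ → ArcIndex} {u v : Angle}
    (h : IsNext (itinSet (rep A) (rep B) s) u v) :
    ∃ x y, (∃ s', IsNext (itinSet (rep A) (rep B) s') x y) ∧ doubling x = u ∧ doubling y = v := by
  have h1 := rep_lt_one B
  have key : ∀ i, itinSet (rep A) (rep B) s ⊆ arcImage (rep A) (rep B) i →
      ∃ x y, (∃ s', IsNext (itinSet (rep A) (rep B) s') x y) ∧ doubling x = u ∧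
        doubling y = v := by
    intro i hi
    set s' : ℕ → ArcIndex := fun n => n.casesOn i (fun n => s n) with hs'
    have himg : doubling '' itinSet (rep A) (rep B) s' = itinSet (rep A) (rep B) s := by
      rw [image_itinSet h0 hab h1]
      exact Set.inter_eq_left.2 hi
    rw [← himg] at h
    obtain ⟨w, hw⟩ := exists_rep_sub_le_of_arc h0 hab h1 i
    obtain ⟨x, y, hxy, hx, hy⟩ := exists_isNext_of_image (X := itinSet (rep A) (rep B) s')
      (Or.inr ⟨w, fun z hz => hw z (hz 0)⟩) h
    exact ⟨x, y, ⟨s', hxy⟩, hx, hy⟩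
  rcases itinSet_subset_arcImage h0 hab hU hA hB hQ s with hs | hs
  · exact key _ hs
  · exact key _ hs

include h0 hab hU hA hB hQ in
theorem isInvariantLamination_arcLamination : IsInvariantLamination (arcLamination A B) := by
  refine isInvariantLamination_of_symmetric (fun x => mk_mem_arcLamination.2 (Or.inl rfl))
    (arcLamination_not_crosses h0 hab hU) (isClosed_arcLamination h0 hab hU) ?_ ?_ ?_
  · intro l hl
    induction l using Sym2.ind with
    | _ x y =>
      change s(doubling x, doubling y) ∈ _
      rcases mk_mem_arcLamination.1 hl with h | ⟨s, h | h⟩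
      · rw [h]; exact mk_mem_arcLamination.2 (Or.inl rfl)
      · exact arcLamination_isNext_image h0 hab hU hA hB hQ h
      · rw [Sym2.eq_swap]
        exact arcLamination_isNext_image h0 hab hU hA hB hQ h
  · intro x y hl
    rcases mk_mem_arcLamination.1 hl with h | ⟨s, h | h⟩
    · rw [h]; exact mk_mem_arcLamination.2 (Or.inl rfl)
    · obtain ⟨s', hs'⟩ := arcLamination_isNext_add_oneHalf h0 hab h
      exact mk_mem_arcLamination.2 (Or.inr ⟨s', Or.inl hs'⟩)
    · obtain ⟨s', hs'⟩ := arcLamination_isNext_add_oneHalf h0 hab h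
      exact mk_mem_arcLamination.2 (Or.inr ⟨s', Or.inr hs'⟩)
  · intro u v hl
    rcases mk_mem_arcLamination.1 hl with h | ⟨s, h | h⟩
    · obtain ⟨x, hx⟩ := doubling_surjective u
      exact ⟨x, x, mk_mem_arcLamination.2 (Or.inl rfl), hx, by rw [hx, h]⟩
    · obtain ⟨x, y, ⟨s', hs'⟩, hx, hy⟩ :=
        arcLamination_isNext_preimage h0 hab hU hA hB hQ h
      exact ⟨x, y, mk_mem_arcLamination.2 (Or.inr ⟨s', Or.inl hs'⟩), hx, hy⟩
    · obtain ⟨x, y, ⟨s', hs'⟩, hx, hy⟩ :=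
        arcLamination_isNext_preimage h0 hab hU hA hB hQ h
      exact ⟨y, x, mk_mem_arcLamination.2 (Or.inr ⟨s', Or.inr hs'⟩), hy, hx⟩

theorem dist_le_of_rep {x y : Angle} {d : ℝ} (h : |rep x - rep y| ≤ d ∨ 1 - d ≤ |rep x - rep y|) :
    dist x y ≤ d := by
  rw [dist_eq_rep]
  rcases h with h | h
  · exact (min_le_left _ _).trans h
  · exact (min_le_right _ _).trans (by linarith)

theorem dist_le_of_mem_arc {a b : ℝ} (h0 : 0 < a) (h1 : b < 1)
    (hlen : b - a ≤ 1 / 2) {x y : Angle} {i : ArcIndex} (hx : x ∈ arc a b i)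
    (hy : y ∈ arc a b i) : dist x y ≤ (1 - (b - a)) / 2 := by
  have hx0 := rep_nonneg x
  have hx1 := rep_lt_one x
  have hy0 := rep_nonneg y
  have hy1 := rep_lt_one y
  apply dist_le_of_rep
  cases i
  · rcases hx with hx | hx <;> rcases hy with hy | hy
    · left; rw [abs_le]; constructor <;> linarith
    · right; rw [le_abs]; right; linarith
    · right; rw [le_abs]; left; linarith
    · left; rw [abs_le]; constructor <;> linarith
  all_goals
    obtain ⟨hx, hx'⟩ := hx
    obtain ⟨hy, hy'⟩ := hy
    left; rw [abs_le]; constructor <;> linarith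

include h0 hab hU hA hB hQ in
/-- A chord whose endpoints have a common itinerary with respect to the arcs bounded by their
preimages is a minor leaf. -/
theorem mem_QML_of_itinSet (hlen : rep B - rep A ≤ 1 / 2) : s(A, B) ∈ QML := by
  have h1 := rep_lt_one B
  -- The major leaf is the chord of the right arc; its ends have the itinerary of `A` and `B`
  -- preceded by `right`. Every non-degenerate leaf has both ends in one of the four arcs, and since
  -- `rep B - rep A ≤ 1/2` none of these gives a longer chord.
  set c : Angle := ((rep B / 2 : ℝ) : Angle) with hc
  set c' : Angle := (((rep A + 1) / 2 : ℝ) : Angle) with hc'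
  have ec : rep c = rep B / 2 := rep_coe (by linarith) (by linarith)
  have ec' : rep c' = (rep A + 1) / 2 := rep_coe (by linarith) (by linarith)
  have dc : doubling c = B := by
    apply rep_injective
    rw [rep_doubling_of_lt (by rw [ec]; linarith), ec]; ring
  have dc' : doubling c' = A := by
    apply rep_injective
    rw [rep_doubling_of_le (by rw [ec']; linarith), ec']; ring
  have hne : c' ≠ c := by
    intro e
    have := congrArg rep e
    rw [ec, ec'] at this
    linarith
  have hmc : c ∈ itinSet (rep A) (rep B) (fun n => n.casesOn .right (fun n => t n)) := by
    intro n
    cases n with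
    | zero => exact ⟨by simp [ec], by simp only [Function.iterate_zero, id_eq, ec]; linarith⟩
    | succ n => rw [Function.iterate_succ_apply, dc]; exact hB n
  have hmc' : c' ∈ itinSet (rep A) (rep B) (fun n => n.casesOn .right (fun n => t n)) := by
    intro n
    cases n with
    | zero => exact ⟨by simp only [Function.iterate_zero, id_eq, ec']; linarith, by simp [ec']⟩
    | succ n => rw [Function.iterate_succ_apply, dc']; exact hA n
  refine ⟨arcLamination A B, isInvariantLamination_arcLamination h0 hab hU hA hB hQ, s(c', c),
    ⟨?_, ?_, ?_⟩, ?_⟩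
  · refine mk_mem_arcLamination.2 (Or.inr ⟨_, Or.inl ⟨hmc', hmc, hne, fun z hz hb => ?_⟩⟩)
    have hz0 := hz 0
    rw [sbtw_iff_rep, ec, ec'] at hb
    obtain ⟨hz1, hz2⟩ := hz0
    simp only [Function.iterate_zero, id_eq] at hz1 hz2
    rcases hb with hb | hb | hb <;> linarith
  · simpa using hne
  · intro l hl
    have hM : Leaf.length s(c', c) = (1 - (rep B - rep A)) / 2 := by
      change dist c' c = _
      rw [dist_eq_rep, ec, ec', abs_of_nonneg (by linarith), min_eq_left (by linarith)]
      ring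
    rw [hM]
    induction l using Sym2.ind with
    | _ x y =>
      change dist x y ≤ _
      rcases mk_mem_arcLamination.1 hl with h | ⟨s, h⟩
      · rw [h, dist_self]; linarith
      · have hx : x ∈ itinSet (rep A) (rep B) s := by rcases h with h | h; exacts [h.1, h.2.1]
        have hy : y ∈ itinSet (rep A) (rep B) s := by rcases h with h | h; exacts [h.2.1, h.1]
        exact dist_le_of_mem_arc h0 h1 hlen (hx 0) (hy 0)
  · change _ = s(doubling c', doubling c)
    rw [dc, dc']

end ArcLamination

end Surgery

/-! ### The half-turn of a major leaf is a leaf -/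

namespace Surgery

theorem sbtw_add_coe {x : Angle} {r s t : ℝ} (hr : r ∈ Set.Ico (0 : ℝ) 1)
    (hs : s ∈ Set.Ico (0 : ℝ) 1) (ht : t ∈ Set.Ico (0 : ℝ) 1) :
    sbtw (x + (r : Angle)) (x + (s : Angle)) (x + (t : Angle)) ↔
      (r < s ∧ s < t) ∨ (s < t ∧ t < r) ∨ (t < r ∧ r < s) := by
  rw [add_comm x, add_comm x, add_comm x, sbtw_add_right, sbtw_iff_rep, rep_coe hr.1 hr.2,
    rep_coe hs.1 hs.2, rep_coe ht.1 ht.2]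

/-- Leaves under a side of a gap: if a relation on an interval is closed and non-crossing, then two
consecutive uncovered points are related. -/
theorem related_of_consecutive_uncovered {R : ℝ → ℝ → Prop} {c d : ℝ}
    (hclosed : IsClosed {z : ℝ × ℝ | R z.1 z.2})
    (hcross : ∀ r s t u, c ≤ r → r < s → s < t → t < u → u ≤ d → R r t → R s u → False)
    {Y : Set ℝ} (hY : ∀ t, t ∈ Y ↔ t ∈ Set.Icc c d ∧
      ∀ u ∈ Set.Icc c d, ∀ v ∈ Set.Icc c d, R u v → u < t → t < v → False)
    {s t : ℝ} (hs : s ∈ Y) (ht : t ∈ Y) (hst : s < t) (hno : ∀ r ∈ Y, s < r → r < t → False) :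
    R s t := by
  obtain ⟨hs1, hs2⟩ := (hY s).1 hs
  obtain ⟨ht1, ht2⟩ := (hY t).1 ht
  have cover : ∀ r, s < r → r < t → ∃ u v, R u v ∧ u < r ∧ r < v ∧ s ≤ u ∧ v ≤ t := by
    intro r h1 h2
    have hr : r ∉ Y := fun h => hno r h h1 h2
    rw [hY] at hr
    push Not at hr
    obtain ⟨u, hu, v, hv, huv, hur, hrv, -⟩ :=
      hr ⟨by linarith [hs1.1], by linarith [ht1.2]⟩
    refine ⟨u, v, huv, hur, hrv, ?_, ?_⟩
    · by_contra! h
      exact hs2 u hu v hv huv h (by linarith)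
    · by_contra! h
      exact ht2 u hu v hv huv (by linarith) h
  set w := (s + t) / 2 with hw
  have hsw : s < w := by rw [hw]; linarith
  have hwt : w < t := by rw [hw]; linarith
  -- Take a longest related pair around the midpoint. If one of its ends were strictly inside `(s,
  -- t)`, a pair covering this end would either be longer or cross it.
  set K : Set (ℝ × ℝ) := (Set.Icc s w ×ˢ Set.Icc w t) ∩ {z : ℝ × ℝ | R z.1 z.2} with hK
  have hKc : IsCompact K := (isCompact_Icc.prod isCompact_Icc).inter_right hclosed
  have hKn : K.Nonempty := by
    obtain ⟨u, v, huv, h1, h2, h3, h4⟩ := cover w hsw hwt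
    exact ⟨(u, v), ⟨⟨h3, h1.le⟩, ⟨h2.le, h4⟩⟩, huv⟩
  obtain ⟨⟨u, v⟩, ⟨⟨hu, hv⟩, huv⟩, hmax⟩ := hKc.exists_isMaxOn hKn
    (f := fun z : ℝ × ℝ => z.2 - z.1) (by fun_prop)
  rw [isMaxOn_iff] at hmax
  simp only at hu hv hmax
  have huv' : R u v := huv
  have hus : u = s := by
    by_contra hne
    have hlt : s < u := lt_of_le_of_ne hu.1 (Ne.symm hne)
    obtain ⟨u', v', h', h1, h2, h3, h4⟩ := cover u hlt (by linarith [hu.2])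
    by_cases hvv : v ≤ v'
    · have := hmax (u', v') ⟨⟨⟨h3, by linarith [hu.2]⟩, ⟨by linarith [hv.1], h4⟩⟩, h'⟩
      simp only at this
      linarith
    · push Not at hvv
      exact hcross u' u v' v (by linarith [hs1.1]) h1 h2 hvv (by linarith [hv.2, ht1.2]) h' huv'
  have hvt : v = t := by
    by_contra hne
    have hlt : v < t := lt_of_le_of_ne hv.2 hne
    obtain ⟨u', v', h', h1, h2, h3, h4⟩ := cover v (by linarith [hv.1]) hlt
    by_cases hvv : u' ≤ u
    · have := hmax (u', v') ⟨⟨⟨h3, by linarith [hu.2]⟩, ⟨by linarith [hv.1], h4⟩⟩, h'⟩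
      simp only at this
      linarith
    · push Not at hvv
      exact hcross u u' v v' (by linarith [hs1.1, hu.1]) hvv h1 h2 (by linarith [ht1.2]) huv' h'
  rw [← hus, ← hvt]
  exact huv'

set_option maxHeartbeats 1000000 in
/-- If the arc under a major leaf is shorter than a half-circle, then the half-turn of the major
leaf is a leaf. -/
theorem IsMajor.add_oneHalf_mem_of_lt {L : Set Leaf} (hL : IsInvariantLamination L) {x y : Angle}
    (hM : IsMajor L s(x, y)) (hlt : rep (y - x) < 1 / 2) :
    s(x + oneHalf, y + oneHalf) ∈ L := by
  by_contra hnot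
  have hxy : x ≠ y := by simpa using hM.2.1
  set β := rep (y - x) with hβ
  have hβ0 : 0 < β := rep_pos (sub_ne_zero.2 hxy.symm)
  have hD : doubling x ≠ doubling y := by
    intro h
    rcases doubling_eq_iff.1 h.symm with h | h
    · exact hxy h.symm
    · have : β = 1 / 2 := by rw [hβ, h, add_sub_cancel_left, rep_oneHalf]
      linarith
  set pt : ℝ → Angle := fun t => x + (t : Angle) with hpt
  have pt0 : pt 0 = x := by simp [hpt]
  have ptβ : pt β = y := by simp [hpt, hβ]
  have pth : pt (1 / 2) = x + oneHalf := rfl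
  have ptβh : pt (β + 1 / 2) = y + oneHalf := by
    simp only [hpt, AddCircle.coe_add, ← add_assoc, hβ, coe_rep, add_sub_cancel]
    rfl
  have ptc : Continuous pt := by
    have : Continuous fun t : ℝ => (t : Angle) := AddCircle.continuous_mk' 1
    fun_prop
  have ptinj : ∀ s ∈ Set.Ico (0 : ℝ) 1, ∀ t ∈ Set.Ico (0 : ℝ) 1, pt s = pt t → s = t := by
    intro s hs t ht h
    have := congrArg rep (add_left_cancel h)
    rwa [rep_coe hs.1 hs.2, rep_coe ht.1 ht.2] at this
  set R : ℝ → ℝ → Prop := fun s t => s(pt s, pt t) ∈ L with hR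
  have Rsymm : ∀ s t, R s t → R t s := fun s t h => by
    simp only [hR]; rwa [Sym2.eq_swap]
  have Rclosed : IsClosed {z : ℝ × ℝ | R z.1 z.2} :=
    hL.closed.preimage (f := fun z : ℝ × ℝ => (pt z.1, pt z.2)) (by fun_prop)
  have Rcross : ∀ r s t u, 0 ≤ r → r < s → s < t → t < u → u < 1 → R r t → R s u → False := by
    intro r s t u h1 h2 h3 h4 h5 h6 h7
    refine hL.not_crosses _ h6 _ h7 (Leaf.crosses_mk ?_ ?_)
    · exact (sbtw_add_coe ⟨h1, by linarith⟩ ⟨by linarith, by linarith⟩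
        ⟨by linarith, by linarith⟩).2 (Or.inl ⟨h2, h3⟩)
    · exact (sbtw_add_coe ⟨by linarith, by linarith⟩ ⟨by linarith, by linarith⟩
        ⟨by linarith, by linarith⟩).2 (Or.inr (Or.inr ⟨by linarith, h4⟩))
  have hdist : dist x y = β := by
    rw [dist_comm, dist_eq_norm, ← coe_rep (y - x), ← hβ, AddCircle.norm_eq]
    simp only [inv_one, one_mul, mul_one]
    rw [abs_sub_round_eq_min, Int.fract_eq_self.2 ⟨hβ0.le, by linarith⟩,
      min_eq_left (by linarith)]
  have hnodiam : ∀ z : Angle, s(z, z + oneHalf) ∉ L := by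
    intro z hz
    have h1 : dist z (z + oneHalf) ≤ dist x y := hM.2.2 _ hz
    rw [hdist] at h1
    have h2 : dist z (z + oneHalf) = 1 / 2 := by
      rw [dist_eq_rep]
      rcases rep_add_oneHalf z with h | h <;> rw [h.2]
      · rw [abs_of_neg (by linarith), min_eq_left (by linarith)]; ring
      · rw [abs_of_nonneg (by linarith), min_eq_left (by linarith)]; ring
    linarith
  -- The image of the major has two disjoint preimages. Without the half-turn, they must be the two
  -- leaves which join `x` to `y + 1/2` and `x + 1/2` to `y`.
  have hother : R 0 (β + 1 / 2) ∧ R (1 / 2) β := by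
    simp only [hR, pt0, ptβ, pth, ptβh]
    obtain ⟨l₁, hl₁, l₂, hl₂, e₁, e₂, hdisj⟩ := hL.backward _ (hL.forward _ hM.1)
    have hform : ∀ l : Leaf, l.image = Leaf.image s(x, y) → l = s(x, y) ∨
        l = s(x + oneHalf, y + oneHalf) ∨ l = s(x, y + oneHalf) ∨ l = s(x + oneHalf, y) := by
      intro l hl
      induction l using Sym2.ind with
      | _ u v =>
        change s(doubling u, doubling v) = s(doubling x, doubling y) at hl
        rcases Sym2.eq_iff.1 hl with ⟨h1, h2⟩ | ⟨h1, h2⟩ <;>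
          rcases doubling_eq_iff.1 h1 with rfl | rfl <;>
          rcases doubling_eq_iff.1 h2 with rfl | rfl <;> simp [Sym2.eq_swap]
    rcases hform _ e₁ with rfl | rfl | rfl | rfl <;> rcases hform _ e₂ with rfl | rfl | rfl | rfl
    all_goals first
      | exact absurd hl₁ hnot
      | exact absurd hl₂ hnot
      | exact ⟨hl₁, hl₂⟩
      | exact ⟨hl₂, hl₁⟩
      | (exfalso; simp at hdisj)
  have R0β : R 0 β := by simp only [hR, pt0, ptβ]; exact hM.1
  -- In coordinates starting at `x`, the points `y`, `x + 1/2`, `y + 1/2` are `β`, `1/2`, `β + 1/2`.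
  -- The leaf from `y` ending farthest along `[1/2, β + 1/2]` and the leaf from `x` ending earliest
  -- there are sides of a gap having `xy` as a side.
  obtain ⟨c₁, hc₁, hc₁max⟩ : ∃ c₁, IsGreatest {t | t ∈ Set.Icc (1 / 2) (β + 1 / 2) ∧ R t β} c₁ := by
    apply IsCompact.exists_isGreatest
    · exact isCompact_Icc.inter_right (Rclosed.preimage (f := fun t : ℝ => (t, β)) (by fun_prop))
    · exact ⟨1 / 2, ⟨le_rfl, by linarith⟩, hother.2⟩
  obtain ⟨c₂, hc₂, hc₂min⟩ : ∃ c₂, IsLeast {t | t ∈ Set.Icc (1 / 2) (β + 1 / 2) ∧ R 0 t} c₂ := by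
    apply IsCompact.exists_isLeast
    · exact isCompact_Icc.inter_right (Rclosed.preimage (f := fun t : ℝ => (0, t)) (by fun_prop))
    · exact ⟨β + 1 / 2, ⟨by linarith, le_rfl⟩, hother.1⟩
  obtain ⟨⟨hc₁l, hc₁u⟩, hRc₁⟩ := hc₁
  obtain ⟨⟨hc₂l, hc₂u⟩, hRc₂⟩ := hc₂
  have hc₁₂ : c₁ ≤ c₂ := by
    by_contra! h
    exact Rcross 0 β c₂ c₁ le_rfl hβ0 (by linarith) h (by linarith) hRc₂ (Rsymm _ _ hRc₁)
  -- The remaining vertices of this gap: the points of `[c₁, c₂]` which are not under a leaf with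
  -- both ends in this interval.
  set Y : Set ℝ := Set.Icc c₁ c₂ ∩ ⋂ u : ℝ, ⋂ v : ℝ,
    ⋂ _ : u ∈ Set.Icc c₁ c₂ ∧ v ∈ Set.Icc c₁ c₂ ∧ R u v, (Set.Ioo u v)ᶜ with hYdef
  have hY : ∀ t, t ∈ Y ↔ t ∈ Set.Icc c₁ c₂ ∧
      ∀ u ∈ Set.Icc c₁ c₂, ∀ v ∈ Set.Icc c₁ c₂, R u v → u < t → t < v → False := by
    intro t
    simp only [hYdef, Set.mem_inter_iff, Set.mem_iInter, Set.mem_compl_iff]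
    constructor
    · rintro ⟨h1, h2⟩
      exact ⟨h1, fun u hu v hv huv h3 h4 => h2 u v ⟨hu, hv, huv⟩ ⟨h3, h4⟩⟩
    · rintro ⟨h1, h2⟩
      exact ⟨h1, fun u v ⟨hu, hv, huv⟩ ⟨h3, h4⟩ => h2 u hu v hv huv h3 h4⟩
  have hYcl : IsCompact Y := by
    apply isCompact_Icc.inter_right
    exact isClosed_iInter fun u => isClosed_iInter fun v => isClosed_iInter fun _ =>
      isOpen_Ioo.isClosed_compl
  have hc₁Y : c₁ ∈ Y := (hY _).2 ⟨⟨le_rfl, hc₁₂⟩, fun u hu v hv _ h1 h2 => by linarith [hu.1]⟩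
  have hc₂Y : c₂ ∈ Y := (hY _).2 ⟨⟨hc₁₂, le_rfl⟩, fun u hu v hv _ h1 h2 => by linarith [hv.2]⟩
  have hYb : ∀ t ∈ Y, c₁ ≤ t ∧ t ≤ c₂ := fun t ht => ((hY t).1 ht).1
  set T : Set ℝ := {0, β} ∪ Y with hT
  have hTb : ∀ t ∈ T, t ∈ Set.Ico (0 : ℝ) 1 := by
    rintro t ((rfl | rfl) | ht)
    · exact ⟨le_rfl, one_pos⟩
    · exact ⟨hβ0.le, by linarith⟩
    · have := hYb t ht
      exact ⟨by linarith, by linarith⟩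
  have h0T : (0 : ℝ) ∈ T := Or.inl (Or.inl rfl)
  have hβT : β ∈ T := Or.inl (Or.inr rfl)
  have hYT : ∀ t ∈ Y, t ∈ T := fun t ht => Or.inr ht
  have hnext : ∀ s ∈ T, ∀ t ∈ T, IsNext (pt '' T) (pt s) (pt t) ↔ s ≠ t ∧
      ∀ r ∈ T, ¬ ((s < r ∧ r < t) ∨ (r < t ∧ t < s) ∨ (t < s ∧ s < r)) := by
    intro s hs t ht
    constructor
    · rintro ⟨-, -, h1, h2⟩
      refine ⟨fun e => h1 (by rw [e]), fun r hr h3 => h2 _ ⟨r, hr, rfl⟩ ?_⟩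
      exact (sbtw_add_coe (hTb s hs) (hTb r hr) (hTb t ht)).2 h3
    · rintro ⟨h1, h2⟩
      refine ⟨⟨s, hs, rfl⟩, ⟨t, ht, rfl⟩, fun e => h1 (ptinj _ (hTb s hs) _ (hTb t ht) e), ?_⟩
      rintro _ ⟨r, hr, rfl⟩ h3
      exact h2 r hr ((sbtw_add_coe (hTb s hs) (hTb r hr) (hTb t ht)).1 h3)
  have hedge : ∀ s ∈ T, ∀ t ∈ T, s < t →
      (R s t ↔ IsNext (pt '' T) (pt s) (pt t) ∨ IsNext (pt '' T) (pt t) (pt s)) := by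
    intro s hs t ht hst
    rw [hnext s hs t ht, hnext t ht s hs]
    rcases hs with (rfl | rfl) | hs
    · rcases ht with (rfl | rfl) | ht
      · exact absurd hst (lt_irrefl _)
      · refine ⟨fun _ => Or.inl ⟨hst.ne, ?_⟩, fun _ => R0β⟩
        rintro r hr h
        have := (hTb r hr).1
        rcases hr with (rfl | rfl) | hr
        · rcases h with h | h | h <;> linarith
        · rcases h with h | h | h <;> linarith
        · have := hYb r hr
          rcases h with h | h | h <;> linarith
      · have htb := hYb t ht
        constructor
        · intro h
          have h2 : c₂ ≤ t := hc₂min ⟨⟨by linarith, by linarith⟩, h⟩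
          refine Or.inr ⟨hst.ne', ?_⟩
          rintro r hr h3
          have h4 := (hTb r hr).1
          have h5 : r ≤ c₂ := by
            rcases hr with (rfl | rfl) | hr
            · linarith
            · linarith
            · exact (hYb r hr).2
          rcases h3 with h | h | h <;> linarith
        · rintro (⟨-, h⟩ | ⟨-, h⟩)
          · exact absurd (Or.inl ⟨hβ0, by linarith⟩) (h β hβT)
          · have h2 : t = c₂ := by
              by_contra hne
              exact h c₂ (hYT _ hc₂Y) (Or.inr (Or.inr ⟨hst, lt_of_le_of_ne htb.2 hne⟩))
            rw [h2]; exact hRc₂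
    · rcases ht with (rfl | rfl) | ht
      · linarith
      · exact absurd hst (lt_irrefl _)
      · have htb := hYb t ht
        constructor
        · intro h
          have h2 : t ≤ c₁ := hc₁max ⟨⟨by linarith, by linarith⟩, Rsymm _ _ h⟩
          refine Or.inl ⟨hst.ne, ?_⟩
          rintro r hr h3
          have h4 := (hTb r hr).1
          rcases hr with (rfl | rfl) | hr
          · rcases h3 with h | h | h <;> linarith
          · rcases h3 with h | h | h <;> linarith
          · have := hYb r hr
            rcases h3 with h | h | h <;> linarith
        · rintro (⟨-, h⟩ | ⟨-, h⟩)
          · have h2 : t = c₁ := by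
              by_contra hne
              exact h c₁ (hYT _ hc₁Y)
                (Or.inl ⟨by linarith, lt_of_le_of_ne htb.1 (Ne.symm hne)⟩)
            rw [h2]; exact Rsymm _ _ hRc₁
          · exact absurd (Or.inr (Or.inl ⟨hβ0, hst⟩)) (h 0 h0T)
    · have hsb := hYb s hs
      rcases ht with (rfl | rfl) | ht
      · linarith
      · linarith
      · have htb := hYb t ht
        constructor
        · intro h
          refine Or.inl ⟨hst.ne, ?_⟩
          rintro r hr h3
          have h4 : s < r ∧ r < t := by
            rcases h3 with h | h | h
            · exact h
            · linarith
            · linarith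
          rcases hr with (rfl | rfl) | hr
          · linarith
          · linarith
          · exact ((hY r).1 hr).2 s hsb t htb h h4.1 h4.2
        · rintro (⟨-, h⟩ | ⟨-, h⟩)
          · refine related_of_consecutive_uncovered Rclosed ?_ hY hs ht hst ?_
            · intro r s t u h1 h2 h3 h4 h5
              exact Rcross r s t u (by linarith) h2 h3 h4 (by linarith)
            · intro r hr h1 h2
              exact h r (hYT r hr) (Or.inl ⟨h1, h2⟩)
          · exact absurd (Or.inr (Or.inl ⟨by linarith, hst⟩)) (h 0 h0T)
  have hgap : IsGap L (pt '' T) := by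
    refine ⟨((((Set.finite_singleton β).insert 0).isCompact.union hYcl).image ptc).isClosed, ?_, ?_⟩
    · have h3 : ({pt 0, pt β, pt c₁} : Set Angle).encard = 3 := by
        refine Set.encard_eq_three.2 ⟨_, _, _, ?_, ?_, ?_, rfl⟩
        · exact fun e => hβ0.ne (ptinj _ (hTb _ h0T) _ (hTb _ hβT) e)
        · intro e
          have := ptinj _ (hTb _ h0T) _ (hTb _ (hYT _ hc₁Y)) e
          linarith
        · intro e
          have := ptinj _ (hTb _ hβT) _ (hTb _ (hYT _ hc₁Y)) e
          linarith
      rw [← h3]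
      apply Set.encard_le_encard
      rintro z (rfl | rfl | rfl)
      · exact ⟨_, h0T, rfl⟩
      · exact ⟨_, hβT, rfl⟩
      · exact ⟨_, hYT _ hc₁Y, rfl⟩
    · rintro _ ⟨s, hs, rfl⟩ _ ⟨t, ht, rfl⟩ hne
      rcases lt_trichotomy s t with h | h | h
      · exact hedge s hs t ht h
      · exact absurd (by rw [h]) hne
      · rw [or_comm, ← hedge t ht s hs h]
        exact ⟨Rsymm _ _, Rsymm _ _⟩
  -- A vertex strictly between `1/2` and `β + 1/2` has its image strictly between those of `x` and
  -- `y`. The gap condition forbids this, because `xy` is a side whose ends have distinct images.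
  have hYsub : ∀ t ∈ Y, t = 1 / 2 ∨ t = β + 1 / 2 := by
    intro t ht
    by_contra! hne
    have htb := hYb t ht
    have h1 : 1 / 2 < t := lt_of_le_of_ne (by linarith) (Ne.symm hne.1)
    have h2 : t < β + 1 / 2 := lt_of_le_of_ne (by linarith) hne.2
    have hs : sbtw (doubling x) (doubling (pt t)) (doubling y) := by
      rw [sbtw_iff_sub, ← doubling_sub, ← doubling_sub, rep_doubling_of_lt hlt]
      have e : pt t - x = (t : Angle) := by simp [hpt]
      have e2 : rep (t : Angle) = t := rep_coe (by linarith) (by linarith)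
      rw [e, rep_doubling_of_le (by rw [e2]; linarith), e2]
      constructor <;> linarith
    have hsn := sbtw_ne hs
    have mx : doubling x ∈ doubling '' (pt '' T) := ⟨x, ⟨0, h0T, pt0⟩, rfl⟩
    have my : doubling y ∈ doubling '' (pt '' T) := ⟨y, ⟨β, hβT, ptβ⟩, rfl⟩
    have mt : doubling (pt t) ∈ doubling '' (pt '' T) := ⟨_, ⟨t, hYT t ht, rfl⟩, rfl⟩
    rcases hL.gap _ hgap with ⟨u, hu⟩ | ⟨u, v, -, huv, -⟩ | ⟨-, hor⟩
    · rw [hu, Set.mem_singleton_iff] at mx my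
      exact hD (mx.trans my.symm)
    · rw [huv, Set.mem_insert_iff, Set.mem_singleton_iff] at mx my mt
      rcases mx with mx | mx <;> rcases my with my | my <;> rcases mt with mt | mt <;>
        first
          | exact hD (mx.trans my.symm)
          | exact hsn.1 (mx.trans mt.symm)
          | exact hsn.2.1 (mt.trans my.symm)
    · have hn : IsNext (pt '' T) x y := by
        have := (hnext 0 h0T β hβT).2 ⟨hβ0.ne, ?_⟩
        · rwa [pt0, ptβ] at this
        · rintro r hr h
          have := (hTb r hr).1
          rcases hr with (rfl | rfl) | hr
          · rcases h with h | h | h <;> linarith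
          · rcases h with h | h | h <;> linarith
          · have := hYb r hr
            rcases h with h | h | h <;> linarith
      rcases hor x y hn with h | h
      · exact hD h
      · exact h.2.2.2 _ mt hs
  -- The other possibility would make a diameter a leaf, longer than the major. So the remaining
  -- vertices are exactly the ends of the half-turn; being consecutive, they are joined by a leaf.
  have hc₁e : c₁ = 1 / 2 := by
    rcases hYsub _ hc₁Y with h | h
    · exact h
    · exfalso
      simp only [hR, h, ptβh, ptβ] at hRc₁
      exact hnodiam y (by rwa [Sym2.eq_swap])
  have hc₂e : c₂ = β + 1 / 2 := by
    rcases hYsub _ hc₂Y with h | h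
    · exfalso
      simp only [hR, h, pth, pt0] at hRc₂
      exact hnodiam x hRc₂
    · exact h
  apply hnot
  rw [← pth, ← ptβh]
  refine related_of_consecutive_uncovered Rclosed ?_ hY (hc₁e ▸ hc₁Y) (hc₂e ▸ hc₂Y)
    (by linarith) ?_
  · intro r s t u h1 h2 h3 h4 h5
    exact Rcross r s t u (by linarith) h2 h3 h4 (by linarith)
  · intro r hr h1 h2
    rcases hYsub r hr with h | h <;> linarith

end Surgery

/-! ### Necessary conditions on the endpoints of a minor leaf -/

namespace Surgery

theorem IsMajor.add_oneHalf_mem {L : Set Leaf} (hL : IsInvariantLamination L) {x y : Angle}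
    (hM : IsMajor L s(x, y)) (hD : doubling x ≠ doubling y) :
    s(x + oneHalf, y + oneHalf) ∈ L := by
  have hxy : x ≠ y := fun e => hD (by rw [e])
  rcases lt_trichotomy (rep (y - x)) (1 / 2) with h | h | h
  · exact hM.add_oneHalf_mem_of_lt hL h
  · rw [← rep_oneHalf, rep_inj] at h
    exact absurd (doubling_eq_iff.2 (Or.inr (by rw [← h]; abel))).symm hD
  · rw [Sym2.eq_swap] at hM ⊢
    refine hM.add_oneHalf_mem_of_lt hL ?_
    rcases rep_sub y x with h1 | h1 <;> rcases rep_sub x y with h2 | h2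
    · have := rep_injective (le_antisymm h1.1 h2.1)
      exact absurd this hxy
    · linarith
    · linarith
    · linarith

theorem norm_eq_rep (z : Angle) : ‖z‖ = min (rep z) (1 - rep z) := by
  have h := dist_eq_rep z 0
  rwa [dist_zero_right, rep_zero, sub_zero, abs_of_nonneg (rep_nonneg z)] at h

/-- On the distance to 0 doubling acts as the tent map with turning point `1/4`. -/
theorem norm_doubling (z : Angle) :
    (‖z‖ ≤ 1 / 4 ∧ ‖doubling z‖ = 2 * ‖z‖) ∨ (1 / 4 ≤ ‖z‖ ∧ ‖doubling z‖ = 1 - 2 * ‖z‖) := by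
  rw [norm_eq_rep, norm_eq_rep]
  have h0 := rep_nonneg z
  have h1 := rep_lt_one z
  rcases rep_doubling z with ⟨h, e⟩ | ⟨h, e⟩ <;> rw [e]
  · rw [min_eq_left (a := rep z) (by linarith)]
    rcases le_total (rep z) (1 / 4) with h2 | h2
    · left; rw [min_eq_left (by linarith)]; exact ⟨h2, rfl⟩
    · right; rw [min_eq_right (by linarith)]; exact ⟨h2, rfl⟩
  · rw [min_eq_right (a := rep z) (by linarith)]
    rcases le_total (rep z) (3 / 4) with h2 | h2
    · right; rw [min_eq_left (by linarith)]; exact ⟨by linarith, by ring⟩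
    · left; rw [min_eq_right (by linarith)]; exact ⟨by linarith, by ring⟩

theorem dist_doubling (x y : Angle) :
    (dist x y ≤ 1 / 4 ∧ dist (doubling x) (doubling y) = 2 * dist x y) ∨
      (1 / 4 ≤ dist x y ∧ dist (doubling x) (doubling y) = 1 - 2 * dist x y) := by
  rw [dist_eq_norm, dist_eq_norm, ← doubling_sub]
  exact norm_doubling _

theorem IsInvariantLamination.not_cross_rep {L : Set Leaf} (hL : IsInvariantLamination L)
    {c d u v : Angle} (h : s(c, d) ∈ L) (h' : s(u, v) ∈ L) (h₁ : rep c < rep u)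
    (h₂ : rep u < rep d) (h₃ : rep v < rep c ∨ rep d < rep v) : False := by
  refine hL.not_crosses _ h _ h' (Leaf.crosses_mk ?_ ?_) <;> rw [sbtw_iff_rep]
  · exact Or.inl ⟨h₁, h₂⟩
  · rcases h₃ with h₃ | h₃
    · right; left; exact ⟨h₃, by linarith⟩
    · right; right; exact ⟨by linarith, h₃⟩

/-- The majors of a lamination whose minor leaf is not degenerate. -/
theorem exists_majors_of_minor {L : Set Leaf} (hL : IsInvariantLamination L) {M : Leaf}
    (hM : IsMajor L M) {A B : Angle} (hm : s(A, B) = M.image) (hAB : rep A < rep B) :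
    0 < rep A ∧ rep B - rep A ≤ 1 / 3 ∧ s(A, B) ∈ L ∧
      (∀ x y, s(x, y) ∈ L → dist x y ≤ (1 - (rep B - rep A)) / 2) ∧
      ∃ x₀ x₁ y₀ y₁, rep x₀ = rep A / 2 ∧ rep x₁ = (rep A + 1) / 2 ∧ rep y₀ = rep B / 2 ∧
        rep y₁ = (rep B + 1) / 2 ∧ s(x₀, y₁) ∈ L ∧ s(y₀, x₁) ∈ L := by
  have hA0 := rep_nonneg A
  have hB1 := rep_lt_one B
  obtain ⟨x, y, rfl, hx, hy⟩ : ∃ x y, M = s(x, y) ∧ doubling x = A ∧ doubling y = B := by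
    induction M using Sym2.ind with
    | _ x y =>
      change s(A, B) = s(doubling x, doubling y) at hm
      rcases Sym2.eq_iff.1 hm with ⟨h1, h2⟩ | ⟨h1, h2⟩
      · exact ⟨x, y, rfl, h1.symm, h2.symm⟩
      · exact ⟨y, x, Sym2.eq_swap, h1.symm, h2.symm⟩
  have hD : doubling x ≠ doubling y := by
    rw [hx, hy]; rintro rfl; exact lt_irrefl _ hAB
  have hM' := hM.add_oneHalf_mem hL hD
  have hmL : s(A, B) ∈ L := by
    have := hL.forward _ hM.1
    rwa [← hm] at this
  have hmax : ∀ u v, s(u, v) ∈ L → dist u v ≤ dist x y := fun u v h => hM.2.2 _ h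
  -- A leaf of length less than `1/3` with distinct image ends has a longer image.
  have hlen : 1 / 3 ≤ dist x y := by
    have h1 := hmax _ _ hmL
    rw [← hx, ← hy] at h1
    have h2 : 0 < dist x y := dist_pos.2 fun e => hD (by rw [e])
    rcases dist_doubling x y with h | h <;> linarith
  have hx' : ∃ x₀ x₁, rep x₀ = rep A / 2 ∧ rep x₁ = (rep A + 1) / 2 ∧
      ((x = x₀ ∧ x + oneHalf = x₁) ∨ (x = x₁ ∧ x + oneHalf = x₀)) := by
    rcases rep_doubling x with h | h <;> rw [hx] at h <;>
      rcases rep_add_oneHalf x with h2 | h2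
    · exact ⟨x, x + oneHalf, by linarith, by linarith, Or.inl ⟨rfl, rfl⟩⟩
    · linarith
    · linarith
    · exact ⟨x + oneHalf, x, by linarith, by linarith, Or.inr ⟨rfl, rfl⟩⟩
  have hy' : ∃ y₀ y₁, rep y₀ = rep B / 2 ∧ rep y₁ = (rep B + 1) / 2 ∧
      ((y = y₀ ∧ y + oneHalf = y₁) ∨ (y = y₁ ∧ y + oneHalf = y₀)) := by
    rcases rep_doubling y with h | h <;> rw [hy] at h <;>
      rcases rep_add_oneHalf y with h2 | h2
    · exact ⟨y, y + oneHalf, by linarith, by linarith, Or.inl ⟨rfl, rfl⟩⟩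
    · linarith
    · linarith
    · exact ⟨y + oneHalf, y, by linarith, by linarith, Or.inr ⟨rfl, rfl⟩⟩
  obtain ⟨x₀, x₁, ex₀, ex₁, hxx⟩ := hx'
  obtain ⟨y₀, y₁, ey₀, ey₁, hyy⟩ := hy'
  have d00 : dist x₀ y₀ = (rep B - rep A) / 2 := by
    rw [dist_eq_rep, ex₀, ey₀, abs_of_neg (by linarith), min_eq_left (by linarith)]; ring
  have d11 : dist x₁ y₁ = (rep B - rep A) / 2 := by
    rw [dist_eq_rep, ex₁, ey₁, abs_of_neg (by linarith), min_eq_left (by linarith)]; ring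
  have d10 : dist x₁ y₀ = (1 - (rep B - rep A)) / 2 := by
    rw [dist_eq_rep, ex₁, ey₀, abs_of_pos (by linarith), min_eq_left (by linarith)]; ring
  have d01 : dist x₀ y₁ = (1 - (rep B - rep A)) / 2 := by
    rw [dist_eq_rep, ex₀, ey₁, abs_of_neg (by linarith), min_eq_right (by linarith)]; ring
  -- The preimages of the endpoints can be paired in two ways. In the short pairing the major has
  -- length `(B - A)/2`, at least `1/3`, and the minor leaf would cross one of the two preimages.
  have short : dist x y = (rep B - rep A) / 2 → s(x₀, y₀) ∈ L → s(x₁, y₁) ∈ L → False := by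
    intro h1 h2 h3
    rw [h1] at hlen
    rcases hA0.eq_or_lt with h | h
    · refine hL.not_cross_rep (u := B) (v := A) h3 (by rwa [Sym2.eq_swap]) ?_ ?_ (Or.inl ?_) <;>
        linarith
    · refine hL.not_cross_rep (u := A) (v := B) h2 hmL ?_ ?_ (Or.inr ?_) <;> linarith
  have long : dist x y = (1 - (rep B - rep A)) / 2 → s(x₀, y₁) ∈ L → s(x₁, y₀) ∈ L →
      0 < rep A ∧ rep B - rep A ≤ 1 / 3 ∧ s(A, B) ∈ L ∧
      (∀ x y, s(x, y) ∈ L → dist x y ≤ (1 - (rep B - rep A)) / 2) ∧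
      ∃ x₀ x₁ y₀ y₁, rep x₀ = rep A / 2 ∧ rep x₁ = (rep A + 1) / 2 ∧ rep y₀ = rep B / 2 ∧
        rep y₁ = (rep B + 1) / 2 ∧ s(x₀, y₁) ∈ L ∧ s(y₀, x₁) ∈ L := by
    intro h1 h2 h3
    rw [Sym2.eq_swap] at h3
    refine ⟨?_, by linarith, hmL, by rwa [h1] at hmax, x₀, x₁, y₀, y₁, ex₀, ex₁, ey₀, ey₁, h2, h3⟩
    rcases hA0.eq_or_lt with h | h
    · exfalso
      refine hL.not_cross_rep (u := B) (v := A) h3 (by rwa [Sym2.eq_swap]) ?_ ?_ (Or.inl ?_) <;>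
        linarith
    · exact h
  have hMm := hM.1
  rcases hxx with ⟨e1, e2⟩ | ⟨e1, e2⟩ <;> rcases hyy with ⟨e3, e4⟩ | ⟨e3, e4⟩ <;>
    rw [e2, e4] at hM' <;> rw [e1, e3] at short long hMm
  · exact (short d00 hMm hM').elim
  · exact long d01 hMm hM'
  · exact long d10 hM' hMm
  · exact (short d11 hM' hMm).elim

/-- The endpoints of a non-degenerate minor leaf have the same itinerary with respect to the two
arcs outside the strip between the major leaves. -/
theorem arcs_of_mem_QML {A B : Angle} (h : s(A, B) ∈ QML) (hAB : rep A < rep B) :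
    0 < rep A ∧ rep B - rep A ≤ 1 / 3 ∧ ∀ n,
      (doubling^[n] A ∈ arc (rep A) (rep B) .right ∧ doubling^[n] B ∈ arc (rep A) (rep B) .right) ∨
      (doubling^[n] A ∈ arc (rep A) (rep B) .left ∧
        doubling^[n] B ∈ arc (rep A) (rep B) .left) := by
  obtain ⟨L, hL, M, hM, hm⟩ := h
  obtain ⟨hA0, hlen, hmL, hmax, x₀, x₁, y₀, y₁, ex₀, ex₁, ey₀, ey₁, hl, hr⟩ :=
    exists_majors_of_minor hL hM hm hAB
  refine ⟨hA0, hlen, ?_⟩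
  have hB1 := rep_lt_one B
  -- No image is shorter than the minor leaf: with `m` the length of the minor and `d ≤ (1 - m)/2`
  -- that of a leaf, the next length is `2d` or `1 - 2d`, and both are at least `m` if `d ≥ m`.
  have hiter : ∀ n, s(doubling^[n] A, doubling^[n] B) ∈ L ∧
      rep B - rep A ≤ dist (doubling^[n] A) (doubling^[n] B) := by
    intro n
    induction n with
    | zero =>
      refine ⟨hmL, ?_⟩
      simp only [Function.iterate_zero, id_eq]
      rw [dist_eq_rep, abs_of_neg (by linarith), le_min_iff]
      constructor <;> linarith
    | succ n ih =>
      rw [Function.iterate_succ_apply', Function.iterate_succ_apply']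
      refine ⟨hL.forward _ ih.1, ?_⟩
      have h1 := hmax _ _ ih.1
      rcases dist_doubling (doubling^[n] A) (doubling^[n] B) with h | h <;> linarith
  intro n
  obtain ⟨hmem, hd⟩ := hiter n
  generalize doubling^[n] A = u at *
  generalize doubling^[n] B = v at *
  have hd2 := hmax _ _ hmem
  -- A leaf with an end strictly inside the strip between the majors stays in the strip. Within one
  -- of the two short arcs it is shorter than the minor leaf; from one to the other it is longer
  -- than the majors.
  have key : ∀ u v : Angle, s(u, v) ∈ L → rep B - rep A ≤ dist u v →
      dist u v ≤ (1 - (rep B - rep A)) / 2 →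
      (u ∈ arc (rep A) (rep B) .right ∧
        (v ∈ arc (rep A) (rep B) .left → False)) ∨ u ∈ arc (rep A) (rep B) .left := by
    intro u v hmem hd hd2
    have hu0 := rep_nonneg u
    have hu1 := rep_lt_one u
    have hv0 := rep_nonneg v
    have hv1 := rep_lt_one v
    rw [dist_eq_rep] at hd hd2
    rw [le_min_iff] at hd
    have hswap : s(v, u) ∈ L := by rwa [Sym2.eq_swap]
    have g1 : ¬ (rep B / 2 < rep u ∧ rep u < (rep A + 1) / 2 ∧
        (rep v < rep B / 2 ∨ (rep A + 1) / 2 < rep v)) := by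
      rintro ⟨h1, h2, h3⟩
      exact hL.not_cross_rep hr hmem (by rwa [ey₀]) (by rwa [ex₁]) (by rwa [ey₀, ex₁])
    have g2 : ¬ (rep B / 2 < rep v ∧ rep v < (rep A + 1) / 2 ∧
        (rep u < rep B / 2 ∨ (rep A + 1) / 2 < rep u)) := by
      rintro ⟨h1, h2, h3⟩
      exact hL.not_cross_rep hr hswap (by rwa [ey₀]) (by rwa [ex₁]) (by rwa [ey₀, ex₁])
    have g3 : ¬ (rep A / 2 < rep u ∧ rep u < (rep B + 1) / 2 ∧
        (rep v < rep A / 2 ∨ (rep B + 1) / 2 < rep v)) := by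
      rintro ⟨h1, h2, h3⟩
      exact hL.not_cross_rep hl hmem (by rwa [ex₀]) (by rwa [ey₁]) (by rwa [ex₀, ey₁])
    have hne : ¬ (|rep u - rep v| < rep B - rep A) := by linarith [hd.1]
    have hne2 : ¬ ((1 - (rep B - rep A)) / 2 < |rep u - rep v| ∧
        |rep u - rep v| < 1 - (1 - (rep B - rep A)) / 2) := by
      rintro ⟨h1, h2⟩
      have := lt_min h1 (show (1 - (rep B - rep A)) / 2 < 1 - |rep u - rep v| by linarith)
      linarith
    by_cases hL' : rep u ≤ rep A / 2 ∨ (rep B + 1) / 2 ≤ rep u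
    · exact Or.inr hL'
    push Not at hL'
    left
    have hvL : ¬ (rep v < rep A / 2 ∨ (rep B + 1) / 2 < rep v) := fun h => g3 ⟨hL'.1, hL'.2, h⟩
    push Not at hvL
    have huR : rep B / 2 ≤ rep u ∧ rep u ≤ (rep A + 1) / 2 := by
      by_contra hcon
      have hcon' : rep u < rep B / 2 ∨ (rep A + 1) / 2 < rep u := by
        by_contra! h; exact hcon h
      have hvR : rep v ≤ rep B / 2 ∨ (rep A + 1) / 2 ≤ rep v := by
        by_contra! h; exact g2 ⟨h.1, h.2, hcon'⟩
      rcases hcon' with h1 | h1 <;> rcases hvR with h2 | h2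
      · apply hne; rw [abs_lt]; constructor <;> linarith
      · apply hne2; rw [abs_of_neg (by linarith)]; constructor <;> linarith
      · apply hne2; rw [abs_of_pos (by linarith)]; constructor <;> linarith
      · apply hne; rw [abs_lt]; constructor <;> linarith
    refine ⟨huR, ?_⟩
    intro hv
    have hv' : rep v = rep A / 2 ∨ rep v = (rep B + 1) / 2 := by
      rcases hv with h | h
      · left; exact le_antisymm h hvL.1
      · right; exact le_antisymm hvL.2 h
    have hu' : rep u = rep B / 2 ∨ rep u = (rep A + 1) / 2 := by
      by_contra! h
      refine g1 ⟨lt_of_le_of_ne huR.1 (Ne.symm h.1), lt_of_le_of_ne huR.2 h.2, ?_⟩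
      rcases hv' with h | h
      · left; linarith
      · right; linarith
    rcases hu' with h1 | h1 <;> rcases hv' with h2 | h2
    · apply hne; rw [abs_lt]; constructor <;> linarith
    · apply hne2; rw [abs_of_neg (by linarith)]; constructor <;> linarith
    · apply hne2; rw [abs_of_pos (by linarith)]; constructor <;> linarith
    · apply hne; rw [abs_lt]; constructor <;> linarith
  rcases key u v hmem hd hd2 with ⟨h1, h1'⟩ | h1
  · rcases key v u (by rwa [Sym2.eq_swap]) (by rwa [dist_comm]) (by rwa [dist_comm]) with h2 | h2
    · exact Or.inl ⟨h1, h2.1⟩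
    · exact (h1' h2).elim
  · rcases key v u (by rwa [Sym2.eq_swap]) (by rwa [dist_comm]) (by rwa [dist_comm]) with h2 | h2
    · exact (h2.2 h1).elim
    · exact Or.inr ⟨h1, h2⟩

end Surgery

/-! ### Binary words and the periodic orbit with rotation number `p/q` -/

namespace Surgery

/-- The integer with a given binary expansion. -/
def wordVal : List (Fin 2) → ℕ
  | [] => 0
  | d :: l => (d : ℕ) * 2 ^ l.length + wordVal l

theorem wordVal_append_singleton (l : List (Fin 2)) (d : Fin 2) :
    wordVal (l ++ [d]) = 2 * wordVal l + d := by
  induction l with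
  | nil => simp [wordVal]
  | cons e l ih =>
    simp only [List.cons_append, wordVal, ih, List.length_append, List.length_cons,
      List.length_nil, pow_succ]
    ring

/-- A word followed by an infinite sequence. -/
def appendSeq (l : List (Fin 2)) (d : ℕ → Fin 2) (n : ℕ) : Fin 2 := l.getD n (d (n - l.length))

theorem ofDigits_appendSeq (l : List (Fin 2)) (d : ℕ → Fin 2) :
    2 ^ l.length * Real.ofDigits (appendSeq l d) = wordVal l + Real.ofDigits d := by
  induction l with
  | nil =>
    have : appendSeq [] d = d := by ext n; simp [appendSeq]
    simp [this, wordVal]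
  | cons e l ih =>
    have h := Real.ofDigits_eq_sum_add_ofDigits (appendSeq (e :: l) d) 1
    have h2 : (fun i => appendSeq (e :: l) d (i + 1)) = appendSeq l d := by
      ext n; simp [appendSeq]
    rw [h2] at h
    have h3 : Real.ofDigitsTerm (appendSeq (e :: l) d) 0 = (e : ℕ) / 2 := by
      simp [Real.ofDigitsTerm, appendSeq, div_eq_mul_inv]
    rw [Finset.sum_range_one, h3] at h
    rw [h, List.length_cons, pow_succ, wordVal]
    push_cast
    have : (2 : ℝ) ^ l.length * 2 * ((e : ℕ) / 2 + (2 ^ 1)⁻¹ * Real.ofDigits (appendSeq l d)) =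
      (e : ℕ) * 2 ^ l.length + 2 ^ l.length * Real.ofDigits (appendSeq l d) := by ring
    rw [this, ih]; ring

theorem le_length_flatMap_range {w : ℕ → List (Fin 2)} (hw : ∀ k, w k ≠ []) (m : ℕ) :
    m ≤ ((List.range m).flatMap w).length := by
  induction m with
  | zero => simp
  | succ m ih =>
    rw [List.range_succ, List.flatMap_append, List.length_append]
    have : 0 < (w m).length := List.length_pos_of_ne_nil (hw m)
    simp only [List.flatMap_cons, List.flatMap_nil, List.append_nil]
    omega

theorem getD_flatMap_range {w : ℕ → List (Fin 2)} (hw : ∀ k, w k ≠ []) {k m n : ℕ} (hk : k < m)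
    (hmn : m ≤ n) :
    ((List.range n).flatMap w).getD k 0 = ((List.range m).flatMap w).getD k 0 := by
  obtain ⟨j, rfl⟩ := Nat.exists_eq_add_of_le hmn
  rw [List.range_add, List.flatMap_append]
  exact List.getD_append _ _ _ _ (hk.trans_le (le_length_flatMap_range hw m))

theorem concat_eq_appendSeq {w : ℕ → List (Fin 2)} (hw : ∀ k, w k ≠ []) :
    concat w = appendSeq (w 0) (concat fun k => w (k + 1)) := by
  ext n : 1
  unfold concat appendSeq
  have h1 : (List.range (n + 1)).flatMap w =
      w 0 ++ (List.range n).flatMap fun k => w (k + 1) := by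
    rw [List.range_succ_eq_map, List.flatMap_cons, List.flatMap_map]
  rw [h1]
  have hpos : 0 < (w 0).length := List.length_pos_of_ne_nil (hw 0)
  rcases lt_or_ge n (w 0).length with h | h
  · rw [List.getD_append _ _ _ _ h, List.getD_eq_getElem _ _ h, List.getD_eq_getElem _ _ h]
  · rw [List.getD_append_right _ _ _ _ h, List.getD_eq_default _ _ h]
    exact getD_flatMap_range (fun k => hw (k + 1)) (by omega) (by omega)

theorem ofDigits_concat {w : ℕ → List (Fin 2)} (hw : ∀ k, w k ≠ []) :
    2 ^ (w 0).length * Real.ofDigits (concat w) =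
      wordVal (w 0) + Real.ofDigits (concat fun k => w (k + 1)) := by
  rw [concat_eq_appendSeq hw]
  exact ofDigits_appendSeq _ _

/-- The points of the periodic orbit with rotation number `p / q`, and their lifts: for `r < q` the
binary digits of `rotPt p q r` are the itinerary of `r / q` under the rotation by `p / q`. -/
noncomputable def rotPt (p q r : ℕ) : ℝ := ∑' k : ℕ, (1 / 2 : ℝ) ^ (k + 1) * ((r + k * p) / q : ℕ)

theorem summable_rotPt (p q r : ℕ) :
    Summable fun k : ℕ => (1 / 2 : ℝ) ^ (k + 1) * ((r + k * p) / q : ℕ) := by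
  have h1 : Summable fun k : ℕ => (k : ℝ) ^ 1 * (1 / 2 : ℝ) ^ k :=
    summable_pow_mul_geometric_of_norm_lt_one 1 (by norm_num)
  have h2 : Summable fun k : ℕ => (1 / 2 : ℝ) ^ k :=
    summable_geometric_of_lt_one (by norm_num) (by norm_num)
  refine Summable.of_nonneg_of_le (fun k => by positivity) (fun k => ?_)
    ((h1.mul_left (p : ℝ)).add (h2.mul_left (r : ℝ)))
  have h3 : (((r + k * p) / q : ℕ) : ℝ) ≤ r + k * p := by
    calc (((r + k * p) / q : ℕ) : ℝ) ≤ ((r + k * p : ℕ) : ℝ) := by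
          exact_mod_cast Nat.div_le_self _ _
      _ = r + k * p := by push_cast; ring
  have h4 : (1 / 2 : ℝ) ^ (k + 1) ≤ (1 / 2 : ℝ) ^ k := by
    rw [pow_succ]
    have : (0 : ℝ) < (1 / 2) ^ k := by positivity
    linarith
  calc (1 / 2 : ℝ) ^ (k + 1) * ((r + k * p) / q : ℕ)
      ≤ (1 / 2 : ℝ) ^ k * (r + k * p) := by gcongr
    _ = _ := by ring

section Rotation

variable {p q : ℕ} (hp : 0 < p) (hpq : p < q) (hcop : Nat.Coprime p q)

include hpq in
theorem rotPt_add_period (r : ℕ) : rotPt p q (r + q) = rotPt p q r + 1 := by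
  have hq : 0 < q := by omega
  have hs : HasSum (fun k : ℕ => (1 / 2 : ℝ) ^ (k + 1)) 1 := by
    have := hasSum_geometric_two.mul_left (1 / 2)
    simpa [pow_succ, mul_comm] using this
  have e := (summable_rotPt p q r).tsum_add hs.summable
  rw [hs.tsum_eq] at e
  unfold rotPt
  rw [← e]
  congr 1
  ext k
  have : (r + q + k * p) / q = (r + k * p) / q + 1 := by
    rw [show r + q + k * p = r + k * p + q by ring, Nat.add_div_right _ hq]
  rw [this]; push_cast; ring

/-- Doubling shifts the series by one place: the leading term becomes the integer part, and the
index moves by `p`. -/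
theorem two_mul_rotPt (r : ℕ) : 2 * rotPt p q r = (r / q : ℕ) + rotPt p q (r + p) := by
  unfold rotPt
  rw [(summable_rotPt p q r).tsum_eq_zero_add, mul_add, ← tsum_mul_left]
  congr 1
  · simp
  · congr 1
    ext k
    rw [show r + (k + 1) * p = r + p + k * p by ring, pow_succ]
    ring

include hcop in
theorem mul_mod_ne_zero {j : ℕ} (h0 : 0 < j) (hj : j < q) : j * p % q ≠ 0 := by
  intro h
  have h1 : q ∣ j * p := Nat.dvd_of_mod_eq_zero h
  have h2 : q ∣ j := (Nat.Coprime.dvd_of_dvd_mul_right hcop.symm h1)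
  exact absurd (Nat.le_of_dvd h0 h2) (by omega)

include hpq hcop in
theorem exists_dvd_add_mul (r : ℕ) : ∃ k, q ∣ r + k * p := by
  have hq : 0 < q := by omega
  have : NeZero q := ⟨hq.ne'⟩
  refine ⟨(-(r : ZMod q) * (p : ZMod q)⁻¹).val, ?_⟩
  rw [← ZMod.natCast_eq_zero_iff]
  push_cast
  rw [ZMod.natCast_val, ZMod.cast_id', id_eq, mul_assoc, mul_comm _ (p : ZMod q),
    ZMod.coe_mul_inv_eq_one p hcop]
  ring

include hpq hcop in
-- All the floors are monotone in `r`, and the one at a `k` with `q ∣ r + 1 + k p` jumps.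
theorem rotPt_strictMono : StrictMono (rotPt p q) := by
  apply strictMono_nat_of_lt_succ
  intro r
  have hq : 0 < q := by omega
  obtain ⟨k, hk⟩ := exists_dvd_add_mul hpq hcop (r + 1)
  unfold rotPt
  refine Summable.tsum_lt_tsum (i := k) (fun j => ?_) ?_ (summable_rotPt p q r)
    (summable_rotPt p q (r + 1))
  · have : (r + j * p) / q ≤ (r + 1 + j * p) / q := Nat.div_le_div_right (by omega)
    have h' : (((r + j * p) / q : ℕ) : ℝ) ≤ ((r + 1 + j * p) / q : ℕ) := by exact_mod_cast this
    gcongr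
  · have h1 : (r + k * p) / q < (r + 1 + k * p) / q := by
      obtain ⟨m, hm⟩ := hk
      rw [hm, Nat.mul_div_cancel_left _ hq, Nat.div_lt_iff_lt_mul hq, mul_comm m q]
      omega
    have h' : (((r + k * p) / q : ℕ) : ℝ) < ((r + 1 + k * p) / q : ℕ) := by exact_mod_cast h1
    gcongr

include hpq in
theorem two_mul_rotPt_mod (r : ℕ) : 2 * rotPt p q (r % q) =
    (if q - p ≤ r % q then (1 : Fin 2) else 0 : Fin 2) + rotPt p q ((r + p) % q) := by
  have hq : 0 < q := by omega
  have hr := Nat.mod_lt r hq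
  rw [two_mul_rotPt, Nat.div_eq_of_lt hr]
  split_ifs with h
  · have e : (r + p) % q + q = r % q + p := by
      rw [Nat.add_mod, Nat.mod_eq_of_lt hpq, Nat.mod_eq_sub_mod (by omega),
        Nat.mod_eq_of_lt (by omega)]
      omega
    rw [← e, rotPt_add_period hpq]
    simp; ring
  · have e : (r + p) % q = r % q + p := by
      rw [Nat.add_mod, Nat.mod_eq_of_lt hpq, Nat.mod_eq_of_lt (by omega)]
    rw [e]; simp

include hpq in
theorem wordVal_map_range (r n : ℕ) :
    (2 : ℝ) ^ n * rotPt p q (r % q) =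
      wordVal ((List.range n).map fun k => if q - p ≤ (r + k * p) % q then (1 : Fin 2) else 0) +
        rotPt p q ((r + n * p) % q) := by
  induction n with
  | zero => simp [wordVal]
  | succ n ih =>
    rw [List.range_succ, List.map_append, List.map_singleton, wordVal_append_singleton, pow_succ]
    have h := two_mul_rotPt_mod hpq (r + n * p)
    rw [show r + n * p + p = r + (n + 1) * p by ring] at h
    push_cast at *
    linarith

include hpq in
-- From index `p`, after `q - 1` steps the index is `q p ≡ 0`. So `Σ₁` consists of the digits read
-- on the way from `θ₁` to `z₀`.
theorem wordVal_sigma1 :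
    (2 : ℝ) ^ (q - 1) * rotPt p q p = wordVal (sigma1 p q) + rotPt p q 0 := by
  have h := wordVal_map_range hpq p (q - 1)
  have e : p + (q - 1) * p = q * p := by
    obtain ⟨m, rfl⟩ : ∃ m, q = m + 1 := ⟨q - 1, by omega⟩
    simp only [Nat.add_sub_cancel]; ring
  rw [e, Nat.mul_mod_right, Nat.mod_eq_of_lt hpq] at h
  rw [h, sigma1]
  congr 4
  ext k
  rw [show p + k * p = (k + 1) * p by ring]

include hp hpq hcop in
-- From index `p - 1` the indices are the residues of `(k + 1) p` lowered by one, without wrapping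
-- because these residues do not vanish. This turns `≥ q - p` into `> q - p`, and the orbit ends at
-- index `q - 1`.
theorem wordVal_sigma0 :
    (2 : ℝ) ^ (q - 1) * rotPt p q (p - 1) = wordVal (sigma0 p q) + rotPt p q (q - 1) := by
  have h := wordVal_map_range hpq (p - 1) (q - 1)
  have e : p - 1 + (q - 1) * p = q - 1 + q * (p - 1) := by
    obtain ⟨m, rfl⟩ : ∃ m, q = m + 1 := ⟨q - 1, by omega⟩
    obtain ⟨n, rfl⟩ : ∃ n, p = n + 1 := ⟨p - 1, by omega⟩
    simp only [Nat.add_sub_cancel]; ring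
  rw [e, Nat.add_mul_mod_self_left, Nat.mod_eq_of_lt (by omega : q - 1 < q),
    Nat.mod_eq_of_lt (by omega : p - 1 < q)] at h
  rw [h, sigma0]
  congr 3
  apply List.map_congr_left
  intro k hk
  rw [List.mem_range] at hk
  have h1 := mul_mod_ne_zero hcop (j := k + 1) (by omega) (by omega)
  have h2 : (p - 1 + k * p) % q = (k + 1) * p % q - 1 := by
    have h3 : p - 1 + k * p = (k + 1) * p - 1 := by
      obtain ⟨n, rfl⟩ : ∃ n, p = n + 1 := ⟨p - 1, by omega⟩
      rw [show (k + 1) * (n + 1) = n + k * (n + 1) + 1 by ring]; simp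
    rw [h3]
    have h4 := Nat.div_add_mod ((k + 1) * p) q
    have h5 : (k + 1) * p - 1 = ((k + 1) * p % q - 1) + q * ((k + 1) * p / q) := by omega
    rw [h5, Nat.add_mul_mod_self_left, Nat.mod_eq_of_lt]
    have := Nat.mod_lt ((k + 1) * p) (show 0 < q by omega)
    omega
  rw [h2]
  congr 1
  rw [eq_iff_iff]
  omega

include hp hpq hcop in
-- The two partitions differ only at the residue `q - p`, which occurs only for the last letter:
-- there `Σ₀` has 0 and `Σ₁` has 1.
theorem wordVal_sigma1_eq : wordVal (sigma1 p q) = wordVal (sigma0 p q) + 1 := by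
  obtain ⟨m, rfl⟩ : ∃ m, q = m + 2 := ⟨q - 2, by omega⟩
  unfold sigma0 sigma1
  rw [show m + 2 - 1 = m + 1 by omega, List.range_succ, List.map_append, List.map_append,
    List.map_singleton, List.map_singleton, wordVal_append_singleton, wordVal_append_singleton]
  have h1 : (m + 1) * p % (m + 2) = m + 2 - p := by
    have : (m + 1) * p = (m + 2 - p) + (m + 2) * (p - 1) := by
      obtain ⟨n, rfl⟩ : ∃ n, p = n + 1 := ⟨p - 1, by omega⟩
      zify [hpq.le]
      push_cast [Nat.add_sub_cancel]
      ring
    rw [this, Nat.add_mul_mod_self_left, Nat.mod_eq_of_lt (by omega)]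
  have h2 : (List.range m).map (fun k => if m + 2 - p ≤ (k + 1) * p % (m + 2) then (1 : Fin 2) else 0) =
      (List.range m).map fun k => if m + 2 - p < (k + 1) * p % (m + 2) then (1 : Fin 2) else 0 := by
    apply List.map_congr_left
    intro k hk
    rw [List.mem_range] at hk
    congr 1
    rw [eq_iff_iff]
    refine ⟨fun h => lt_of_le_of_ne h fun e => ?_, le_of_lt⟩
    refine mul_mod_ne_zero hcop (j := k + 2) (by omega) (by omega) ?_
    rw [show (k + 2) * p = (k + 1) * p + p by ring, Nat.add_mod, ← e, Nat.mod_eq_of_lt hpq,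
      Nat.sub_add_cancel hpq.le, Nat.mod_self]
  rw [h1, h2]
  simp

end Rotation

end Surgery

/-! ### Symbolic dynamics of the return map -/

namespace Surgery

/-- The numerical data of the first return map of doubling to the union of the sector `[θ₀, θ₁]` and
of the sector bounded by `z₁` and `z₀` which contains `0`: on `[θ₀, τ)` the return map is
`y ↦ N y - v`, on `[τ, θ₁]` it is `y ↦ N y - (v + 1)`. -/
structure Model where
  (N v z₀ θ₀ τ θ₁ z₁ : ℝ)
  two_le : 2 ≤ N
  mul_τ : N * τ = v + 1
  mul_θ₀ : N * θ₀ = v + z₁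
  mul_θ₁ : N * θ₁ = v + 1 + z₀
  two_z₀ : 2 * z₀ = θ₁
  two_z₁ : 2 * z₁ = 1 + θ₀
  z₀_pos : 0 < z₀
  z₀_le : z₀ ≤ θ₀
  θ₀_lt : θ₀ < τ
  τ_lt : τ < θ₁
  θ₁_le : θ₁ ≤ z₁
  z₁_lt : z₁ < 1

/-- The symbols of the itineraries, in increasing order. -/
inductive St
  | S0 | U | T0 | T1 | W | S1

/-- The position of a symbol. -/
def St.idx : St → ℕ
  | .S0 => 0 | .U => 1 | .T0 => 2 | .T1 => 3 | .W => 4 | .S1 => 5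

theorem St.idx_injective : Function.Injective St.idx := by
  intro s s' h
  cases s <;> cases s' <;> simp_all [St.idx]

namespace Model

variable (M M' : Model)

/-- The set of points with a given first symbol. -/
def piece : St → Set ℝ
  | .S0 => Set.Ico 0 M.z₀
  | .U => {M.θ₀}
  | .T0 => Set.Ioo M.θ₀ M.τ
  | .T1 => Set.Ico M.τ M.θ₁
  | .W => {M.θ₁}
  | .S1 => Set.Ioo M.z₁ 1

/-- The additive constant of the branch of the return map. -/
def wt : St → ℝ
  | .S0 => 0
  -- The branch sending `θ₀` to `z₁` is followed by one more doubling, which returns to `θ₀`. The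
  -- symbol `W` is treated likewise with `θ₁` and `z₀`.
  | .U => 2 * M.v + 1
  | .T0 => M.v
  | .T1 => M.v + 1
  | .W => 2 * (M.v + 1)
  | .S1 => 1

/-- The slope of the branch of the return map. -/
def len : St → ℝ
  | .S0 => 2
  | .U => 2 * M.N
  | .T0 => M.N
  | .T1 => M.N
  | .W => 2 * M.N
  | .S1 => 2

/-- `y` is an orbit of the return map, with itinerary `σ`. -/
def IsItin (σ : ℕ → St) (y : ℕ → ℝ) : Prop :=
  ∀ j, y j ∈ M.piece (σ j) ∧ M.len (σ j) * y j = M.wt (σ j) + y (j + 1)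

/-- The first symbol of a point. -/
noncomputable def st (t : ℝ) : St :=
  if t < M.z₀ then .S0 else if t ≤ M.θ₀ then .U else if t < M.τ then .T0
  else if t < M.θ₁ then .T1 else if t ≤ M.θ₁ then .W else .S1

variable {M M'} {σ σ' : ℕ → St} {x x' y y' : ℕ → ℝ}

theorem st_eq {s : St} {t : ℝ} (h : t ∈ M.piece s) : M.st t = s := by
  have h1 := M.z₀_le
  have h2 := M.θ₀_lt
  have h3 := M.τ_lt
  have h4 := M.θ₁_le
  unfold st
  cases s <;> simp only [piece, Set.mem_Ico, Set.mem_Ioo, Set.mem_singleton_iff] at h <;>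
    split_ifs <;> first | rfl | (exfalso; linarith)

theorem two_le_len (s : St) : 2 ≤ M.len s := by
  have := M.two_le
  cases s <;> simp only [len] <;> linarith

theorem piece_subset {s : St} {t : ℝ} (h : t ∈ M.piece s) : 0 ≤ t ∧ t < 1 := by
  have h0 := M.z₀_pos
  have h1 := M.z₀_le
  have h2 := M.θ₀_lt
  have h3 := M.τ_lt
  have h4 := M.θ₁_le
  have h5 := M.z₁_lt
  cases s <;> simp only [piece, Set.mem_Ico, Set.mem_Ioo, Set.mem_singleton_iff] at h <;>
    constructor <;> linarith

theorem lt_of_idx_lt {s s' : St} (hs : s.idx < s'.idx) {t t' : ℝ} (h : t ∈ M.piece s)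
    (h' : t' ∈ M.piece s') : t < t' := by
  have h1 := M.z₀_le
  have h2 := M.θ₀_lt
  have h3 := M.τ_lt
  have h4 := M.θ₁_le
  cases s <;> cases s' <;> simp [St.idx] at hs <;>
    simp only [piece, Set.mem_Ico, Set.mem_Ioo, Set.mem_singleton_iff] at h h' <;> linarith

/-- A bounded sequence satisfying the recursion of an itinerary is unique. -/
theorem eq_of_recursion (hy : ∀ j, y j ∈ Set.Icc (0 : ℝ) 1) (hy' : ∀ j, y' j ∈ Set.Icc (0 : ℝ) 1)
    (h : ∀ j, M.len (σ j) * y j = M.wt (σ j) + y (j + 1))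
    (h' : ∀ j, M.len (σ j) * y' j = M.wt (σ j) + y' (j + 1)) : y = y' := by
  have key : ∀ n j, |y j - y' j| ≤ (1 / 2 : ℝ) ^ n := by
    intro n
    induction n with
    | zero =>
      intro j
      rw [pow_zero, abs_le]
      constructor <;> linarith [(hy j).1, (hy j).2, (hy' j).1, (hy' j).2]
    | succ n ih =>
      intro j
      have e : M.len (σ j) * (y j - y' j) = y (j + 1) - y' (j + 1) := by linarith [h j, h' j]
      have h2 := M.two_le_len (σ j)
      have h3 := ih (j + 1)
      rw [← e, abs_mul, abs_of_nonneg (by linarith)] at h3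
      rw [pow_succ]
      nlinarith [abs_nonneg (y j - y' j)]
  ext j
  by_contra hne
  obtain ⟨n, hn⟩ := exists_pow_lt_of_lt_one (abs_pos.2 (sub_ne_zero.2 hne))
    (by norm_num : (1 / 2 : ℝ) < 1)
  linarith [key n j]

theorem IsItin.mem_Icc (h : M.IsItin σ y) (j : ℕ) : y j ∈ Set.Icc (0 : ℝ) 1 :=
  ⟨(piece_subset (h j).1).1, (piece_subset (h j).1).2.le⟩

theorem IsItin.eq (h : M.IsItin σ y) (h' : M.IsItin σ y') : y = y' :=
  eq_of_recursion h.mem_Icc h'.mem_Icc (fun j => (h j).2) fun j => (h' j).2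

/-- Points with itineraries are ordered in the same way in all models. -/
theorem IsItin.lt (hy : M.IsItin σ y) (hy' : M.IsItin σ' y') (hx : M'.IsItin σ x)
    (hx' : M'.IsItin σ' x') (h : y 0 < y' 0) : x 0 < x' 0 := by
  have hne : ∃ n, σ n ≠ σ' n := by
    by_contra hcon
    push Not at hcon
    obtain rfl : σ = σ' := funext hcon
    rw [hy.eq hy'] at h
    exact lt_irrefl _ h
  classical
  have hn := Nat.find_spec hne
  have hmin : ∀ j < Nat.find hne, σ j = σ' j := fun j hj => not_not.1 (Nat.find_min hne hj)
  generalize Nat.find hne = n at hn hmin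
  -- Before the first difference both orbits follow the same increasing branches, so the order of
  -- the points is that of the symbols at the first difference, whatever the model.
  have transfer : ∀ (P : Model) (u u' : ℕ → ℝ), P.IsItin σ u → P.IsItin σ' u' →
      ∀ j ≤ n, (u 0 < u' 0 ↔ u j < u' j) := by
    intro P u u' hu hu' j hj
    induction j with
    | zero => rfl
    | succ j ih =>
      rw [ih (by omega)]
      have e := (hu j).2
      have e' := (hu' j).2
      rw [← hmin j (by omega)] at e'
      have h2 := P.two_le_len (σ j)
      constructor <;> intro hlt <;> nlinarith
  rw [transfer _ _ _ hx hx' n le_rfl]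
  rw [transfer _ _ _ hy hy' n le_rfl] at h
  rcases lt_trichotomy (σ n).idx (σ' n).idx with hlt | heq | hgt
  · exact lt_of_idx_lt hlt (hx n).1 (hx' n).1
  · exact absurd (St.idx_injective heq) hn
  · exact absurd (lt_of_idx_lt hgt (hy' n).1 (hy n).1) (by linarith)

end Model

/-- The possible transitions between symbols. -/
def St.Trans : St → St → Prop
  | .S0, s => s = .S0 ∨ s = .U ∨ s = .T0 ∨ s = .T1
  | .S1, s => s = .S1 ∨ s = .W ∨ s = .T0 ∨ s = .T1
  | .T0, s => s = .S1
  | .T1, s => s = .S0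
  | .U, s => s = .U
  | .W, s => s = .W

/-- The sequences of symbols which are itineraries, in any model. -/
structure Admissible (σ : ℕ → St) : Prop where
  trans : ∀ j, (σ j).Trans (σ (j + 1))
  not_S1 : ∀ j, ¬ ∀ i, σ (j + i) = .S1
  not_S0T1 : ∀ j, ¬ ∀ i, σ (j + 2 * i) = .S0 ∧ σ (j + 2 * i + 1) = .T1
  not_S1T0 : ∀ j, ¬ ∀ i, σ (j + 2 * i) = .S1 ∧ σ (j + 2 * i + 1) = .T0

/-- A bounded quantity which is at least doubled in each step cannot be positive. -/
theorem not_forall_two_mul_le {f : ℕ → ℝ} (h0 : 0 < f 0) (hf : ∀ i, 2 * f i ≤ f (i + 1))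
    (hb : ∀ i, f i ≤ 1) : False := by
  have key : ∀ i, 2 ^ i * f 0 ≤ f i := by
    intro i
    induction i with
    | zero => simp
    | succ i ih => rw [pow_succ]; linarith [hf i]
  obtain ⟨n, hn⟩ := pow_unbounded_of_one_lt (1 / f 0) (by norm_num : (1 : ℝ) < 2)
  rw [div_lt_iff₀ h0] at hn
  linarith [key n, hb n]

namespace Model

variable {M : Model} {σ : ℕ → St} {y : ℕ → ℝ}

/-- Transitions are read off from the images of the pieces. The excluded tails belong to the missing
ends: constant `S1` to the point 1, and the alternations to the cycles of `z₀, θ₁` and `z₁, θ₀`.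
Along such a tail the distance to the missing end at least doubles in each period, yet stays
bounded. -/
theorem IsItin.admissible (h : M.IsItin σ y) : Admissible σ := by
  have h0 := M.z₀_pos
  have h1 := M.z₀_le
  have h2 := M.θ₀_lt
  have h3 := M.τ_lt
  have h4 := M.θ₁_le
  have h5 := M.z₁_lt
  have hN := M.two_le
  have e1 := M.mul_τ
  have e2 := M.mul_θ₀
  have e3 := M.mul_θ₁
  have e4 := M.two_z₀
  have e5 := M.two_z₁
  refine ⟨fun j => ?_, fun j hj => ?_, fun j hj => ?_, fun j hj => ?_⟩
  · obtain ⟨ha, hb⟩ := h j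
    obtain ⟨hc, -⟩ := h (j + 1)
    generalize y (j + 1) = y' at *
    generalize σ (j + 1) = s' at *
    generalize σ j = s at *
    generalize y j = t at *
    have key : ∀ c d, c < d → M.N * c < M.N * d := fun c d hcd => by nlinarith
    have k1 := key M.θ₀ t
    have k2 := key t M.τ
    have k3 := key t M.θ₁
    have k4 : M.τ ≤ t → M.N * M.τ ≤ M.N * t := fun hcd => by nlinarith
    cases s <;> simp only [piece, Set.mem_Ico, Set.mem_Ioo, Set.mem_singleton_iff, len, wt] at ha hb
    · cases s' <;> simp only [piece, Set.mem_Ico, Set.mem_Ioo, Set.mem_singleton_iff] at hc <;>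
        simp [St.Trans] <;> linarith
    · have : y' = M.θ₀ := by subst ha; linarith
      cases s' <;> simp only [piece, Set.mem_Ico, Set.mem_Ioo, Set.mem_singleton_iff] at hc <;>
        simp [St.Trans] <;> linarith
    · have k1 := k1 ha.1
      have k2 := k2 ha.2
      cases s' <;> simp only [piece, Set.mem_Ico, Set.mem_Ioo, Set.mem_singleton_iff] at hc <;>
        simp [St.Trans] <;> linarith
    · have k3 := k3 ha.2
      have k4 := k4 ha.1
      cases s' <;> simp only [piece, Set.mem_Ico, Set.mem_Ioo, Set.mem_singleton_iff] at hc <;>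
        simp [St.Trans] <;> linarith
    · have : y' = M.θ₁ := by subst ha; linarith
      cases s' <;> simp only [piece, Set.mem_Ico, Set.mem_Ioo, Set.mem_singleton_iff] at hc <;>
        simp [St.Trans] <;> linarith
    · cases s' <;> simp only [piece, Set.mem_Ico, Set.mem_Ioo, Set.mem_singleton_iff] at hc <;>
        simp [St.Trans] <;> linarith
  · refine not_forall_two_mul_le (f := fun i => 1 - y (j + i)) ?_ (fun i => ?_) fun i => ?_
    · linarith [(piece_subset (h (j + 0)).1).2]
    · have := (h (j + i)).2
      rw [hj i] at this
      simp only [len, wt] at this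
      change 2 * (1 - y (j + i)) ≤ 1 - y (j + i + 1)
      linarith
    · linarith [(piece_subset (h (j + i)).1).1]
  · refine not_forall_two_mul_le (f := fun i => M.z₀ - y (j + 2 * i)) ?_ (fun i => ?_) fun i => ?_
    · have := (h (j + 2 * 0)).1
      rw [(hj 0).1] at this
      exact sub_pos.2 this.2
    · have g1 := (h (j + 2 * i)).2
      have g2 := (h (j + 2 * i + 1)).2
      have g3 := (h (j + 2 * i)).1
      rw [(hj i).1] at g1 g3
      rw [(hj i).2] at g2
      simp only [len, wt] at g1 g2
      change 2 * (M.z₀ - y (j + 2 * i)) ≤ M.z₀ - y (j + 2 * i + 1 + 1)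
      have g4 := g3.2
      nlinarith
    · linarith [(piece_subset (h (j + 2 * i)).1).1]
  · refine not_forall_two_mul_le (f := fun i => y (j + 2 * i) - M.z₁) ?_ (fun i => ?_) fun i => ?_
    · have := (h (j + 2 * 0)).1
      rw [(hj 0).1] at this
      exact sub_pos.2 this.1
    · have g1 := (h (j + 2 * i)).2
      have g2 := (h (j + 2 * i + 1)).2
      have g3 := (h (j + 2 * i)).1
      rw [(hj i).1] at g1 g3
      rw [(hj i).2] at g2
      simp only [len, wt] at g1 g2
      change 2 * (y (j + 2 * i) - M.z₁) ≤ y (j + 2 * i + 1 + 1) - M.z₁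
      have g4 := g3.1
      nlinarith
    · linarith [(piece_subset (h (j + 2 * i)).1).2]

/-- The lower end of a piece. -/
def lo (M : Model) : St → ℝ
  | .S0 => 0 | .U => M.θ₀ | .T0 => M.θ₀ | .T1 => M.τ | .W => M.θ₁ | .S1 => M.z₁

/-- The upper end of a piece. -/
def hi (M : Model) : St → ℝ
  | .S0 => M.z₀ | .U => M.θ₀ | .T0 => M.τ | .T1 => M.θ₁ | .W => M.θ₁ | .S1 => 1

/-- Together with `wt_add_hi_le`: the branch of a piece covers the closed hull of every allowed
successor, so inverse branches map hulls into hulls. -/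
theorem len_mul_lo_le {s s' : St} (h : s.Trans s') : M.len s * M.lo s ≤ M.wt s + M.lo s' := by
  have h0 := M.z₀_pos
  have h1 := M.z₀_le
  have h2 := M.θ₀_lt
  have h3 := M.τ_lt
  have h4 := M.θ₁_le
  have h5 := M.z₁_lt
  have e1 := M.mul_τ
  have e2 := M.mul_θ₀
  have e3 := M.mul_θ₁
  have e4 := M.two_z₀
  have e5 := M.two_z₁
  cases s <;> cases s' <;> simp [St.Trans] at h <;> simp only [len, lo, wt] <;> linarith

theorem wt_add_hi_le {s s' : St} (h : s.Trans s') : M.wt s + M.hi s' ≤ M.len s * M.hi s := by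
  have h0 := M.z₀_pos
  have h1 := M.z₀_le
  have h2 := M.θ₀_lt
  have h3 := M.τ_lt
  have h4 := M.θ₁_le
  have h5 := M.z₁_lt
  have e1 := M.mul_τ
  have e2 := M.mul_θ₀
  have e3 := M.mul_θ₁
  have e4 := M.two_z₀
  have e5 := M.two_z₁
  cases s <;> cases s' <;> simp [St.Trans] at h <;> simp only [len, hi, wt] <;> linarith

/-- Inverse branches contract by at least a factor of 2, so a deviation from the hull at time `j` is
at most half of a bound for it at time `j + 1`. -/
theorem mem_Icc_lo_hi (hσ : Admissible σ) (hy : ∀ j, y j ∈ Set.Icc (0 : ℝ) 1)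
    (h : ∀ j, M.len (σ j) * y j = M.wt (σ j) + y (j + 1)) (j : ℕ) :
    M.lo (σ j) ≤ y j ∧ y j ≤ M.hi (σ j) := by
  have h0 := M.z₀_pos
  have h1 := M.z₀_le
  have h2 := M.θ₀_lt
  have h3 := M.τ_lt
  have h4 := M.θ₁_le
  have h5 := M.z₁_lt
  have key : ∀ n j, M.lo (σ j) - (1 / 2 : ℝ) ^ n ≤ y j ∧ y j ≤ M.hi (σ j) + (1 / 2 : ℝ) ^ n := by
    intro n
    induction n with
    | zero =>
      intro j
      obtain ⟨ha, hb⟩ := hy j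
      rw [pow_zero]
      cases σ j <;> simp only [lo, hi] <;> constructor <;> linarith
    | succ n ih =>
      intro j
      obtain ⟨ha, hb⟩ := ih (j + 1)
      have hlo := M.len_mul_lo_le (hσ.trans j)
      have hhi := M.wt_add_hi_le (hσ.trans j)
      have h2 := M.two_le_len (σ j)
      have hp : (0 : ℝ) < (1 / 2) ^ n := by positivity
      have e := h j
      rw [pow_succ]
      constructor <;> by_contra hcon <;> push Not at hcon <;> nlinarith
  constructor
  · refine le_of_forall_pos_lt_add fun ε hε => ?_
    obtain ⟨n, hn⟩ := exists_pow_lt_of_lt_one hε (by norm_num : (1 / 2 : ℝ) < 1)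
    linarith [(key n j).1]
  · refine le_of_forall_pos_lt_add fun ε hε => ?_
    obtain ⟨n, hn⟩ := exists_pow_lt_of_lt_one hε (by norm_num : (1 / 2 : ℝ) < 1)
    linarith [(key n j).2]

/-- The solution lies in the closed hulls of the pieces. Being at an end which the piece omits would
force one of the excluded tails. -/
theorem isItin_of_admissible (hσ : Admissible σ) (hy : ∀ j, y j ∈ Set.Icc (0 : ℝ) 1)
    (h : ∀ j, M.len (σ j) * y j = M.wt (σ j) + y (j + 1)) : M.IsItin σ y := by
  have h0 := M.z₀_pos
  have h1 := M.z₀_le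
  have h2 := M.θ₀_lt
  have h3 := M.τ_lt
  have h4 := M.θ₁_le
  have h5 := M.z₁_lt
  have e1 := M.mul_τ
  have e2 := M.mul_θ₀
  have e3 := M.mul_θ₁
  have e4 := M.two_z₀
  have e5 := M.two_z₁
  have hb := M.mem_Icc_lo_hi hσ hy h
  have hS0 : ∀ j, σ j = .S0 → y j ≠ M.z₀ := by
    intro j hj hyj
    refine hσ.not_S0T1 j ?_
    have step : ∀ i, σ i = .S0 → y i = M.z₀ →
        σ (i + 1) = .T1 ∧ σ (i + 1 + 1) = .S0 ∧ y (i + 1 + 1) = M.z₀ := by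
      intro i hi hyi
      have g1 := h i
      rw [hi, hyi] at g1
      simp only [len, wt] at g1
      have g2 : σ (i + 1) = .T1 := by
        have t := hσ.trans i
        have b := hb (i + 1)
        rw [hi] at t
        rcases t with t | t | t | t <;> rw [t] at b ⊢ <;> simp only [lo, Model.hi] at b <;> linarith
      have g3 := h (i + 1)
      have t := hσ.trans (i + 1)
      rw [g2] at g3 t
      simp only [len, wt] at g3
      refine ⟨g2, t, ?_⟩
      have : y (i + 1) = M.θ₁ := by linarith
      rw [this] at g3
      linarith
    have all : ∀ i, σ (j + 2 * i) = .S0 ∧ y (j + 2 * i) = M.z₀ := by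
      intro i
      induction i with
      | zero => exact ⟨hj, hyj⟩
      | succ i ih => exact (step _ ih.1 ih.2).2
    exact fun i => ⟨(all i).1, (step _ (all i).1 (all i).2).1⟩
  have hS1 : ∀ j, σ j = .S1 → y j ≠ M.z₁ := by
    intro j hj hyj
    refine hσ.not_S1T0 j ?_
    have step : ∀ i, σ i = .S1 → y i = M.z₁ →
        σ (i + 1) = .T0 ∧ σ (i + 1 + 1) = .S1 ∧ y (i + 1 + 1) = M.z₁ := by
      intro i hi hyi
      have g1 := h i
      rw [hi, hyi] at g1
      simp only [len, wt] at g1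
      have g2 : σ (i + 1) = .T0 := by
        have t := hσ.trans i
        have b := hb (i + 1)
        rw [hi] at t
        rcases t with t | t | t | t <;> rw [t] at b ⊢ <;> simp only [lo, Model.hi] at b <;> linarith
      have g3 := h (i + 1)
      have t := hσ.trans (i + 1)
      rw [g2] at g3 t
      simp only [len, wt] at g3
      refine ⟨g2, t, ?_⟩
      have : y (i + 1) = M.θ₀ := by linarith
      rw [this] at g3
      linarith
    have all : ∀ i, σ (j + 2 * i) = .S1 ∧ y (j + 2 * i) = M.z₁ := by
      intro i
      induction i with
      | zero => exact ⟨hj, hyj⟩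
      | succ i ih => exact (step _ ih.1 ih.2).2
    exact fun i => ⟨(all i).1, (step _ (all i).1 (all i).2).1⟩
  have hone : ∀ j, σ j = .S1 → y j ≠ 1 := by
    intro j hj hyj
    refine hσ.not_S1 j ?_
    have all : ∀ i, σ (j + i) = .S1 ∧ y (j + i) = 1 := by
      intro i
      induction i with
      | zero => exact ⟨hj, hyj⟩
      | succ i ih =>
        have g1 := h (j + i)
        have t := hσ.trans (j + i)
        have b := hb (j + i + 1)
        rw [ih.1] at t
        rw [ih.1, ih.2] at g1
        simp only [len, wt] at g1
        refine ⟨?_, by rw [← add_assoc]; linarith⟩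
        rw [← add_assoc]
        rcases t with t | t | t | t <;> rw [t] at b ⊢ <;> simp only [lo, hi] at b <;> linarith
    exact fun i => (all i).1
  intro j
  refine ⟨?_, h j⟩
  have b := hb j
  have g := h j
  have t := hσ.trans j
  cases hs : σ j <;> rw [hs] at b g t <;> simp only [lo, hi, len, wt] at b g <;>
    simp only [piece, Set.mem_Ico, Set.mem_Ioo, Set.mem_singleton_iff]
  · exact ⟨b.1, lt_of_le_of_ne b.2 (hS0 j hs)⟩
  · linarith
  · refine ⟨lt_of_le_of_ne b.1 fun e => hS1 (j + 1) t ?_,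
      lt_of_le_of_ne b.2 fun e => hone (j + 1) t ?_⟩
    · rw [← e] at g; linarith
    · rw [e] at g; linarith
  · refine ⟨b.1, lt_of_le_of_ne b.2 fun e => hS0 (j + 1) t ?_⟩
    rw [e] at g; linarith
  · linarith
  · exact ⟨lt_of_le_of_ne b.1 (hS1 j hs).symm, lt_of_le_of_ne b.2 (hone j hs)⟩

end Model

end Surgery

/-! ### The surgery map as a conjugacy of return maps -/

namespace Surgery

open Model

theorem iterate_doubling (n : ℕ) (z : Angle) : doubling^[n] z = ((2 ^ n * rep z : ℝ) : Angle) := by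
  induction n with
  | zero => simp [coe_rep]
  | succ n ih =>
    rw [Function.iterate_succ_apply', ih, doubling, ← AddCircle.coe_add, pow_succ]
    congr 1
    ring

theorem rep_iterate_doubling {n k : ℕ} {z : Angle} {t : ℝ} (h : 2 ^ n * rep z = k + t) (h0 : 0 ≤ t)
    (h1 : t < 1) : rep (doubling^[n] z) = t := by
  have e := rep_coe_add_int (k : ℤ) h0 h1
  rw [Int.cast_natCast] at e
  rw [iterate_doubling, h, add_comm, e]

namespace Model

/-- Thus `wt s` is the integer part of `len s * t`, and the branch of `s` is an iterate of doubling.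
-/
theorem len_mul_sub_wt_mem {M : Model} {s : St} {t : ℝ} (h : t ∈ M.piece s) :
    0 ≤ M.len s * t - M.wt s ∧ M.len s * t - M.wt s < 1 := by
  have h0 := M.z₀_pos
  have h1 := M.z₀_le
  have h2 := M.θ₀_lt
  have h3 := M.τ_lt
  have h4 := M.θ₁_le
  have h5 := M.z₁_lt
  have hN := M.two_le
  have e1 := M.mul_τ
  have e2 := M.mul_θ₀
  have e3 := M.mul_θ₁
  have e4 := M.two_z₀
  have e5 := M.two_z₁
  cases s <;> simp only [piece, Set.mem_Ico, Set.mem_Ioo, Set.mem_singleton_iff] at h <;>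
    simp only [len, wt]
  · constructor <;> linarith
  · subst h; constructor <;> linarith
  · constructor <;> nlinarith
  · constructor <;> nlinarith
  · subst h; constructor <;> linarith
  · constructor <;> linarith

end Model

section Words

variable {p q : ℕ} (hp : 0 < p) (hpq : p < q) (hcop : Nat.Coprime p q)

include hpq hcop in
theorem rotPt_zero_pos (hp : 0 < p) : 0 < rotPt p q 0 := by
  have h1 := two_mul_rotPt (p := p) (q := q) 0
  have h2 := rotPt_strictMono hpq hcop hp
  rw [Nat.zero_div, Nat.cast_zero, zero_add, zero_add] at h1
  linarith

include hp hpq in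
theorem two_mul_rotPt_last : 2 * rotPt p q (q - 1) = 1 + rotPt p q (p - 1) := by
  have h := two_mul_rotPt (p := p) (q := q) (q - 1)
  rw [Nat.div_eq_of_lt (by omega), show q - 1 + p = p - 1 + q by omega, rotPt_add_period hpq] at h
  push_cast at h
  linarith

include hp hpq hcop in
theorem rotPt_last_lt_one : rotPt p q (q - 1) < 1 := by
  have h1 := two_mul_rotPt_last hp hpq
  have h2 := rotPt_strictMono hpq hcop (show p - 1 < q - 1 by omega)
  linarith

end Words

/-- The return map of doubling to the sectors of the `α`-portrait at `0` and at `τ`. -/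
noncomputable def model (p q : ℕ) (hp : 0 < p) (hpq : p < q) (hcop : Nat.Coprime p q) : Model where
  N := 2 ^ (q - 1)
  v := wordVal (sigma0 p q)
  z₀ := rotPt p q 0
  θ₀ := rotPt p q (p - 1)
  -- The point of `[θ₀, θ₁]` which reaches 0 after `q - 1` doublings; its expansion is `Σ₁` followed
  -- by zeros.
  τ := (wordVal (sigma0 p q) + 1) / 2 ^ (q - 1)
  θ₁ := rotPt p q p
  z₁ := rotPt p q (q - 1)
  two_le := by
    calc (2 : ℝ) = 2 ^ 1 := by norm_num
      _ ≤ 2 ^ (q - 1) := pow_le_pow_right₀ (by norm_num) (by omega)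
  mul_τ := by field_simp
  mul_θ₀ := wordVal_sigma0 hp hpq hcop
  mul_θ₁ := by
    rw [wordVal_sigma1 hpq, wordVal_sigma1_eq hp hpq hcop]; push_cast; ring
  two_z₀ := by
    have h := two_mul_rotPt (p := p) (q := q) 0
    simpa using h
  two_z₁ := two_mul_rotPt_last hp hpq
  z₀_pos := rotPt_zero_pos hpq hcop hp
  z₀_le := (rotPt_strictMono hpq hcop).monotone (Nat.zero_le _)
  θ₀_lt := by
    rw [lt_div_iff₀ (by positivity), mul_comm, wordVal_sigma0 hp hpq hcop]
    linarith [rotPt_last_lt_one hp hpq hcop]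
  τ_lt := by
    rw [div_lt_iff₀ (by positivity), mul_comm, wordVal_sigma1 hpq, wordVal_sigma1_eq hp hpq hcop]
    push_cast
    linarith [rotPt_zero_pos hpq hcop hp]
  θ₁_le := (rotPt_strictMono hpq hcop).monotone (by omega)
  z₁_lt := rotPt_last_lt_one hp hpq hcop

section Words

variable {p q : ℕ} (hp : 0 < p) (hpq : p < q) (hcop : Nat.Coprime p q)

/-- The binary word of a symbol. -/
def word (p q : ℕ) : St → List (Fin 2)
  | .S0 => [0]
  | .U => sigma0 p q ++ [1]
  | .T0 => sigma0 p q
  | .T1 => sigma1 p q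
  | .W => sigma1 p q ++ [0]
  | .S1 => [1]

/-- The return time. -/
def stepLen (q : ℕ) : St → ℕ
  | .S0 => 1 | .U => q | .T0 => q - 1 | .T1 => q - 1 | .W => q | .S1 => 1

include hpq in
theorem stepLen_pos (hp : 0 < p) (s : St) : 0 < stepLen q s := by
  cases s <;> simp only [stepLen] <;> omega

include hpq in
theorem length_word (s : St) : (word p q s).length = stepLen q s := by
  cases s <;> simp [word, stepLen, sigma0, sigma1] <;> omega

theorem two_pow_stepLen (s : St) : (2 : ℝ) ^ stepLen q s = (model p q hp hpq hcop).len s := by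
  have e : (2 : ℝ) ^ q = 2 * 2 ^ (q - 1) := by
    rw [← pow_succ']; congr 1; omega
  cases s <;> simp [stepLen, len, model, e]

theorem wordVal_word (s : St) : (wordVal (word p q s) : ℝ) = (model p q hp hpq hcop).wt s := by
  cases s <;> simp [word, wt, model, wordVal_append_singleton, wordVal_sigma1_eq hp hpq hcop] <;>
    simp [wordVal]

include hp hpq in
theorem word_ne_nil (s : St) : word p q s ≠ [] := by
  rw [← List.length_pos_iff_ne_nil, length_word hpq]
  exact stepLen_pos hpq hp s

/-- The return map on angles. -/
noncomputable def retMap (p q : ℕ) (hp : 0 < p) (hpq : p < q) (hcop : Nat.Coprime p q)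
    (z : Angle) : Angle :=
  doubling^[stepLen q ((model p q hp hpq hcop).st (rep z))] z

variable {hp hpq hcop} {σ : ℕ → St} {y : ℕ → ℝ} {z : Angle} {s : St}

theorem retMap_eq (h : rep z ∈ (model p q hp hpq hcop).piece s) :
    retMap p q hp hpq hcop z = doubling^[stepLen q s] z := by
  rw [retMap, st_eq h]

theorem len_mul_rep (h : rep z ∈ (model p q hp hpq hcop).piece s) :
    (model p q hp hpq hcop).len s * rep z =
      (model p q hp hpq hcop).wt s + rep (retMap p q hp hpq hcop z) := by
  obtain ⟨h0, h1⟩ := len_mul_sub_wt_mem h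
  have e := rep_iterate_doubling (z := z) (n := stepLen q s) (k := wordVal (word p q s))
    (t := (model p q hp hpq hcop).len s * rep z - (model p q hp hpq hcop).wt s)
    (by rw [two_pow_stepLen hp hpq hcop, wordVal_word hp hpq hcop]; ring) h0 h1
  rw [retMap_eq h, e]
  ring

theorem isItin_retMap
    (h : ∀ k, rep ((retMap p q hp hpq hcop)^[k] z) ∈ (model p q hp hpq hcop).piece (σ k)) :
    (model p q hp hpq hcop).IsItin σ fun k => rep ((retMap p q hp hpq hcop)^[k] z) :=
  fun k => ⟨h k, by beta_reduce; rw [Function.iterate_succ_apply']; exact len_mul_rep (h k)⟩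

theorem rep_iterate_retMap (h : (model p q hp hpq hcop).IsItin σ y) (k : ℕ) :
    rep ((retMap p q hp hpq hcop)^[k] (y 0 : Angle)) = y k := by
  induction k with
  | zero =>
    obtain ⟨h0, h1⟩ := piece_subset (h 0).1
    exact rep_coe h0 h1
  | succ k ih =>
    rw [Function.iterate_succ_apply']
    have := len_mul_rep (hp := hp) (hpq := hpq) (hcop := hcop) (ih ▸ (h k).1)
    rw [ih] at this
    linarith [(h k).2]

end Words

section Real

/-- The model of the real vein. -/
noncomputable abbrev realModel : Model := model 1 2 (by norm_num) (by norm_num) (by norm_num)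

/-- Doubling, modified to fix `1/3` and `2/3`. -/
noncomputable abbrev haltedMap : Angle → Angle :=
  retMap 1 2 (by norm_num) (by norm_num) (by norm_num)

theorem realModel_N : realModel.N = 2 := by simp [model]

theorem realModel_v : realModel.v = 0 := by
  have : sigma0 1 2 = [0] := by decide
  simp [model, this, wordVal]

theorem realModel_τ : realModel.τ = 1 / 2 := by
  have := realModel.mul_τ
  rw [realModel_N, realModel_v] at this
  linarith

theorem realModel_z₀ : realModel.z₀ = 1 / 3 := by
  have h1 := realModel.mul_θ₁
  have h2 := realModel.two_z₀
  rw [realModel_N, realModel_v] at h1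
  linarith

theorem realModel_θ₁ : realModel.θ₁ = 2 / 3 := by
  have h2 := realModel.two_z₀
  rw [realModel_z₀] at h2
  linarith

theorem realModel_θ₀ : realModel.θ₀ = 1 / 3 := by
  have h1 := realModel.mul_θ₀
  have h2 := realModel.two_z₁
  rw [realModel_N, realModel_v] at h1
  linarith

theorem realModel_z₁ : realModel.z₁ = 2 / 3 := by
  have h2 := realModel.two_z₁
  rw [realModel_θ₀] at h2
  linarith

/-- The first symbol of an angle. -/
noncomputable def symbol (x : Angle) : St := realModel.st (rep x)

theorem symbol_eq (x : Angle) : symbol x =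
    if rep x < 1 / 3 then .S0 else if rep x ≤ 1 / 3 then .U else if rep x < 1 / 2 then .T0
    else if rep x < 2 / 3 then .T1 else if rep x ≤ 2 / 3 then .W else .S1 := by
  rw [symbol, st, realModel_z₀, realModel_θ₀, realModel_τ, realModel_θ₁]

theorem rep_mem_piece_symbol (x : Angle) : rep x ∈ realModel.piece (symbol x) := by
  have h0 := rep_nonneg x
  have h1 := rep_lt_one x
  rw [symbol_eq]
  split_ifs with g1 g2 g3 g4 g5 <;>
    simp only [piece, Set.mem_Ico, Set.mem_Ioo, Set.mem_singleton_iff, realModel_z₀, realModel_θ₀,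
      realModel_τ, realModel_θ₁, realModel_z₁] <;>
    first | linarith | (constructor <;> linarith)

theorem rep_oneThird : rep oneThird = 1 / 3 := rep_coe (by norm_num) (by norm_num)

theorem rep_twoThirds : rep twoThirds = 2 / 3 := rep_coe (by norm_num) (by norm_num)

theorem eq_oneThird_iff {x : Angle} : x = oneThird ↔ rep x = 1 / 3 := by
  rw [← rep_oneThird, rep_inj]

theorem eq_twoThirds_iff {x : Angle} : x = twoThirds ↔ rep x = 2 / 3 := by
  rw [← rep_twoThirds, rep_inj]

theorem haltedMap_of_fixed {x : Angle} (h : x = oneThird ∨ x = twoThirds) : haltedMap x = x := by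
  apply rep_injective
  have e := len_mul_rep (rep_mem_piece_symbol x)
  rw [eq_oneThird_iff, eq_twoThirds_iff] at h
  rw [symbol_eq] at e
  rcases h with h | h <;> norm_num [h, len, wt, realModel_N, realModel_v] at e <;> rw [h] <;>
    linarith

theorem haltedMap_of_ne {x : Angle} (h : ¬ (x = oneThird ∨ x = twoThirds)) :
    haltedMap x = doubling x := by
  rw [eq_oneThird_iff, eq_twoThirds_iff] at h
  push Not at h
  rw [haltedMap, retMap_eq (rep_mem_piece_symbol x), symbol_eq]
  split_ifs with g1 g2 g3 g4 g5
  · rfl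
  · exact absurd (le_antisymm g2 (not_lt.1 g1)) h.1
  · rfl
  · rfl
  · exact absurd (le_antisymm g5 (not_lt.1 g4)) h.2
  · rfl

/-- The itinerary of an angle. -/
noncomputable def itin (x : Angle) (k : ℕ) : St := symbol (haltedMap^[k] x)

theorem isItin_itin (x : Angle) : realModel.IsItin (itin x) fun k => rep (haltedMap^[k] x) :=
  isItin_retMap fun k => rep_mem_piece_symbol (haltedMap^[k] x)

theorem code_eq_word (p q : ℕ) {x : Angle} (h : ¬ (x = oneThird ∨ x = twoThirds)) :
    code p q x = word p q (symbol x) := by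
  rw [eq_oneThird_iff, eq_twoThirds_iff] at h
  push Not at h
  rw [symbol_eq, code]
  split_ifs with g1 g2 g3 g4 g5 g6 <;> first | rfl | (exfalso; push Not at *; grind)

theorem iterate_haltedMap_of_forall_lt {x : Angle} {k : ℕ}
    (h : ∀ j < k, ¬ (doubling^[j] x = oneThird ∨ doubling^[j] x = twoThirds)) :
    haltedMap^[k] x = doubling^[k] x := by
  induction k with
  | zero => rfl
  | succ k ih =>
    rw [Function.iterate_succ_apply', Function.iterate_succ_apply',
      ih fun j hj => h j (by omega), haltedMap_of_ne (h k (by omega))]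

/-- The periodic tails `Σ₀ 1` and `Σ₁ 0` are the words of `U` and `W`, the symbols of the points
`1/3` and `2/3` fixed by `haltedMap`. This merges the cases in the definition of the surgery map. -/
theorem surgeryWord_eq (p q : ℕ) (x : Angle) (k : ℕ) :
    surgeryWord p q x k = word p q (itin x k) := by
  unfold surgeryWord itin
  split_ifs with H hk h
  · rw [iterate_haltedMap_of_forall_lt fun j hj => Nat.find_min H (by omega),
      code_eq_word p q (Nat.find_min H hk)]
  all_goals try
    have hst : haltedMap^[k] x = doubling^[Nat.find H] x := by
      obtain ⟨m, hm⟩ := Nat.exists_eq_add_of_le (not_lt.1 hk)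
      rw [hm, add_comm, Function.iterate_add_apply,
        iterate_haltedMap_of_forall_lt fun j hj => Nat.find_min H hj,
        Function.iterate_fixed (haltedMap_of_fixed (Nat.find_spec H))]
  · rw [hst, h, symbol_eq, rep_oneThird]
    norm_num [word]
  · have h2 := (Nat.find_spec H).resolve_left h
    rw [hst, h2, symbol_eq, rep_twoThirds]
    norm_num [word]
  · push Not at H
    rw [iterate_haltedMap_of_forall_lt fun j _ => not_or.2 (H j), code_eq_word p q (not_or.2 (H k))]

end Real

section Surgery

variable {p q : ℕ} (hp : 0 < p) (hpq : p < q) (hcop : Nat.Coprime p q)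

/-- Deleting the first word of the concatenation is precisely the recursion for the branch of its
symbol. -/
theorem isItin_ofDigits {σ : ℕ → St} (hσ : Admissible σ) : (model p q hp hpq hcop).IsItin σ
    fun k => Real.ofDigits (concat fun j => word p q (σ (k + j))) := by
  refine isItin_of_admissible hσ
    (fun j => ⟨Real.ofDigits_nonneg _, Real.ofDigits_le_one _⟩) fun j => ?_
  have e := ofDigits_concat (w := fun i => word p q (σ (j + i))) fun k => word_ne_nil hp hpq _
  rw [length_word hpq, two_pow_stepLen hp hpq hcop, wordVal_word hp hpq hcop] at e
  simp only [add_zero] at e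
  rw [e]
  congr 3
  ext i
  rw [show j + (i + 1) = j + 1 + i by ring]

/-- The surgery map conjugates the modified doubling map to the return map. -/
theorem isItin_surgery (x : Angle) :
    (model p q hp hpq hcop).IsItin (itin x) fun k => rep (surgery p q (haltedMap^[k] x)) := by
  have h := isItin_ofDigits hp hpq hcop (isItin_itin x).admissible
  convert h using 1
  ext k
  have e2 : surgeryWord p q (haltedMap^[k] x) = fun j => word p q (itin x (k + j)) := by
    ext1 j
    rw [surgeryWord_eq, itin, itin, ← Function.iterate_add_apply, add_comm]
  obtain ⟨h0, h1⟩ := piece_subset (h k).1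
  rw [surgery, e2]
  exact rep_coe h0 h1

include hp hpq hcop in
theorem rep_surgery_lt {x x' : Angle} (h : rep x < rep x') :
    rep (surgery p q x) < rep (surgery p q x') :=
  (isItin_itin x).lt (isItin_itin x') (isItin_surgery hp hpq hcop x) (isItin_surgery hp hpq hcop x') h

include hp hpq hcop in
theorem rep_surgery_le_iff {x x' : Angle} :
    rep (surgery p q x) ≤ rep (surgery p q x') ↔ rep x ≤ rep x' := by
  constructor
  · intro h
    by_contra hcon
    exact absurd (rep_surgery_lt hp hpq hcop (not_le.1 hcon)) (not_lt.2 h)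
  · intro h
    rcases h.lt_or_eq with h | h
    · exact (rep_surgery_lt hp hpq hcop h).le
    · rw [rep_injective h]

include hp hpq hcop in
theorem surgery_injective : Function.Injective (surgery p q) := fun x x' h => by
  have h1 := (rep_surgery_le_iff hp hpq hcop).1 (le_of_eq (congrArg rep h))
  have h2 := (rep_surgery_le_iff hp hpq hcop).1 (le_of_eq (congrArg rep h.symm))
  exact rep_injective (le_antisymm h1 h2)

/-- For `1/2` the target is the real model itself, where a point is determined by its itinerary.
Results for general `p/q` can therefore be specialised to the real vein. -/
theorem surgery_one_two (x : Angle) : surgery 1 2 x = x :=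
  rep_injective (congrFun ((isItin_surgery (by norm_num) (by norm_num) (by norm_num) x).eq
    (isItin_itin x)) 0)

theorem rep_surgery_mem_piece (x : Angle) :
    rep (surgery p q x) ∈ (model p q hp hpq hcop).piece (symbol x) :=
  (isItin_surgery hp hpq hcop x 0).1

theorem len_mul_rep_surgery (x : Angle) :
    (model p q hp hpq hcop).len (symbol x) * rep (surgery p q x) =
      (model p q hp hpq hcop).wt (symbol x) + rep (surgery p q (haltedMap x)) :=
  (isItin_surgery hp hpq hcop x 0).2

include hp hpq hcop in
theorem iterate_doubling_surgery (x : Angle) :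
    doubling^[stepLen q (symbol x)] (surgery p q x) = surgery p q (haltedMap x) := by
  have h := rep_surgery_mem_piece hp hpq hcop x
  rw [← retMap_eq h]
  apply rep_injective
  linarith [len_mul_rep h, len_mul_rep_surgery hp hpq hcop x]

/-- A sequence of symbols which is an itinerary in one model is the itinerary of a point of the
real model, and the surgery map sends this point to the given one. -/
theorem exists_surgery_eq {σ : ℕ → St} {y : ℕ → ℝ} (h : (model p q hp hpq hcop).IsItin σ y) :
    ∃ x, itin x = σ ∧ ∀ k, rep (surgery p q (haltedMap^[k] x)) = y k := by
  set t : ℕ → ℝ := fun k => Real.ofDigits (concat fun j => word 1 2 (σ (k + j)))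
  have h' : realModel.IsItin σ t := isItin_ofDigits _ _ _ h.admissible
  have hit : itin (t 0 : Angle) = σ := by
    ext1 k
    rw [itin, symbol, rep_iterate_retMap h', st_eq (h' k).1]
  refine ⟨(t 0 : Angle), hit, fun k => ?_⟩
  have h2 := isItin_surgery hp hpq hcop (t 0 : Angle)
  rw [hit] at h2
  exact congrFun (h2.eq h) k

end Surgery

end Surgery

/-! ### Rotation of the sectors of the `α`-portrait -/

namespace Surgery

open Model

/-- The points of the periodic orbit with rotation number `p / q`. -/
def IsRot (p q : ℕ) (z : Angle) : Prop := ∃ r < q, rep z = rotPt p q r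

/-- The closed sector of the `α`-portrait which begins at the point with index `r`. -/
def InSector (p q r : ℕ) (z : Angle) : Prop :=
  ∃ t : ℝ, (t : Angle) = z ∧ rotPt p q r ≤ t ∧ t ≤ rotPt p q (r + 1)

/-- The open half circle bounded by the halves of `τ`, not containing `0`. -/
def innerHalf (τ : ℝ) : Set Angle := {z | τ / 2 < rep z ∧ rep z < (τ + 1) / 2}

/-- The open half circle bounded by the halves of `τ`, containing `0`. -/
def outerHalf (τ : ℝ) : Set Angle := {z | rep z < τ / 2 ∨ (τ + 1) / 2 < rep z}

theorem mem_arc_right_of_mem_innerHalf {τ : ℝ} {z : Angle} (h : z ∈ innerHalf τ) :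
    z ∈ arc τ τ .right := ⟨h.1.le, h.2.le⟩

theorem mem_arc_left_of_mem_outerHalf {τ : ℝ} {z : Angle} (h : z ∈ outerHalf τ) :
    z ∈ arc τ τ .left := h.imp le_of_lt le_of_lt

theorem disjoint_innerHalf_outerHalf {τ : ℝ} {z : Angle} (h : z ∈ innerHalf τ) :
    z ∉ outerHalf τ := by
  rintro (h' | h')
  · exact lt_asymm h' h.1
  · exact lt_asymm h' h.2

section Sectors

variable {p q : ℕ} (hp : 0 < p) (hpq : p < q) (hcop : Nat.Coprime p q) {z : Angle} {r : ℕ}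

include hpq hcop in
theorem rotPt_mem_Icc (hr : r < q) : rotPt p q 0 ≤ rotPt p q r ∧ rotPt p q r ≤ rotPt p q (q - 1) :=
  ⟨(rotPt_strictMono hpq hcop).monotone (Nat.zero_le _),
    (rotPt_strictMono hpq hcop).monotone (by omega)⟩

include hp hpq hcop in
theorem rotPt_mem_Ioo (hr : r < q) : 0 < rotPt p q r ∧ rotPt p q r < 1 :=
  ⟨(rotPt_zero_pos hpq hcop hp).trans_le (rotPt_mem_Icc hpq hcop hr).1,
    (rotPt_mem_Icc hpq hcop hr).2.trans_lt (rotPt_last_lt_one hp hpq hcop)⟩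

include hp hpq hcop in
theorem rep_doubling_of_rotPt (hr : r < q) (h : rep z = rotPt p q r) :
    rep (doubling z) = rotPt p q ((r + p) % q) := by
  have e := two_mul_rotPt_mod hpq r
  rw [Nat.mod_eq_of_lt hr, ← h] at e
  obtain ⟨h0, h1⟩ := rotPt_mem_Ioo hp hpq hcop (Nat.mod_lt (r + p) (by omega : 0 < q))
  exact rep_iterate_doubling (n := 1) (by rw [pow_one]; exact e) h0.le h1

include hp hpq hcop in
theorem IsRot.iterate (h : IsRot p q z) (n : ℕ) : IsRot p q (doubling^[n] z) := by
  induction n with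
  | zero => exact h
  | succ n ih =>
    obtain ⟨r, hr, e⟩ := ih
    rw [Function.iterate_succ_apply']
    exact ⟨_, Nat.mod_lt _ (by omega), rep_doubling_of_rotPt hp hpq hcop hr e⟩

theorem half_τ_lt (M : Model) : M.τ / 2 < M.z₀ := by linarith [M.two_z₀, M.τ_lt]

theorem lt_half_τ_add_one (M : Model) : M.z₁ < (M.τ + 1) / 2 := by linarith [M.two_z₁, M.θ₀_lt]

include hp hpq hcop in
theorem mem_innerHalf_of_mem_Icc (h : rotPt p q 0 ≤ rep z ∧ rep z ≤ rotPt p q (q - 1)) :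
    z ∈ innerHalf (model p q hp hpq hcop).τ :=
  ⟨(half_τ_lt (model p q hp hpq hcop)).trans_le h.1,
    h.2.trans_lt (lt_half_τ_add_one (model p q hp hpq hcop))⟩

theorem IsRot.mem_innerHalf (h : IsRot p q z) : z ∈ innerHalf (model p q hp hpq hcop).τ := by
  obtain ⟨r, hr, e⟩ := h
  exact mem_innerHalf_of_mem_Icc hp hpq hcop (e ▸ rotPt_mem_Icc hpq hcop hr)

include hp hpq hcop in
theorem exists_inSector (z : Angle) : ∃ r < q, InSector p q r z := by
  classical
  have hq : rotPt p q q = rotPt p q 0 + 1 := by simpa using rotPt_add_period hpq 0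
  have h0 := rotPt_zero_pos hpq hcop hp
  have hlast := rotPt_last_lt_one hp hpq hcop
  have hz0 := rep_nonneg z
  have hz1 := rep_lt_one z
  have hex : ∃ n, rep z < rotPt p q n := ⟨q, by linarith⟩
  have hspec := Nat.find_spec hex
  have hmin := fun m (hm : m < Nat.find hex) => not_lt.1 (Nat.find_min hex hm)
  have hle : Nat.find hex ≤ q := Nat.find_min' hex (by linarith)
  generalize Nat.find hex = n at *
  rcases Nat.eq_zero_or_pos n with rfl | hn
  · refine ⟨q - 1, by omega, rep z + 1, ?_, by linarith, ?_⟩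
    · rw [coe_add_one, coe_rep]
    · rw [Nat.sub_add_cancel (by omega)]; linarith
  · refine ⟨n - 1, by omega, rep z, coe_rep z, hmin _ (by omega), ?_⟩
    rw [Nat.sub_add_cancel hn]
    exact hspec.le

include hp hpq hcop in
theorem InSector.rep_mem_Icc (h : InSector p q r z) (hr : r < q - 1) :
    rotPt p q r ≤ rep z ∧ rep z ≤ rotPt p q (r + 1) := by
  obtain ⟨t, rfl, h1, h2⟩ := h
  have g1 := rotPt_mem_Ioo hp hpq hcop (show r < q by omega)
  have g2 := rotPt_mem_Ioo hp hpq hcop (show r + 1 < q by omega)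
  rw [rep_coe (by linarith) (by linarith)]
  exact ⟨h1, h2⟩

include hp hpq hcop in
theorem InSector.rep_le_or_le (h : InSector p q (q - 1) z) :
    rep z ≤ rotPt p q 0 ∨ rotPt p q (q - 1) ≤ rep z := by
  obtain ⟨t, rfl, h1, h2⟩ := h
  have hq : rotPt p q q = rotPt p q 0 + 1 := by simpa using rotPt_add_period hpq 0
  have g0 := rotPt_mem_Ioo hp hpq hcop (show 0 < q by omega)
  have g1 := rotPt_mem_Ioo hp hpq hcop (show q - 1 < q by omega)
  rw [Nat.sub_add_cancel (by omega)] at h2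
  rcases lt_or_ge t 1 with ht | ht
  · rw [rep_coe (by linarith) ht]; exact Or.inr h1
  · left
    rw [← coe_sub_one, rep_coe (by linarith) (by linarith)]
    linarith

include hp hpq hcop in
-- The left arc of `τ` lies strictly inside the sector from `z₁` through 0 to `z₀`, so it meets no
-- other sector.
theorem InSector.eq_of_mem_left (h : InSector p q r z) (hr : r < q)
    (hz : z ∈ arc (model p q hp hpq hcop).τ (model p q hp hpq hcop).τ .left) : r = q - 1 := by
  by_contra hne
  have h1 := h.rep_mem_Icc hp hpq hcop (by omega)
  have h2 := mem_innerHalf_of_mem_Icc hp hpq hcop (z := z)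
    ⟨(rotPt_mem_Icc hpq hcop hr).1.trans h1.1,
      h1.2.trans (rotPt_mem_Icc hpq hcop (show r + 1 < q by omega)).2⟩
  rcases hz with hz | hz
  · exact absurd h2.1 (not_lt.2 hz)
  · exact absurd h2.2 (not_lt.2 hz)

theorem doubling_coe (t : ℝ) : doubling (t : Angle) = ((2 * t : ℝ) : Angle) := by
  rw [doubling, ← AddCircle.coe_add, two_mul]

/-- On the inner half circle doubling rotates the sectors. -/
theorem InSector.image_of_right (h : InSector p q r z) (hr : r < q)
    (hz : z ∈ arc (model p q hp hpq hcop).τ (model p q hp hpq hcop).τ .right) :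
    InSector p q ((r + p) % q) (doubling z) := by
  have hq : rotPt p q q = rotPt p q 0 + 1 := by simpa using rotPt_add_period hpq 0
  rcases Nat.lt_or_ge r (q - 1) with hr' | hr'
  · obtain ⟨t, rfl, h1, h2⟩ := h
    have e1 := two_mul_rotPt (p := p) (q := q) r
    have e2 := two_mul_rotPt (p := p) (q := q) (r + 1)
    rw [Nat.div_eq_of_lt (by omega), Nat.cast_zero, zero_add] at e1 e2
    rw [doubling_coe]
    rcases Nat.lt_or_ge (r + p) q with hrp | hrp
    · refine ⟨2 * t, rfl, ?_, ?_⟩ <;> rw [Nat.mod_eq_of_lt hrp]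
      · linarith
      · rw [show r + p + 1 = r + 1 + p by ring]; linarith
    · obtain ⟨m, hm⟩ := Nat.exists_eq_add_of_le hrp
      have em : (r + p) % q = m := by
        rw [hm, Nat.add_mod_left, Nat.mod_eq_of_lt (by omega)]
      rw [show r + p = m + q by omega, rotPt_add_period hpq] at e1
      rw [show r + 1 + p = m + 1 + q by omega, rotPt_add_period hpq] at e2
      refine ⟨2 * t - 1, coe_sub_one _, ?_, ?_⟩ <;> rw [em] <;> linarith
  -- In the sector at 0 the right arc leaves only `[τ/2, z₀]` and `[z₁, (τ + 1)/2]`. Doubling maps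
  -- them to the parts `[τ, θ₁]` and `[θ₀, τ]` of the sector `p - 1`.
  · obtain rfl : r = q - 1 := by omega
    have em : (q - 1 + p) % q = p - 1 := by
      rw [show q - 1 + p = q + (p - 1) by omega, Nat.add_mod_left, Nat.mod_eq_of_lt (by omega)]
    have h' := h.rep_le_or_le hp hpq hcop
    have e1 := (model p q hp hpq hcop).two_z₀
    have e2 := (model p q hp hpq hcop).two_z₁
    have e3 := (model p q hp hpq hcop).θ₀_lt
    have e4 := (model p q hp hpq hcop).τ_lt
    have hz1 := hz.1
    have hz2 := hz.2
    rw [em]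
    change 2 * rotPt p q 0 = rotPt p q p at e1
    change 2 * rotPt p q (q - 1) = 1 + rotPt p q (p - 1) at e2
    change rotPt p q (p - 1) < _ at e3
    change _ < rotPt p q p at e4
    unfold InSector
    rw [Nat.sub_add_cancel hp, ← coe_rep z, doubling_coe]
    rcases h' with h' | h'
    · exact ⟨2 * rep z, rfl, by linarith, by linarith⟩
    · exact ⟨2 * rep z - 1, coe_sub_one _, by linarith, by linarith⟩

theorem InSector.iterate (h : InSector p q r z) (hr : r < q) {m : ℕ}
    (hz : ∀ j < m, doubling^[j] z ∈
      arc (model p q hp hpq hcop).τ (model p q hp hpq hcop).τ .right) :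
    InSector p q ((r + m * p) % q) (doubling^[m] z) := by
  induction m with
  | zero => simpa [Nat.mod_eq_of_lt hr] using h
  | succ m ih =>
    have := (ih fun j hj => hz j (by omega)).image_of_right hp hpq hcop (Nat.mod_lt _ (by omega))
      (hz m (by omega))
    rw [Nat.mod_add_mod] at this
    rw [Function.iterate_succ_apply', show r + (m + 1) * p = r + m * p + p by ring]
    exact this

/-- Points which enter the outer half circle at the same time for the first time belong to the same
sector. -/
theorem InSector.of_first_entry {u v : Angle} (hu : InSector p q r u) (hr : r < q) {m : ℕ}
    (hR : ∀ j < m,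
      doubling^[j] u ∈ arc (model p q hp hpq hcop).τ (model p q hp hpq hcop).τ .right ∧
      doubling^[j] v ∈ arc (model p q hp hpq hcop).τ (model p q hp hpq hcop).τ .right)
    (hL : doubling^[m] u ∈ arc (model p q hp hpq hcop).τ (model p q hp hpq hcop).τ .left ∧
      doubling^[m] v ∈ arc (model p q hp hpq hcop).τ (model p q hp hpq hcop).τ .left) :
    InSector p q r v := by
  obtain ⟨r', hr', hv⟩ := exists_inSector hp hpq hcop v
  have h1 := (hu.iterate hp hpq hcop hr fun j hj => (hR j hj).1).eq_of_mem_left hp hpq hcop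
    (Nat.mod_lt _ (by omega)) hL.1
  have h2 := (hv.iterate hp hpq hcop hr' fun j hj => (hR j hj).2).eq_of_mem_left hp hpq hcop
    (Nat.mod_lt _ (by omega)) hL.2
  -- At the time of entry both sectors have index `q - 1`, and both indices have moved by the same
  -- multiple of `p`.
  have h3 : r ≡ r' [MOD q] := Nat.ModEq.add_right_cancel' (m * p) (h1.trans h2.symm)
  rw [Nat.ModEq, Nat.mod_eq_of_lt hr, Nat.mod_eq_of_lt hr'] at h3
  rwa [h3]

theorem rep_iterate_of_lt_τ (h0 : (model p q hp hpq hcop).θ₀ ≤ rep z)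
    (h1 : rep z < (model p q hp hpq hcop).τ) :
    rep (doubling^[q - 1] z) =
      (model p q hp hpq hcop).N * rep z - (model p q hp hpq hcop).v := by
  have e1 := (model p q hp hpq hcop).mul_θ₀
  have e2 := (model p q hp hpq hcop).mul_τ
  have e3 := (model p q hp hpq hcop).two_le
  have e4 := (model p q hp hpq hcop).z₀_pos
  have e5 := (model p q hp hpq hcop).z₀_le
  have e6 := (model p q hp hpq hcop).two_z₁
  refine rep_iterate_doubling (k := wordVal (sigma0 p q)) ?_ ?_ ?_
  · change _ = (model p q hp hpq hcop).v + _
    change (model p q hp hpq hcop).N * _ = _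
    ring
  · nlinarith
  · nlinarith

theorem rep_iterate_of_τ_le (h0 : (model p q hp hpq hcop).τ ≤ rep z)
    (h1 : rep z ≤ (model p q hp hpq hcop).θ₁) :
    rep (doubling^[q - 1] z) =
      (model p q hp hpq hcop).N * rep z - ((model p q hp hpq hcop).v + 1) := by
  have e1 := (model p q hp hpq hcop).mul_θ₁
  have e2 := (model p q hp hpq hcop).mul_τ
  have e3 := (model p q hp hpq hcop).two_le
  have e4 := (model p q hp hpq hcop).θ₁_le
  have e5 := (model p q hp hpq hcop).z₁_lt
  have e6 := (model p q hp hpq hcop).two_z₀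
  refine rep_iterate_doubling (k := wordVal (sigma0 p q) + 1) ?_ ?_ ?_
  · push_cast
    change _ = (model p q hp hpq hcop).v + 1 + _
    change (model p q hp hpq hcop).N * _ = _
    ring
  · nlinarith
  · nlinarith

theorem τ_pos (M : Model) : 0 < M.τ := by linarith [M.z₀_pos, M.z₀_le, M.θ₀_lt]

/-- One doubling leads from the part next to `z₁` into `[θ₀, τ)`, and `q - 1` more lead back near
`z₁`, with total slope `2 N`. So an orbit which never leaves the right arc is repelled by `z₁`. -/
theorem rep_iterate_of_forall_right_of_le
    (h : ∀ n, doubling^[n] z ∈ arc (model p q hp hpq hcop).τ (model p q hp hpq hcop).τ .right)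
    (hz : (model p q hp hpq hcop).z₁ ≤ rep z) :
    rep (doubling^[q] z) - (model p q hp hpq hcop).z₁ =
      2 * (model p q hp hpq hcop).N * (rep z - (model p q hp hpq hcop).z₁) := by
  have hr := (h 0).2
  rw [Function.iterate_zero_apply] at hr
  have e1 := (model p q hp hpq hcop).mul_θ₀
  have e2 := (model p q hp hpq hcop).two_z₁
  have e3 := (model p q hp hpq hcop).z₀_pos
  have e4 := (model p q hp hpq hcop).z₀_le
  have hd := rep_doubling_of_le (x := z) (by linarith)
  have hlt : rep (doubling z) < (model p q hp hpq hcop).τ := by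
    -- The image cannot be `τ`, which is sent to 0 and thus out of the right arc.
    refine lt_of_le_of_ne (by linarith) fun heq => ?_
    have h0 := rep_iterate_of_τ_le hp hpq hcop heq.ge
      (heq.le.trans (model p q hp hpq hcop).τ_lt.le)
    rw [heq, (model p q hp hpq hcop).mul_τ, sub_self] at h0
    have h1 := (h (q - 1 + 1)).1
    rw [Function.iterate_succ_apply, h0] at h1
    linarith [τ_pos (model p q hp hpq hcop)]
  have h2 := rep_iterate_of_lt_τ hp hpq hcop (by linarith) hlt
  rw [← Function.iterate_succ_apply, Nat.succ_eq_add_one, Nat.sub_add_cancel (by omega), hd] at h2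
  rw [h2]
  linear_combination e1 + (model p q hp hpq hcop).N * e2

theorem rep_iterate_of_forall_right_of_ge
    (h : ∀ n, doubling^[n] z ∈ arc (model p q hp hpq hcop).τ (model p q hp hpq hcop).τ .right)
    (hz : rep z ≤ (model p q hp hpq hcop).z₀) :
    (model p q hp hpq hcop).z₀ - rep (doubling^[q] z) =
      2 * (model p q hp hpq hcop).N * ((model p q hp hpq hcop).z₀ - rep z) := by
  have hr := (h 0).1
  rw [Function.iterate_zero_apply] at hr
  have e1 := (model p q hp hpq hcop).mul_θ₁
  have e2 := (model p q hp hpq hcop).two_z₀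
  have e3 := (model p q hp hpq hcop).z₁_lt
  have e4 := (model p q hp hpq hcop).θ₁_le
  have hd := rep_doubling_of_lt (x := z) (by linarith)
  have h2 := rep_iterate_of_τ_le hp hpq hcop (z := doubling z) (by linarith) (by linarith)
  rw [← Function.iterate_succ_apply, Nat.succ_eq_add_one, Nat.sub_add_cancel (by omega), hd] at h2
  rw [h2]
  linear_combination -(model p q hp hpq hcop).N * e2 - e1

theorem iterate_iterate_right {S : Set Angle} (h : ∀ n, doubling^[n] z ∈ S) (i : ℕ) (n : ℕ) :
    doubling^[n] (doubling^[i] z) ∈ S := by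
  rw [← Function.iterate_add_apply]
  exact h _

/-- A point of the sector at `0` which stays in the inner half circle is an end of this sector. -/
theorem rep_eq_of_forall_right
    (h : ∀ n, doubling^[n] z ∈ arc (model p q hp hpq hcop).τ (model p q hp hpq hcop).τ .right)
    (hz : rep z ≤ (model p q hp hpq hcop).z₀ ∨ (model p q hp hpq hcop).z₁ ≤ rep z) :
    rep z = (model p q hp hpq hcop).z₀ ∨ rep z = (model p q hp hpq hcop).z₁ := by
  have hN := (model p q hp hpq hcop).two_le
  have e3 := (model p q hp hpq hcop).z₀_pos
  have e4 := (model p q hp hpq hcop).z₁_lt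
  have e5 := (model p q hp hpq hcop).z₀_le
  have e6 := (model p q hp hpq hcop).two_z₁
  have e7 := (model p q hp hpq hcop).θ₁_le
  have e8 := (model p q hp hpq hcop).two_z₀
  rcases hz with hz | hz
  · left
    by_contra hne
    have key : ∀ i, rep (doubling^[i * q] z) ≤ (model p q hp hpq hcop).z₀ ∧
        2 * ((model p q hp hpq hcop).z₀ - rep (doubling^[i * q] z)) ≤
          (model p q hp hpq hcop).z₀ - rep (doubling^[(i + 1) * q] z) := by
      intro i
      have step : ∀ i, rep (doubling^[i * q] z) ≤ (model p q hp hpq hcop).z₀ →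
        2 * ((model p q hp hpq hcop).z₀ - rep (doubling^[i * q] z)) ≤
          (model p q hp hpq hcop).z₀ - rep (doubling^[(i + 1) * q] z) := by
        intro i hi
        have := rep_iterate_of_forall_right_of_ge hp hpq hcop (iterate_iterate_right h (i * q)) hi
        rw [← Function.iterate_add_apply, show q + i * q = (i + 1) * q by ring] at this
        rw [this]
        nlinarith
      induction i with
      | zero => exact ⟨by simpa using hz, step 0 (by simpa using hz)⟩
      | succ i ih =>
        have : rep (doubling^[(i + 1) * q] z) ≤ (model p q hp hpq hcop).z₀ := by linarith [ih.1, ih.2]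
        exact ⟨this, step _ this⟩
    refine not_forall_two_mul_le
      (f := fun i => (model p q hp hpq hcop).z₀ - rep (doubling^[i * q] z)) ?_
      (fun i => (key i).2) fun i => ?_
    · simpa using lt_of_le_of_ne hz hne
    · linarith [rep_nonneg (doubling^[i * q] z)]
  · right
    by_contra hne
    have key : ∀ i, (model p q hp hpq hcop).z₁ ≤ rep (doubling^[i * q] z) ∧
        2 * (rep (doubling^[i * q] z) - (model p q hp hpq hcop).z₁) ≤
          rep (doubling^[(i + 1) * q] z) - (model p q hp hpq hcop).z₁ := by
      intro i
      have step : ∀ i, (model p q hp hpq hcop).z₁ ≤ rep (doubling^[i * q] z) →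
        2 * (rep (doubling^[i * q] z) - (model p q hp hpq hcop).z₁) ≤
          rep (doubling^[(i + 1) * q] z) - (model p q hp hpq hcop).z₁ := by
        intro i hi
        have := rep_iterate_of_forall_right_of_le hp hpq hcop (iterate_iterate_right h (i * q)) hi
        rw [← Function.iterate_add_apply, show q + i * q = (i + 1) * q by ring] at this
        rw [this]
        nlinarith
      induction i with
      | zero => exact ⟨by simpa using hz, step 0 (by simpa using hz)⟩
      | succ i ih =>
        have : (model p q hp hpq hcop).z₁ ≤ rep (doubling^[(i + 1) * q] z) := by linarith [ih.1, ih.2]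
        exact ⟨this, step _ this⟩
    refine not_forall_two_mul_le
      (f := fun i => rep (doubling^[i * q] z) - (model p q hp hpq hcop).z₁) ?_
      (fun i => (key i).2) fun i => ?_
    · simpa using lt_of_le_of_ne hz (Ne.symm hne)
    · linarith [rep_lt_one (doubling^[i * q] z)]

/-- An orbit which stays in the inner half circle meets the periodic orbit. -/
theorem exists_isRot_of_forall_right
    (h : ∀ n, doubling^[n] z ∈ arc (model p q hp hpq hcop).τ (model p q hp hpq hcop).τ .right) :
    ∃ n, IsRot p q (doubling^[n] z) := by
  obtain ⟨r, hr, hz⟩ := exists_inSector hp hpq hcop z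
  -- At time `k` the sector has index `r + k p ≡ -1`, so it is the sector at 0.
  obtain ⟨k, hk⟩ := exists_dvd_add_mul hpq hcop (r + 1)
  have e : (r + k * p) % q = q - 1 := by
    obtain ⟨c, hc⟩ := hk
    have hc0 : c ≠ 0 := by rintro rfl; omega
    obtain ⟨d, rfl⟩ := Nat.exists_eq_succ_of_ne_zero hc0
    rw [Nat.succ_eq_add_one, mul_add, mul_one] at hc
    rw [show r + k * p = q - 1 + q * d by omega, Nat.add_mul_mod_self_left,
      Nat.mod_eq_of_lt (by omega)]
  have hs := hz.iterate hp hpq hcop hr (m := k) fun j _ => h j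
  rw [e] at hs
  refine ⟨k, ?_⟩
  rcases rep_eq_of_forall_right hp hpq hcop (iterate_iterate_right h k)
    (hs.rep_le_or_le hp hpq hcop) with h' | h'
  · exact ⟨0, by omega, h'⟩
  · exact ⟨q - 1, by omega, h'⟩

end Sectors

end Surgery

/-! ### Pairs of orbits on the same side of a diameter have conjugate itineraries -/

namespace Surgery

open Model

/-- The symbol of the reflected piece. -/
def St.conj : St → St
  | .S0 => .S1 | .U => .W | .T0 => .T1 | .T1 => .T0 | .W => .U | .S1 => .S0

theorem St.conj_conj (s : St) : s.conj.conj = s := by cases s <;> rfl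

theorem stepLen_conj (q : ℕ) (s : St) : stepLen q s.conj = stepLen q s := by cases s <;> rfl

namespace Model

/-- The interior of a piece. -/
def openPiece (M : Model) : St → Set ℝ
  | .S0 => Set.Ioo 0 M.z₀
  | .U => ∅
  | .T0 => Set.Ioo M.θ₀ M.τ
  | .T1 => Set.Ioo M.τ M.θ₁
  | .W => ∅
  | .S1 => Set.Ioo M.z₁ 1

theorem openPiece_subset_piece (M : Model) (s : St) : M.openPiece s ⊆ M.piece s := by
  cases s <;> simp [openPiece, piece, Set.Ioo_subset_Ico_self]

end Model

/-- At all times the two orbits are on the same side of the diameter through the halves of `τ`, and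
they visit the outer side infinitely often. -/
structure Companions (τ : ℝ) (u v : Angle) : Prop where
  same : ∀ n, (doubling^[n] u ∈ innerHalf τ ∧ doubling^[n] v ∈ innerHalf τ) ∨
    (doubling^[n] u ∈ outerHalf τ ∧ doubling^[n] v ∈ outerHalf τ)
  frequently : ∀ n, ∃ m, doubling^[m + n] u ∈ outerHalf τ

namespace Companions

variable {τ : ℝ} {u v : Angle}

theorem frequently_right (h : Companions τ u v) (n : ℕ) :
    ∃ m, doubling^[m + n] v ∈ outerHalf τ := by
  obtain ⟨m, hm⟩ := h.frequently n
  refine ⟨m, ?_⟩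
  rcases h.same (m + n) with h' | h'
  · exact absurd hm (disjoint_innerHalf_outerHalf h'.1)
  · exact h'.2

theorem symm (h : Companions τ u v) : Companions τ v u :=
  ⟨fun n => (h.same n).imp And.symm And.symm, h.frequently_right⟩

theorem iterate (h : Companions τ u v) (i : ℕ) :
    Companions τ (doubling^[i] u) (doubling^[i] v) := by
  refine ⟨fun n => ?_, fun n => ?_⟩
  · rw [← Function.iterate_add_apply, ← Function.iterate_add_apply]
    exact h.same _
  · obtain ⟨m, hm⟩ := h.frequently (n + i)
    exact ⟨m, by rwa [← Function.iterate_add_apply, add_assoc]⟩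

end Companions

section Pairs

variable {p q : ℕ} {hp : 0 < p} {hpq : p < q} {hcop : Nat.Coprime p q} {u v : Angle} {s : St}

theorem Companions.not_isRot (h : Companions (model p q hp hpq hcop).τ u v) : ¬ IsRot p q u := by
  intro hu
  obtain ⟨m, hm⟩ := h.frequently 0
  exact disjoint_innerHalf_outerHalf ((hu.iterate hp hpq hcop _).mem_innerHalf hp hpq hcop) hm

/-- Companions on different sides of `τ` belong both to the sector of `τ`, or both to the sector of
`0`. -/
theorem Companions.sector (h : Companions (model p q hp hpq hcop).τ u v)
    (hu : rep u < (model p q hp hpq hcop).τ) (hv : (model p q hp hpq hcop).τ < rep v) :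
    ((model p q hp hpq hcop).θ₀ < rep u ∧ rep v < (model p q hp hpq hcop).θ₁) ∨
      (rep u < (model p q hp hpq hcop).z₀ ∧ (model p q hp hpq hcop).z₁ < rep v) := by
  classical
  have hmono := rotPt_strictMono hpq hcop
  have e1 := (model p q hp hpq hcop).θ₀_lt
  have e2 := (model p q hp hpq hcop).τ_lt
  have e3 := (model p q hp hpq hcop).θ₁_le
  have e4 := (model p q hp hpq hcop).z₀_le
  obtain ⟨r, hr, hsu⟩ := exists_inSector hp hpq hcop u
  have hnu : ∀ j, j < q → rep u ≠ rotPt p q j := fun j hj e => h.not_isRot ⟨j, hj, e⟩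
  have hnv : ∀ j, j < q → rep v ≠ rotPt p q j := fun j hj e => h.symm.not_isRot ⟨j, hj, e⟩
  have hex : ∃ m, doubling^[m] u ∈ outerHalf (model p q hp hpq hcop).τ := h.frequently 0
  have hsv : InSector p q r v := by
    refine hsu.of_first_entry hp hpq hcop hr (m := Nat.find hex) (fun j hj => ?_) ?_
    · rcases h.same j with h' | h'
      · exact ⟨mem_arc_right_of_mem_innerHalf h'.1, mem_arc_right_of_mem_innerHalf h'.2⟩
      · exact absurd h'.1 (Nat.find_min hex hj)
    · rcases h.same (Nat.find hex) with h' | h'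
      · exact absurd (Nat.find_spec hex) (disjoint_innerHalf_outerHalf h'.1)
      · exact ⟨mem_arc_left_of_mem_outerHalf h'.1, mem_arc_left_of_mem_outerHalf h'.2⟩
  rcases Nat.lt_or_ge r (q - 1) with hr' | hr'
  · left
    have h1 := hsu.rep_mem_Icc hp hpq hcop hr'
    have h2 := hsv.rep_mem_Icc hp hpq hcop hr'
    have g1 : r < p := hmono.lt_iff_lt.1 ((h1.1.trans_lt hu).trans e2)
    have g2 : p - 1 < r + 1 := hmono.lt_iff_lt.1 ((e1.trans hv).trans_le h2.2)
    -- A sector other than the one at 0 with points on both sides of `τ` contains `τ` itself.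
    obtain rfl : r = p - 1 := by omega
    rw [Nat.sub_add_cancel hp] at h2
    exact ⟨lt_of_le_of_ne h1.1 (hnu _ (by omega)).symm, lt_of_le_of_ne h2.2 (hnv _ hpq)⟩
  · right
    obtain rfl : r = q - 1 := by omega
    have h1 : rep u ≤ (model p q hp hpq hcop).z₀ ∨ (model p q hp hpq hcop).z₁ ≤ rep u :=
      hsu.rep_le_or_le hp hpq hcop
    have h2 : rep v ≤ (model p q hp hpq hcop).z₀ ∨ (model p q hp hpq hcop).z₁ ≤ rep v :=
      hsv.rep_le_or_le hp hpq hcop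
    refine ⟨lt_of_le_of_ne (h1.resolve_right ?_) (hnu _ (by omega)),
      lt_of_le_of_ne (h2.resolve_left ?_) (hnv _ (by omega)).symm⟩
    · intro h'; linarith
    · intro h'; linarith

/-- The pairs of points in opposite pieces. -/
def Opposite (M : Model) (s : St) (u v : Angle) : Prop :=
  rep u ∈ M.openPiece s ∧ rep v ∈ M.openPiece s.conj

theorem Opposite.symm {M : Model} (h : Opposite M s u v) : Opposite M s.conj v u :=
  ⟨h.2, by rw [St.conj_conj]; exact h.1⟩

theorem Opposite.retMap_eq (h : Opposite (model p q hp hpq hcop) s u v) :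
    retMap p q hp hpq hcop u = doubling^[stepLen q s] u ∧
      retMap p q hp hpq hcop v = doubling^[stepLen q s] v :=
  ⟨Surgery.retMap_eq (openPiece_subset_piece _ _ h.1),
    by rw [Surgery.retMap_eq (openPiece_subset_piece _ _ h.2), stepLen_conj]⟩

/-- From `T0` and `T1` the pair goes to `S1` and `S0`. From `S0` and `S1`, if both points are in the
inner half they go to `T1` and `T0`; if both are in the outer half, their images are on different
sides of `τ`, and `Companions.sector` leaves only `T0`, `T1` or `S0`, `S1`. The other cases follow
by exchanging the points. -/
theorem Opposite.step (h : Opposite (model p q hp hpq hcop) s u v)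
    (hc : Companions (model p q hp hpq hcop).τ u v) :
    Companions (model p q hp hpq hcop).τ (retMap p q hp hpq hcop u) (retMap p q hp hpq hcop v) ∧
      ∃ s', Opposite (model p q hp hpq hcop) s' (retMap p q hp hpq hcop u)
        (retMap p q hp hpq hcop v) := by
  have hc' : Companions (model p q hp hpq hcop).τ (retMap p q hp hpq hcop u)
      (retMap p q hp hpq hcop v) := by
    rw [h.retMap_eq.1, h.retMap_eq.2]
    exact hc.iterate _
  refine ⟨hc', ?_⟩
  suffices key : ∀ s u v, s = .S0 ∨ s = .T0 → Opposite (model p q hp hpq hcop) s u v →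
      Companions (model p q hp hpq hcop).τ u v →
      Companions (model p q hp hpq hcop).τ (retMap p q hp hpq hcop u)
        (retMap p q hp hpq hcop v) →
      ∃ s', Opposite (model p q hp hpq hcop) s' (retMap p q hp hpq hcop u)
        (retMap p q hp hpq hcop v) by
    have swap : s.conj = .S0 ∨ s.conj = .T0 → ∃ s', Opposite (model p q hp hpq hcop) s'
        (retMap p q hp hpq hcop u) (retMap p q hp hpq hcop v) := by
      intro hs
      obtain ⟨s', hs'⟩ := key _ v u hs h.symm hc.symm hc'.symm
      exact ⟨_, hs'.symm⟩
    cases s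
    · exact key _ u v (Or.inl rfl) h hc hc'
    · exact absurd h.1 (Set.notMem_empty _)
    · exact key _ u v (Or.inr rfl) h hc hc'
    · exact swap (Or.inr rfl)
    · exact absurd h.1 (Set.notMem_empty _)
    · exact swap (Or.inl rfl)
  clear! u v s
  intro s u v hs h hc hc'
  have h0 := (model p q hp hpq hcop).z₀_pos
  have h1 := (model p q hp hpq hcop).z₀_le
  have h2 := (model p q hp hpq hcop).θ₀_lt
  have h3 := (model p q hp hpq hcop).τ_lt
  have h4 := (model p q hp hpq hcop).θ₁_le
  have h5 := (model p q hp hpq hcop).z₁_lt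
  have hN := (model p q hp hpq hcop).two_le
  have e1 := (model p q hp hpq hcop).mul_τ
  have e2 := (model p q hp hpq hcop).mul_θ₀
  have e3 := (model p q hp hpq hcop).mul_θ₁
  have e4 := (model p q hp hpq hcop).two_z₀
  have e5 := (model p q hp hpq hcop).two_z₁
  have ru := len_mul_rep (openPiece_subset_piece _ _ h.1)
  have rv := len_mul_rep (openPiece_subset_piece _ _ h.2)
  have hcs := hc'.sector
  have hr0 := rep_lt_one (retMap p q hp hpq hcop v)
  generalize retMap p q hp hpq hcop u = u' at *
  generalize retMap p q hp hpq hcop v = v' at *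
  have hm := hc.same 0
  simp only [Function.iterate_zero, id_eq] at hm
  obtain ⟨hu, hv⟩ := h
  generalize model p q hp hpq hcop = M at *
  rcases hs with rfl | rfl <;> simp only [St.conj, openPiece, Set.mem_Ioo] at hu hv <;>
    simp only [len, wt, St.conj] at ru rv
  · rcases hm with ⟨hm1, hm2⟩ | ⟨hm1, hm2⟩
    · have g1 := hm1.1
      have g2 := hm2.2
      refine ⟨.T1, ⟨?_, ?_⟩, ?_, ?_⟩ <;> linarith
    · have g1 : rep u < M.τ / 2 := hm1.resolve_right (by intro h'; linarith)
      have g2 : (M.τ + 1) / 2 < rep v := hm2.resolve_left (by intro h'; linarith)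
      rcases hcs (by linarith) (by linarith) with hc | hc
      · exact ⟨.T0, ⟨hc.1, by linarith⟩, by linarith, hc.2⟩
      · exact ⟨.S0, ⟨by linarith, hc.1⟩, hc.2, hr0⟩
  · refine ⟨.S1, ⟨?_, ?_⟩, ?_, ?_⟩ <;> nlinarith

/-- Companions in the sector of `τ`, on different sides of `τ`, have conjugate itineraries. -/
theorem Companions.exists_isItin (hc : Companions (model p q hp hpq hcop).τ u v)
    (hu : rep u ∈ Set.Ioo (model p q hp hpq hcop).θ₀ (model p q hp hpq hcop).τ)
    (hv : rep v ∈ Set.Ioo (model p q hp hpq hcop).τ (model p q hp hpq hcop).θ₁) :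
    ∃ σ : ℕ → St, σ 0 = .T0 ∧ (∀ k, σ k ≠ .U ∧ σ k ≠ .W) ∧
      (model p q hp hpq hcop).IsItin σ (fun k => rep ((retMap p q hp hpq hcop)^[k] u)) ∧
      (model p q hp hpq hcop).IsItin (fun k => (σ k).conj)
        (fun k => rep ((retMap p q hp hpq hcop)^[k] v)) := by
  have key : ∀ k, Companions (model p q hp hpq hcop).τ ((retMap p q hp hpq hcop)^[k] u)
      ((retMap p q hp hpq hcop)^[k] v) ∧ ∃ s, Opposite (model p q hp hpq hcop) s
        ((retMap p q hp hpq hcop)^[k] u) ((retMap p q hp hpq hcop)^[k] v) := by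
    intro k
    induction k with
    | zero => exact ⟨hc, .T0, hu, hv⟩
    | succ k ih =>
      obtain ⟨h1, s, h2⟩ := ih
      rw [Function.iterate_succ_apply', Function.iterate_succ_apply']
      exact h2.step h1
  choose σ hσ using fun k => (key k).2
  refine ⟨σ, ?_, fun k => ?_, isItin_retMap fun k => openPiece_subset_piece _ _ (hσ k).1,
    isItin_retMap fun k => openPiece_subset_piece _ _ (hσ k).2⟩
  · rw [← st_eq (openPiece_subset_piece _ _ (hσ 0).1)]
    exact st_eq (s := .T0) hu
  · have := (hσ k).1
    constructor <;> intro h <;> rw [h] at this <;> exact this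

end Pairs

end Surgery

/-! ### Reflection symmetry, and transfer of the arc condition by surgery -/

namespace Surgery

open Model

theorem rep_neg {x : Angle} (h : 0 < rep x) : rep (-x) = 1 - rep x := by
  rcases rep_sub 0 x with ⟨h', e⟩ | ⟨h', e⟩ <;> rw [rep_zero] at h' e
  · linarith
  · rw [zero_sub] at e
    rw [e]; ring

theorem doubling_neg (x : Angle) : doubling (-x) = -doubling x := by
  simp only [doubling]; abel

/-- At all times the two orbits are both in the right arc, or both in the left arc. -/
def SameArcs (a b : ℝ) (u v : Angle) : Prop :=
  ∀ n, (doubling^[n] u ∈ arc a b .right ∧ doubling^[n] v ∈ arc a b .right) ∨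
    (doubling^[n] u ∈ arc a b .left ∧ doubling^[n] v ∈ arc a b .left)

section Arcs

variable {a b : ℝ} (h0 : 0 < a) (hab : a < b) (h1 : b < 1) {u v z : Angle}

include h0 hab h1 in
-- For `a < b` the left and right arcs are shorter than a half-circle, so doubling is injective on
-- each of them.
theorem SameArcs.iterate_ne (h : SameArcs a b u v) (huv : u ≠ v) (n : ℕ) :
    doubling^[n] u ≠ doubling^[n] v := by
  induction n with
  | zero => exact huv
  | succ n ih =>
    intro e
    rw [Function.iterate_succ_apply', Function.iterate_succ_apply'] at e
    rcases h n with h' | h'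
    · exact hab.ne (eq_of_doubling_eq_of_mem_arc h0 hab.le h1 h'.1 h'.2 ih e).1
    · exact hab.ne (eq_of_doubling_eq_of_mem_arc h0 hab.le h1 h'.1 h'.2 ih e).1

include h0 hab h1 in
-- An orbit in the left arc stays on its side of 0, and its distance to 0 doubles in each step.
theorem eq_zero_of_forall_left (h : ∀ n, doubling^[n] z ∈ arc a b .left) : z = 0 := by
  apply rep_injective
  rw [rep_zero]
  by_contra hne
  have hz : 0 < rep z := lt_of_le_of_ne (rep_nonneg z) (Ne.symm hne)
  rcases h 0 with hl | hl <;> rw [Function.iterate_zero_apply] at hl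
  · have step : ∀ n, rep (doubling^[n] z) ≤ a / 2 →
        rep (doubling^[n + 1] z) = 2 * rep (doubling^[n] z) ∧ rep (doubling^[n + 1] z) ≤ a / 2 := by
      intro n hn
      have e : rep (doubling^[n + 1] z) = 2 * rep (doubling^[n] z) := by
        rw [Function.iterate_succ_apply', rep_doubling_of_lt (by linarith)]
      exact ⟨e, (h (n + 1)).resolve_right (by rw [e]; intro h'; linarith)⟩
    have all : ∀ n, rep (doubling^[n] z) ≤ a / 2 := by
      intro n
      induction n with
      | zero => exact hl
      | succ n ih => exact (step n ih).2
    exact not_forall_two_mul_le (f := fun n => rep (doubling^[n] z)) hz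
      (fun n => (step n (all n)).1.ge) fun n => (rep_lt_one _).le
  · have step : ∀ n, (b + 1) / 2 ≤ rep (doubling^[n] z) →
        1 - rep (doubling^[n + 1] z) = 2 * (1 - rep (doubling^[n] z)) ∧
          (b + 1) / 2 ≤ rep (doubling^[n + 1] z) := by
      intro n hn
      have e : rep (doubling^[n + 1] z) = 2 * rep (doubling^[n] z) - 1 := by
        rw [Function.iterate_succ_apply', rep_doubling_of_le (by linarith)]
      exact ⟨by rw [e]; ring, (h (n + 1)).resolve_left (by rw [e]; intro h'; linarith)⟩
    have all : ∀ n, (b + 1) / 2 ≤ rep (doubling^[n] z) := by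
      intro n
      induction n with
      | zero => exact hl
      | succ n ih => exact (step n ih).2
    exact not_forall_two_mul_le (f := fun n => 1 - rep (doubling^[n] z))
      (sub_pos.2 (rep_lt_one z))
      (fun n => (step n (all n)).1.ge) fun n => by linarith [rep_nonneg (doubling^[n] z)]

theorem SameArcs.iterate (h : SameArcs a b u v) (n : ℕ) :
    SameArcs a b (doubling^[n] u) (doubling^[n] v) := by
  intro m
  rw [← Function.iterate_add_apply, ← Function.iterate_add_apply]
  exact h _

theorem SameArcs.symm (h : SameArcs a b u v) : SameArcs a b v u :=
  fun n => (h n).imp And.symm And.symm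

theorem mem_innerHalf_of_mem_right {τ : ℝ} (ha : a < τ) (hb : τ < b) (h : z ∈ arc a b .right) :
    z ∈ innerHalf τ :=
  ⟨by linarith [h.1], by linarith [h.2]⟩

theorem mem_outerHalf_of_mem_left {τ : ℝ} (ha : a < τ) (hb : τ < b) (h : z ∈ arc a b .left) :
    z ∈ outerHalf τ := by
  rcases h with h | h
  · left; linarith
  · right; linarith

include h0 hab h1 in
theorem sbtw_doubling_of_mem_arc {i : ArcIndex} {x y z : Angle} (hx : x ∈ arc a b i)
    (hy : y ∈ arc a b i) (hz : z ∈ arc a b i) (h : sbtw x y z) :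
    sbtw (doubling x) (doubling y) (doubling z) := by
  obtain ⟨w, hw⟩ := exists_rep_sub_le_of_arc h0 hab.le h1 i
  obtain ⟨hxy, hyz, hxz⟩ := sbtw_ne h
  refine sbtw_doubling_of_half (hw x hx) (hw y hy) (hw z hz) h (fun e => ?_) (fun e => ?_)
    fun e => ?_
  · exact hab.ne (eq_of_doubling_eq_of_mem_arc h0 hab.le h1 hx hy hxy e).1
  · exact hab.ne (eq_of_doubling_eq_of_mem_arc h0 hab.le h1 hy hz hyz e).1
  · exact hab.ne (eq_of_doubling_eq_of_mem_arc h0 hab.le h1 hx hz hxz e).1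

include h0 hab h1 in
theorem sbtw_iterate_of_mem_itinSet {s : ℕ → ArcIndex} {x y z : Angle} (hx : x ∈ itinSet a b s)
    (hy : y ∈ itinSet a b s) (hz : z ∈ itinSet a b s) (h : sbtw x y z) (n : ℕ) :
    sbtw (doubling^[n] x) (doubling^[n] y) (doubling^[n] z) := by
  induction n with
  | zero => exact h
  | succ n ih =>
    simp only [Function.iterate_succ_apply']
    exact sbtw_doubling_of_mem_arc h0 hab h1 (hx n) (hy n) (hz n) ih

/-- The itineraries common to two points with distinct orbits in the left and right arcs. -/
theorem SameArcs.eq_right_or_left (h : SameArcs a b u v)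
    (hne : ∀ n, doubling^[n] u ≠ doubling^[n] v) {s : ℕ → ArcIndex} (hu : u ∈ itinSet a b s)
    (hv : v ∈ itinSet a b s) (n : ℕ) : s n = .right ∨ s n = .left := by
  have gu := hu n
  have gv := hv n
  have hn := h n
  have ne : rep (doubling^[n] u) ≠ rep (doubling^[n] v) := fun e => hne n (rep_injective e)
  generalize doubling^[n] u = u' at *
  generalize doubling^[n] v = v' at *
  have hu0 := rep_lt_one u'
  have hv0 := rep_lt_one v'
  cases hs : s n
  · exact Or.inr rfl
  · rw [hs] at gu gv
    exfalso
    apply ne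
    rcases hn with hn | hn
    · exact le_antisymm (by linarith [gu.2, hn.2.1]) (by linarith [gv.2, hn.1.1])
    · have k1 : rep u' ≤ a / 2 := hn.1.resolve_right (by linarith [gu.2])
      have k2 : rep v' ≤ a / 2 := hn.2.resolve_right (by linarith [gv.2])
      exact le_antisymm (by linarith [gv.1]) (by linarith [gu.1])
  · exact Or.inl rfl
  · rw [hs] at gu gv
    exfalso
    apply ne
    rcases hn with hn | hn
    · exact le_antisymm (by linarith [gv.1, hn.1.2]) (by linarith [gu.1, hn.2.2])
    · have k1 : (b + 1) / 2 ≤ rep u' := hn.1.resolve_left (by linarith [gu.1])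
      have k2 : (b + 1) / 2 ≤ rep v' := hn.2.resolve_left (by linarith [gv.1])
      exact le_antisymm (by linarith [gu.2]) (by linarith [gv.2])

end Arcs

section Symmetry

theorem haltedMap_neg (x : Angle) : haltedMap (-x) = -haltedMap x := by
  have e : oneThird = -twoThirds := by
    apply rep_injective
    rw [rep_neg (by rw [rep_twoThirds]; norm_num), rep_oneThird, rep_twoThirds]; norm_num
  by_cases h : x = oneThird ∨ x = twoThirds
  · rw [haltedMap_of_fixed h, haltedMap_of_fixed]
    rcases h with rfl | rfl
    · right; rw [e, neg_neg]
    · left; rw [e]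
  · rw [haltedMap_of_ne h, haltedMap_of_ne, doubling_neg]
    rintro (h' | h')
    · apply h; right; rw [← neg_neg x, h', e, neg_neg]
    · apply h; left; rw [← neg_neg x, h', e]

/-- Reflection conjugates the symbols except at 0 and `1/2`, which are their own reflections. The
return times agree everywhere. -/
theorem stepLen_symbol_neg (q : ℕ) (x : Angle) :
    stepLen q (symbol (-x)) = stepLen q (symbol x) := by
  rcases (rep_nonneg x).eq_or_lt with h | h
  · have : x = 0 := by apply rep_injective; rw [rep_zero, h]
    rw [this, neg_zero]
  · rw [symbol_eq, symbol_eq, rep_neg h]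
    split_ifs <;> first | rfl | (exfalso; linarith)

end Symmetry

section SurgeryArcs

variable {p q : ℕ} (hp : 0 < p) (hpq : p < q) (hcop : Nat.Coprime p q)

include hp hpq hcop in
theorem two_mul_rep_surgery_of_lt {x : Angle} (h : rep x < 1 / 3) :
    2 * rep (surgery p q x) = rep (surgery p q (doubling x)) := by
  have e := len_mul_rep_surgery hp hpq hcop x
  rw [haltedMap_of_ne (by rw [eq_oneThird_iff, eq_twoThirds_iff]; rintro (h' | h') <;> linarith),
    symbol_eq, if_pos h] at e
  simpa [len, wt] using e

include hp hpq hcop in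
theorem two_mul_rep_surgery_of_gt {x : Angle} (h : 2 / 3 < rep x) :
    2 * rep (surgery p q x) = 1 + rep (surgery p q (doubling x)) := by
  have e := len_mul_rep_surgery hp hpq hcop x
  rw [haltedMap_of_ne (by rw [eq_oneThird_iff, eq_twoThirds_iff]; rintro (h' | h') <;> linarith),
    symbol_eq, if_neg (by linarith), if_neg (by linarith), if_neg (by linarith),
    if_neg (by linarith), if_neg (by linarith)] at e
  simpa [len, wt] using e

include hp hpq hcop in
theorem surgery_zero : surgery p q 0 = 0 := by
  apply rep_injective
  have h := two_mul_rep_surgery_of_lt hp hpq hcop (x := 0) (by rw [rep_zero]; norm_num)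
  rw [doubling, add_zero] at h
  rw [rep_zero]
  linarith

theorem rep_surgery_oneHalf : rep (surgery p q oneHalf) = (model p q hp hpq hcop).τ := by
  have e := len_mul_rep_surgery hp hpq hcop oneHalf
  rw [haltedMap_of_ne (by rw [eq_oneThird_iff, eq_twoThirds_iff, rep_oneHalf]; norm_num),
    doubling, oneHalf_add_oneHalf, surgery_zero hp hpq hcop, rep_zero, symbol_eq, rep_oneHalf] at e
  norm_num [len, wt] at e
  have hN := (model p q hp hpq hcop).two_le
  rw [← (model p q hp hpq hcop).mul_τ] at e
  exact mul_left_cancel₀ (by linarith) e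

theorem rep_surgery_oneThird : rep (surgery p q oneThird) = (model p q hp hpq hcop).θ₀ := by
  have h := rep_surgery_mem_piece hp hpq hcop oneThird
  rw [symbol_eq, rep_oneThird] at h
  norm_num at h
  exact h

theorem rep_surgery_twoThirds : rep (surgery p q twoThirds) = (model p q hp hpq hcop).θ₁ := by
  have h := rep_surgery_mem_piece hp hpq hcop twoThirds
  rw [symbol_eq, rep_twoThirds] at h
  norm_num at h
  exact h

include hp hpq hcop in
/-- An orbit which starts in the sector of `τ` remains between the ends of the sector of `0` up to
the return time. -/
theorem rep_iterate_mem_Icc {z : Angle} (h0 : rotPt p q (p - 1) ≤ rep z)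
    (h1 : rep z ≤ rotPt p q p) {i : ℕ} (hi : i < q - 1) :
    rotPt p q 0 ≤ rep (doubling^[i] z) ∧ rep (doubling^[i] z) ≤ rotPt p q (q - 1) := by
  have hs : InSector p q (p - 1) z :=
    ⟨rep z, coe_rep z, h0, by rwa [Nat.sub_add_cancel hp]⟩
  induction i using Nat.strong_induction_on with
  | _ i ih =>
    have h := hs.iterate hp hpq hcop (by omega) (m := i) fun j hj =>
      mem_arc_right_of_mem_innerHalf
        (mem_innerHalf_of_mem_Icc hp hpq hcop (ih j hj (by omega)))
    have hlt := Nat.mod_lt (p - 1 + i * p) (show 0 < q by omega)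
    have hne : (p - 1 + i * p) % q ≠ q - 1 := by
      intro e
      refine mul_mod_ne_zero hcop (j := i + 1) (by omega) (by omega) ?_
      have e2 : (i + 1) * p = p - 1 + i * p + 1 := by
        rw [add_mul, one_mul]; omega
      rw [e2, Nat.add_mod, e]
      rcases Nat.lt_or_ge 1 q with h1 | h1
      · rw [Nat.mod_eq_of_lt h1, Nat.sub_add_cancel (by omega), Nat.mod_self]
      · omega
    have hm := h.rep_mem_Icc hp hpq hcop (by omega)
    exact ⟨(rotPt_mem_Icc hpq hcop hlt).1.trans hm.1,
      hm.2.trans (rotPt_mem_Icc hpq hcop (show (p - 1 + i * p) % q + 1 < q by omega)).2⟩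

include hp hpq hcop in
-- The same time serves for `x` and `-x`, because their return times agree.
theorem exists_iterate_surgery_eq (x : Angle) (k : ℕ) : ∃ n,
    doubling^[n] (surgery p q x) = surgery p q (haltedMap^[k] x) ∧
      doubling^[n] (surgery p q (-x)) = surgery p q (-haltedMap^[k] x) := by
  induction k with
  | zero => exact ⟨0, rfl, rfl⟩
  | succ k ih =>
    obtain ⟨n, e1, e2⟩ := ih
    refine ⟨stepLen q (symbol (haltedMap^[k] x)) + n, ?_, ?_⟩
    · rw [Function.iterate_add_apply, e1, iterate_doubling_surgery hp hpq hcop,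
        Function.iterate_succ_apply']
    · rw [Function.iterate_add_apply, e2, ← stepLen_symbol_neg,
        iterate_doubling_surgery hp hpq hcop, Function.iterate_succ_apply', haltedMap_neg]

include hp hpq hcop in
-- The pieces other than `U` and `W` contain no points of the portrait, so it is not met at return
-- times. It is not met between them either, since doubling would keep the orbit in it up to the
-- next return.
theorem not_isRot_iterate_surgery {x : Angle} (h : ∀ k, itin x k ≠ .U ∧ itin x k ≠ .W) (n : ℕ) :
    ¬ IsRot p q (doubling^[n] (surgery p q x)) := by
  have hmono := rotPt_strictMono hpq hcop
  induction n generalizing x with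
  | zero =>
    rintro ⟨r, hr, e⟩
    rw [Function.iterate_zero_apply] at e
    have hm := rep_surgery_mem_piece hp hpq hcop x
    have hx : symbol x ≠ .U ∧ symbol x ≠ .W := h 0
    rw [e] at hm
    cases hs : symbol x <;> rw [hs] at hm hx
    · exact absurd (hmono.lt_iff_lt.1 hm.2) (by omega)
    · exact hx.1 rfl
    · have h1 := hmono.lt_iff_lt.1 hm.1
      have h2 := hmono.lt_iff_lt.1 (hm.2.trans (model p q hp hpq hcop).τ_lt)
      omega
    · have h1 := hmono.lt_iff_lt.1 ((model p q hp hpq hcop).θ₀_lt.trans_le hm.1)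
      have h2 := hmono.lt_iff_lt.1 hm.2
      omega
    · exact hx.2 rfl
    · exact absurd (hmono.lt_iff_lt.1 hm.1) (by omega)
  | succ n ih =>
    intro hrot
    have hpos := stepLen_pos hpq hp (symbol x)
    have h2 := hrot.iterate hp hpq hcop (stepLen q (symbol x) - 1)
    rw [← Function.iterate_add_apply,
      show stepLen q (symbol x) - 1 + (n + 1) = n + stepLen q (symbol x) by omega,
      Function.iterate_add_apply, iterate_doubling_surgery hp hpq hcop] at h2
    refine ih (x := haltedMap x) (fun k => ?_) h2
    have := h (k + 1)
    rwa [itin, Function.iterate_succ_apply] at this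

variable {x : Angle} (hx : 1 / 3 ≤ rep x) (hx' : rep x < 1 / 2)

include hp hpq hcop hx hx' in
theorem surgery_bounds :
    (model p q hp hpq hcop).θ₀ ≤ rep (surgery p q x) ∧
      rep (surgery p q x) < (model p q hp hpq hcop).τ ∧
      (model p q hp hpq hcop).τ < rep (surgery p q (-x)) ∧
      rep (surgery p q (-x)) ≤ (model p q hp hpq hcop).θ₁ := by
  rw [← rep_surgery_oneThird, ← rep_surgery_oneHalf, ← rep_surgery_twoThirds]
  have hn : rep (-x) = 1 - rep x := rep_neg (by linarith)
  refine ⟨(rep_surgery_le_iff hp hpq hcop).2 (by rwa [rep_oneThird]),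
    rep_surgery_lt hp hpq hcop (by rwa [rep_oneHalf]),
    rep_surgery_lt hp hpq hcop (by rw [rep_oneHalf]; linarith),
    (rep_surgery_le_iff hp hpq hcop).2 (by rw [rep_twoThirds]; linarith)⟩

include hp hpq hcop hx hx' in
-- The ends of the left arc are halves of `x` and `-x` with symbols `S0` and `S1`, for which the
-- surgery map commutes with doubling. They are sent to the ends of the left arc of the image leaf,
-- and the order is preserved.
theorem surgery_mem_left_iff {z : Angle} :
    surgery p q z ∈ arc (rep (surgery p q x)) (rep (surgery p q (-x))) .left ↔
      z ∈ arc (rep x) (rep (-x)) .left := by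
  have hn : rep (-x) = 1 - rep x := rep_neg (by linarith)
  have e1 : rep ((rep x / 2 : ℝ) : Angle) = rep x / 2 := rep_coe (by linarith) (by linarith)
  have e2 : rep (((rep (-x) + 1) / 2 : ℝ) : Angle) = (rep (-x) + 1) / 2 :=
    rep_coe (by linarith) (by linarith)
  have d1 : doubling ((rep x / 2 : ℝ) : Angle) = x := by
    rw [doubling_coe, mul_div_cancel₀ _ (by norm_num), coe_rep]
  have d2 : doubling (((rep (-x) + 1) / 2 : ℝ) : Angle) = -x := by
    rw [doubling_coe, mul_div_cancel₀ _ (by norm_num), coe_add_one, coe_rep]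
  have g1 := two_mul_rep_surgery_of_lt hp hpq hcop (x := ((rep x / 2 : ℝ) : Angle))
    (by rw [e1]; linarith)
  have g2 := two_mul_rep_surgery_of_gt hp hpq hcop (x := (((rep (-x) + 1) / 2 : ℝ) : Angle))
    (by rw [e2]; linarith)
  rw [d1] at g1
  rw [d2] at g2
  change _ ∨ _ ↔ _ ∨ _
  rw [← g1, add_comm _ (1 : ℝ), ← g2, mul_div_cancel_left₀ _ (by norm_num),
    mul_div_cancel_left₀ _ (by norm_num), rep_surgery_le_iff hp hpq hcop,
    rep_surgery_le_iff hp hpq hcop, e1, e2]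

include hp hpq hcop hx' in
-- As for the left arc; the ends now have symbols `S0` and `S1` only if `1/3 < rep x`.
theorem surgery_mem_right_iff {z : Angle} (hx : 1 / 3 < rep x) :
    surgery p q z ∈ arc (rep (surgery p q x)) (rep (surgery p q (-x))) .right ↔
      z ∈ arc (rep x) (rep (-x)) .right := by
  have hn : rep (-x) = 1 - rep x := rep_neg (by linarith)
  have e1 : rep ((rep (-x) / 2 : ℝ) : Angle) = rep (-x) / 2 := rep_coe (by linarith) (by linarith)
  have e2 : rep (((rep x + 1) / 2 : ℝ) : Angle) = (rep x + 1) / 2 :=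
    rep_coe (by linarith) (by linarith)
  have d1 : doubling ((rep (-x) / 2 : ℝ) : Angle) = -x := by
    rw [doubling_coe, mul_div_cancel₀ _ (by norm_num), coe_rep]
  have d2 : doubling (((rep x + 1) / 2 : ℝ) : Angle) = x := by
    rw [doubling_coe, mul_div_cancel₀ _ (by norm_num), coe_add_one, coe_rep]
  have g1 := two_mul_rep_surgery_of_lt hp hpq hcop (x := ((rep (-x) / 2 : ℝ) : Angle))
    (by rw [e1]; linarith)
  have g2 := two_mul_rep_surgery_of_gt hp hpq hcop (x := (((rep x + 1) / 2 : ℝ) : Angle))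
    (by rw [e2]; linarith)
  rw [d1] at g1
  rw [d2] at g2
  change _ ∧ _ ↔ _ ∧ _
  rw [← g1, add_comm _ (1 : ℝ), ← g2, mul_div_cancel_left₀ _ (by norm_num),
    mul_div_cancel_left₀ _ (by norm_num), rep_surgery_le_iff hp hpq hcop,
    rep_surgery_le_iff hp hpq hcop, e1, e2]

include hp hpq hcop hx hx' in
theorem mem_right_of_mem_Icc {z : Angle}
    (h : rotPt p q 0 ≤ rep z ∧ rep z ≤ rotPt p q (q - 1)) :
    z ∈ arc (rep (surgery p q x)) (rep (surgery p q (-x))) .right := by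
  obtain ⟨h1, -, -, h2⟩ := surgery_bounds hp hpq hcop hx hx'
  have e1 : 2 * rotPt p q 0 = (model p q hp hpq hcop).θ₁ := (model p q hp hpq hcop).two_z₀
  have e2 : 2 * rotPt p q (q - 1) = 1 + (model p q hp hpq hcop).θ₀ :=
    (model p q hp hpq hcop).two_z₁
  exact ⟨by linarith [h.1], by linarith [h.2]⟩

include hp hpq hcop in
theorem surgery_mem_Icc {y : Angle} (h0 : 1 / 3 ≤ rep y) (h1 : rep y ≤ 2 / 3) :
    rotPt p q (p - 1) ≤ rep (surgery p q y) ∧ rep (surgery p q y) ≤ rotPt p q p := by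
  have e1 := rep_surgery_oneThird hp hpq hcop
  have e2 := rep_surgery_twoThirds hp hpq hcop
  change _ = rotPt p q (p - 1) at e1
  change _ = rotPt p q p at e2
  rw [← e1, ← e2, rep_surgery_le_iff hp hpq hcop, rep_surgery_le_iff hp hpq hcop, rep_oneThird,
    rep_twoThirds]
  exact ⟨h0, h1⟩

include hp hpq hcop hx hx' in
-- Induction on the time, for all starting points at once. Up to the return from the sector of `τ`
-- both image orbits are between `z₀` and `z₁`, hence in the right arc; at a return time the arcs
-- correspond to those of the real orbits. Once `1/3` or `2/3` is reached, the image orbits remain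
-- in the portrait.
theorem sameArcs_surgery (h : SameArcs (rep x) (rep (-x)) x (-x)) :
    SameArcs (rep (surgery p q x)) (rep (surgery p q (-x))) (surgery p q x) (surgery p q (-x)) := by
  suffices key : ∀ n y, SameArcs (rep x) (rep (-x)) y (-y) →
      (doubling^[n] (surgery p q y) ∈
          arc (rep (surgery p q x)) (rep (surgery p q (-x))) .right ∧
        doubling^[n] (surgery p q (-y)) ∈
          arc (rep (surgery p q x)) (rep (surgery p q (-x))) .right) ∨
      (doubling^[n] (surgery p q y) ∈
          arc (rep (surgery p q x)) (rep (surgery p q (-x))) .left ∧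
        doubling^[n] (surgery p q (-y)) ∈
          arc (rep (surgery p q x)) (rep (surgery p q (-x))) .left) from
    fun n => key n x h
  intro n
  induction n using Nat.strong_induction_on with
  | _ n ih =>
    intro y hy
    have hstep := iterate_doubling_surgery hp hpq hcop y
    have hstep' := iterate_doubling_surgery hp hpq hcop (-y)
    rw [stepLen_symbol_neg, haltedMap_neg] at hstep'
    have recurse : ¬ (y = oneThird ∨ y = twoThirds) → stepLen q (symbol y) ≤ n →
        (doubling^[n] (surgery p q y) ∈
          arc (rep (surgery p q x)) (rep (surgery p q (-x))) .right ∧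
        doubling^[n] (surgery p q (-y)) ∈
          arc (rep (surgery p q x)) (rep (surgery p q (-x))) .right) ∨
      (doubling^[n] (surgery p q y) ∈
          arc (rep (surgery p q x)) (rep (surgery p q (-x))) .left ∧
        doubling^[n] (surgery p q (-y)) ∈
          arc (rep (surgery p q x)) (rep (surgery p q (-x))) .left) := by
      intro hne hle
      obtain ⟨m, rfl⟩ := Nat.exists_eq_add_of_le' hle
      rw [haltedMap_of_ne hne] at hstep hstep'
      rw [Function.iterate_add_apply, Function.iterate_add_apply, hstep, hstep']
      refine ih m (by have := stepLen_pos hpq hp (symbol y); omega) _ ?_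
      have := hy.iterate 1
      rwa [Function.iterate_one, doubling_neg] at this
    have hy0 := rep_nonneg y
    have hy1 := rep_lt_one y
    by_cases hmid : 1 / 3 ≤ rep y ∧ rep y ≤ 2 / 3
    · have hny : rep (-y) = 1 - rep y := rep_neg (by linarith)
      obtain ⟨b1, b2⟩ := surgery_mem_Icc hp hpq hcop hmid.1 hmid.2
      obtain ⟨b3, b4⟩ := surgery_mem_Icc hp hpq hcop (y := -y) (by linarith [hmid.2])
        (by linarith [hmid.1])
      rcases Nat.lt_or_ge n (q - 1) with hn | hn
      · left
        exact ⟨mem_right_of_mem_Icc hp hpq hcop hx hx' (rep_iterate_mem_Icc hp hpq hcop b1 b2 hn),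
          mem_right_of_mem_Icc hp hpq hcop hx hx' (rep_iterate_mem_Icc hp hpq hcop b3 b4 hn)⟩
      · by_cases hf : y = oneThird ∨ y = twoThirds
        · left
          have hrot : ∀ w, rep w = 1 / 3 ∨ rep w = 2 / 3 → IsRot p q (surgery p q w) := by
            rintro w (hw | hw)
            · rw [eq_oneThird_iff.2 hw]
              exact ⟨p - 1, by omega, rep_surgery_oneThird hp hpq hcop⟩
            · rw [eq_twoThirds_iff.2 hw]
              exact ⟨p, hpq, rep_surgery_twoThirds hp hpq hcop⟩
          have hright : ∀ w, rep w = 1 / 3 ∨ rep w = 2 / 3 → doubling^[n] (surgery p q w) ∈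
              arc (rep (surgery p q x)) (rep (surgery p q (-x))) .right := by
            intro w hw
            obtain ⟨r, hr, e⟩ := (hrot w hw).iterate hp hpq hcop n
            exact mem_right_of_mem_Icc hp hpq hcop hx hx' (e ▸ rotPt_mem_Icc hpq hcop hr)
          rw [eq_oneThird_iff, eq_twoThirds_iff] at hf
          refine ⟨hright y hf, hright (-y) ?_⟩
          rw [hny]
          rcases hf with hf | hf <;> rw [hf] <;> norm_num
        · refine recurse hf ?_
          rw [eq_oneThird_iff, eq_twoThirds_iff] at hf
          push Not at hf
          have h1 := lt_of_le_of_ne hmid.1 hf.1.symm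
          have h2 := lt_of_le_of_ne hmid.2 hf.2
          rw [symbol_eq, if_neg (by linarith), if_neg (by linarith)]
          split_ifs <;> exact hn
    · have hne : ¬ (y = oneThird ∨ y = twoThirds) := by
        rw [eq_oneThird_iff, eq_twoThirds_iff]
        rintro (h' | h') <;> apply hmid <;> rw [h'] <;> norm_num
      rcases Nat.eq_zero_or_pos n with rfl | hn
      · rcases hy 0 with h' | h'
        · left
          have hr : ∀ w, w ∈ arc (rep x) (rep (-x)) .right → surgery p q w ∈
              arc (rep (surgery p q x)) (rep (surgery p q (-x))) .right := by
            intro w hw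
            -- For `rep x = 1/3` the right arc is `[1/3, 2/3]`, which the surgery map sends into the
            -- sector of `τ`.
            rcases hx.lt_or_eq with hx3 | hx3
            · exact (surgery_mem_right_iff hp hpq hcop hx' hx3).2 hw
            · have hn : rep (-x) = 1 - rep x := rep_neg (by linarith)
              have w1 := hw.1
              have w2 := hw.2
              obtain ⟨c1, c2⟩ := surgery_mem_Icc hp hpq hcop (y := w) (by linarith) (by linarith)
              exact mem_right_of_mem_Icc hp hpq hcop hx hx'
                (rep_iterate_mem_Icc hp hpq hcop c1 c2 (i := 0) (by omega))
          exact ⟨hr _ h'.1, hr _ h'.2⟩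
        · right
          exact ⟨(surgery_mem_left_iff hp hpq hcop hx hx').2 h'.1,
            (surgery_mem_left_iff hp hpq hcop hx hx').2 h'.2⟩
      · refine recurse hne ?_
        rw [symbol_eq]
        split_ifs with g1 g2 g3 g4 g5
        · exact hn
        · exact absurd ⟨not_lt.1 g1, by linarith⟩ hmid
        · exact absurd ⟨not_lt.1 g1, by linarith⟩ hmid
        · exact absurd ⟨not_lt.1 g1, by linarith⟩ hmid
        · exact absurd ⟨not_lt.1 g1, g5⟩ hmid
        · exact hn

end SurgeryArcs

end Surgery

/-! ### Images of real leaves are minor leaves -/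

namespace Surgery

open Model

section LeafMem

variable {p q : ℕ} (hp : 0 < p) (hpq : p < q) (hcop : Nat.Coprime p q)

theorem SameArcs.exists_itinSet {a b : ℝ} {u v : Angle} (h : SameArcs a b u v) :
    ∃ t, u ∈ itinSet a b t ∧ v ∈ itinSet a b t := by
  have : ∀ n, ∃ i, doubling^[n] u ∈ arc a b i ∧ doubling^[n] v ∈ arc a b i := fun n =>
    (h n).elim (fun h' => ⟨_, h'⟩) fun h' => ⟨_, h'⟩
  choose t ht using this
  exact ⟨t, fun n => (ht n).1, fun n => (ht n).2⟩

variable {x : Angle} (hx : 1 / 3 ≤ rep x) (hx' : rep x < 1 / 2)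

include hp hpq hcop hx hx' in
/-- If the orbit of `x` meets `{1/3, 2/3}`, then no set of points with the itinerary of the image
leaf has points on both sides of it. -/
theorem not_separated_of_hit
    (hk : ∃ k, haltedMap^[k] x = oneThird ∨ haltedMap^[k] x = twoThirds) {s : ℕ → ArcIndex}
    (hA : surgery p q x ∈ itinSet (rep (surgery p q x)) (rep (surgery p q (-x))) s)
    (hB : surgery p q (-x) ∈ itinSet (rep (surgery p q x)) (rep (surgery p q (-x))) s)
    (hs : ∀ n, s n = .right ∨ s n = .left) {z w : Angle}
    (hz : z ∈ itinSet (rep (surgery p q x)) (rep (surgery p q (-x))) s)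
    (hw : w ∈ itinSet (rep (surgery p q x)) (rep (surgery p q (-x))) s)
    (h1 : sbtw (surgery p q x) z (surgery p q (-x)))
    (h2 : sbtw (surgery p q (-x)) w (surgery p q x)) : False := by
  obtain ⟨bd1, bd2, bd3, bd4⟩ := surgery_bounds hp hpq hcop hx hx'
  have e0 := (model p q hp hpq hcop).z₀_pos
  have e1 := (model p q hp hpq hcop).z₀_le
  have e2 := (model p q hp hpq hcop).θ₀_lt
  have e3 := (model p q hp hpq hcop).τ_lt
  have e4 := (model p q hp hpq hcop).θ₁_le
  have e5 := (model p q hp hpq hcop).z₁_lt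
  have e6 := (model p q hp hpq hcop).two_le
  have e7 := (model p q hp hpq hcop).mul_τ
  have e8 := (model p q hp hpq hcop).mul_θ₀
  have e9 := (model p q hp hpq hcop).mul_θ₁
  obtain ⟨k, hk⟩ := hk
  obtain ⟨n, en, en'⟩ := exists_iterate_surgery_eq hp hpq hcop x k
  have f1 := rep_surgery_oneThird hp hpq hcop
  have f2 := rep_surgery_twoThirds hp hpq hcop
  have hneg : -oneThird = twoThirds := by
    apply rep_injective
    rw [rep_neg (by rw [rep_oneThird]; norm_num), rep_oneThird, rep_twoThirds]; norm_num
  have hrot : IsRot p q (doubling^[n] (surgery p q x)) := by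
    rw [en]
    rcases hk with hk | hk <;> rw [hk]
    · exact ⟨p - 1, by omega, f1⟩
    · exact ⟨p, hpq, f2⟩
  -- At time `n` the image leaf joins `θ₀` and `θ₁`. A point of its class strictly between them
  -- would follow the portrait in the inner half forever, but `q - 1` doublings put it strictly
  -- inside the sector at 0, where `rep_eq_of_forall_right` excludes this.
  have noInner : ∀ y ∈ itinSet (rep (surgery p q x)) (rep (surgery p q (-x))) s,
      (model p q hp hpq hcop).θ₀ < rep (doubling^[n] y) →
      rep (doubling^[n] y) < (model p q hp hpq hcop).θ₁ → False := by
    intro y hy g1 g2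
    have hright : ∀ m, doubling^[m] (doubling^[n] y) ∈
        arc (model p q hp hpq hcop).τ (model p q hp hpq hcop).τ .right := by
      intro m
      apply mem_arc_right_of_mem_innerHalf
      have hin := (hrot.iterate hp hpq hcop m).mem_innerHalf hp hpq hcop
      rw [← Function.iterate_add_apply] at hin ⊢
      have hA' := hA (m + n)
      have hy' := hy (m + n)
      rcases hs (m + n) with h' | h' <;> rw [h'] at hA' hy'
      · exact mem_innerHalf_of_mem_right bd2 bd3 hy'
      · exact absurd (mem_outerHalf_of_mem_left bd2 bd3 hA') (disjoint_innerHalf_outerHalf hin)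
    have hq := rep_eq_of_forall_right hp hpq hcop (iterate_iterate_right hright (q - 1))
    rcases lt_or_ge (rep (doubling^[n] y)) (model p q hp hpq hcop).τ with hτ | hτ
    · have e := rep_iterate_of_lt_τ hp hpq hcop g1.le hτ
      have : (model p q hp hpq hcop).z₁ < rep (doubling^[q - 1] (doubling^[n] y)) := by
        rw [e]; nlinarith
      rcases hq (Or.inr this.le) with h' | h' <;> linarith
    · have e := rep_iterate_of_τ_le hp hpq hcop hτ g2.le
      have : rep (doubling^[q - 1] (doubling^[n] y)) < (model p q hp hpq hcop).z₀ := by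
        rw [e]; nlinarith
      rcases hq (Or.inl this.le) with h' | h' <;> linarith
  have hab : rep (surgery p q x) < rep (surgery p q (-x)) := bd2.trans bd3
  have s1 := sbtw_iterate_of_mem_itinSet (by linarith) hab (rep_lt_one _) hA hz hB h1 n
  have s2 := sbtw_iterate_of_mem_itinSet (by linarith) hab (rep_lt_one _) hB hw hA h2 n
  rw [en, en', sbtw_iff_rep] at s1 s2
  -- Doubling preserves the orientation of the triples. So the point carried into the open sector is
  -- `z` if the orbit of `x` hits `1/3`, and `w` if it hits `2/3`.
  rcases hk with hk | hk <;> rw [hk] at s1 s2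
  · rw [hneg, f1, f2] at s1
    refine noInner z hz ?_ ?_ <;> rcases s1 with s1 | s1 | s1 <;> linarith [s1.1, s1.2]
  · rw [← hneg, neg_neg, hneg, f1, f2] at s2
    refine noInner w hw ?_ ?_ <;> rcases s2 with s2 | s2 | s2 <;> linarith [s2.1, s2.2]

include hp hpq hcop hx hx' in
/-- If the orbit of `x` does not meet `{1/3, 2/3}`, then the points with the itinerary of the image
leaf are not strictly inside of it. -/
theorem not_sbtw_of_not_hit (h : SameArcs (rep x) (rep (-x)) x (-x))
    (hk : ∀ k, ¬ (haltedMap^[k] x = oneThird ∨ haltedMap^[k] x = twoThirds)) {s : ℕ → ArcIndex}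
    (hA : surgery p q x ∈ itinSet (rep (surgery p q x)) (rep (surgery p q (-x))) s)
    (hB : surgery p q (-x) ∈ itinSet (rep (surgery p q x)) (rep (surgery p q (-x))) s)
    (hs : ∀ n, s n = .right ∨ s n = .left) {z : Angle}
    (hz : z ∈ itinSet (rep (surgery p q x)) (rep (surgery p q (-x))) s) :
    ¬ sbtw (surgery p q x) z (surgery p q (-x)) := by
  intro hb
  obtain ⟨bd1, bd2, bd3, bd4⟩ := surgery_bounds hp hpq hcop hx hx'
  have hx3 : 1 / 3 < rep x := lt_of_le_of_ne hx fun e => hk 0 (Or.inl (eq_oneThird_iff.2 e.symm))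
  have hnx : rep (-x) = 1 - rep x := rep_neg (by linarith)
  have bd1 : (model p q hp hpq hcop).θ₀ < rep (surgery p q x) := by
    rw [← rep_surgery_oneThird]
    exact rep_surgery_lt hp hpq hcop (by rwa [rep_oneThird])
  have bd4 : rep (surgery p q (-x)) < (model p q hp hpq hcop).θ₁ := by
    rw [← rep_surgery_twoThirds]
    exact rep_surgery_lt hp hpq hcop (by rw [rep_twoThirds]; linarith)
  have hzab : rep (surgery p q x) < rep z ∧ rep z < rep (surgery p q (-x)) := by
    rw [sbtw_iff_rep] at hb
    rcases hb with hb | hb | hb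
    · exact hb
    · linarith [hb.1, hb.2]
    · linarith [hb.1, hb.2]
  have hpos : 0 < rep (surgery p q x) := by
    linarith [(model p q hp hpq hcop).z₀_pos, (model p q hp hpq hcop).z₀_le]
  have hitin : ∀ k, itin x k ≠ .U ∧ itin x k ≠ .W := by
    intro k
    have := hk k
    rw [eq_oneThird_iff, eq_twoThirds_iff] at this
    push Not at this
    rw [itin, symbol_eq]
    split_ifs with g1 g2 g3 g4 g5
    · simp
    · exact absurd (le_antisymm g2 (not_lt.1 g1)) this.1
    · simp
    · simp
    · exact absurd (le_antisymm g5 (not_lt.1 g4)) this.2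
    · simp
  have half : ∀ u v, u ∈ itinSet (rep (surgery p q x)) (rep (surgery p q (-x))) s →
      v ∈ itinSet (rep (surgery p q x)) (rep (surgery p q (-x))) s →
      ∀ n, (doubling^[n] u ∈ innerHalf (model p q hp hpq hcop).τ ∧
        doubling^[n] v ∈ innerHalf (model p q hp hpq hcop).τ) ∨
      (doubling^[n] u ∈ outerHalf (model p q hp hpq hcop).τ ∧
        doubling^[n] v ∈ outerHalf (model p q hp hpq hcop).τ) := by
    intro u v hu hv n
    have hu' := hu n
    have hv' := hv n
    rcases hs n with h' | h' <;> rw [h'] at hu' hv'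
    · exact Or.inl ⟨mem_innerHalf_of_mem_right bd2 bd3 hu', mem_innerHalf_of_mem_right bd2 bd3 hv'⟩
    · exact Or.inr ⟨mem_outerHalf_of_mem_left bd2 bd3 hu', mem_outerHalf_of_mem_left bd2 bd3 hv'⟩
  have comp : ∀ v, v ∈ itinSet (rep (surgery p q x)) (rep (surgery p q (-x))) s →
      Companions (model p q hp hpq hcop).τ (surgery p q x) v := by
    refine fun v hv => ⟨half _ _ hA hv, fun n => ?_⟩
    by_contra hcon
    push Not at hcon
    have hright : ∀ m, doubling^[m] (doubling^[n] (surgery p q x)) ∈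
        arc (model p q hp hpq hcop).τ (model p q hp hpq hcop).τ .right := by
      intro m
      rw [← Function.iterate_add_apply]
      exact mem_arc_right_of_mem_innerHalf
        ((half _ _ hA hA (m + n)).resolve_right fun h' => hcon m h'.1).1
    obtain ⟨m, hm⟩ := exists_isRot_of_forall_right hp hpq hcop hright
    rw [← Function.iterate_add_apply] at hm
    exact not_isRot_iterate_surgery hp hpq hcop hitin _ hm
  have hne : surgery p q x ≠ surgery p q (-x) := fun e => by
    rw [← e] at bd3
    exact lt_asymm bd2 bd3
  have hnever := (sameArcs_surgery hp hpq hcop hx hx' h).iterate_ne hpos (bd2.trans bd3)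
    (rep_lt_one _) hne
  have cAB := comp _ hB
  have cAz := comp _ hz
  obtain ⟨σ, -, -, hσA, hσB⟩ := cAB.exists_isItin ⟨bd1, bd2⟩ ⟨bd3, bd4⟩
  -- If `z` is below `τ`, its itinerary is conjugate to that of the upper end, so `z` equals the
  -- lower end; above `τ` the roles are exchanged. If `z = τ`, its orbit reaches 0, both ends must
  -- do so at the same time, and they would have coinciding iterates.
  rcases lt_trichotomy (rep z) (model p q hp hpq hcop).τ with hlt | heq | hgt
  · have cBz : Companions (model p q hp hpq hcop).τ z (surgery p q (-x)) :=
      ⟨half _ _ hz hB, cAz.frequently_right⟩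
    obtain ⟨σ', -, -, hz', hB'⟩ := cBz.exists_isItin ⟨bd1.trans hzab.1, hlt⟩ ⟨bd3, bd4⟩
    have : σ' = σ := by
      ext1 k
      have : (σ' k).conj = (σ k).conj := (st_eq (hB' k).1).symm.trans (st_eq (hσB k).1)
      rw [← St.conj_conj (σ' k), this, St.conj_conj]
    rw [this] at hz'
    exact hzab.1.ne (congrFun (hσA.eq hz') 0)
  · have e := rep_iterate_of_τ_le hp hpq hcop heq.ge
      (heq.le.trans (model p q hp hpq hcop).τ_lt.le)
    rw [heq, (model p q hp hpq hcop).mul_τ, sub_self] at e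
    have hz0 : doubling^[q - 1] z = 0 := by apply rep_injective; rw [e, rep_zero]
    have hzero : ∀ m, doubling^[m] (0 : Angle) = 0 := fun m =>
      Function.iterate_fixed (by rw [doubling, add_zero]) m
    have hleft : ∀ m, s (m + (q - 1)) = .left := by
      intro m
      refine (hs _).resolve_left fun h' => ?_
      have := hz (m + (q - 1))
      rw [h', Function.iterate_add_apply, hz0, hzero] at this
      have := this.1
      rw [rep_zero] at this
      linarith
    have hl : ∀ v, v ∈ itinSet (rep (surgery p q x)) (rep (surgery p q (-x))) s →
        doubling^[q - 1] v = 0 := by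
      intro v hv
      refine eq_zero_of_forall_left hpos (bd2.trans bd3) (rep_lt_one _) fun m => ?_
      have := hv (m + (q - 1))
      rwa [hleft, Function.iterate_add_apply] at this
    exact hnever (q - 1) ((hl _ hA).trans (hl _ hB).symm)
  · obtain ⟨σ', -, -, hA', hz'⟩ := cAz.exists_isItin ⟨bd1, bd2⟩ ⟨hgt, hzab.2.trans bd4⟩
    have : σ' = σ := by
      ext1 k
      exact (st_eq (hA' k).1).symm.trans (st_eq (hσA k).1)
    rw [this] at hz'
    exact hzab.2.ne (congrFun (hz'.eq hσB) 0)

include hp hpq hcop hx hx' in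
theorem surgery_mem_QML (h : SameArcs (rep x) (rep (-x)) x (-x)) :
    s(surgery p q x, surgery p q (-x)) ∈ QML := by
  obtain ⟨bd1, bd2, bd3, bd4⟩ := surgery_bounds hp hpq hcop hx hx'
  have hpos : 0 < rep (surgery p q x) := by
    linarith [(model p q hp hpq hcop).z₀_pos, (model p q hp hpq hcop).z₀_le]
  have hab := bd2.trans bd3
  have hsame := sameArcs_surgery hp hpq hcop hx hx' h
  have hne : surgery p q x ≠ surgery p q (-x) := fun e => by
    rw [e] at hab
    exact lt_irrefl _ hab
  have hnever := hsame.iterate_ne hpos hab (rep_lt_one _) hne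
  obtain ⟨t, hA, hB⟩ := hsame.exists_itinSet
  refine mem_QML_of_itinSet hpos hab.le (fun e => absurd e hne) hA hB ?_ ?_
  · intro s hA hB z hz w hw h1 h2
    have hs := hsame.eq_right_or_left hnever hA hB
    by_cases hk : ∃ k, haltedMap^[k] x = oneThird ∨ haltedMap^[k] x = twoThirds
    · exact not_separated_of_hit hp hpq hcop hx hx' hk hA hB hs hz hw h1 h2
    · exact not_sbtw_of_not_hit hp hpq hcop hx hx' h (not_exists.1 hk) hA hB hs hz h1
  -- The leaf lies in the sector of `τ`, whose length `(1 + z₀ - z₁)/N` is at most `1/2`.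
  · have e1 := (model p q hp hpq hcop).mul_θ₀
    have e2 := (model p q hp hpq hcop).mul_θ₁
    have e3 := (model p q hp hpq hcop).two_le
    have e4 := (model p q hp hpq hcop).z₀_le
    have e5 := (model p q hp hpq hcop).θ₁_le
    have e6 := (model p q hp hpq hcop).θ₀_lt
    have e7 := (model p q hp hpq hcop).τ_lt
    nlinarith

/-- The case `1/2` of `surgery_mem_QML`, where the surgery map is the identity: for real leaves the
arc condition is sufficient. -/
theorem mem_QML_of_sameArcs (h : SameArcs (rep x) (rep (-x)) x (-x)) (hx : 1 / 3 ≤ rep x)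
    (hx' : rep x < 1 / 2) : s(x, -x) ∈ QML := by
  have := surgery_mem_QML (p := 1) (q := 2) (by norm_num) (by norm_num) (by norm_num) hx hx' h
  rwa [surgery_one_two, surgery_one_two] at this

theorem rep_tau : rep (tau p q) = (model p q hp hpq hcop).τ := rep_surgery_oneHalf hp hpq hcop

include hp hpq hcop in
theorem iterate_tau : doubling^[q - 1] (tau p q) = 0 := by
  have hτ := rep_tau hp hpq hcop
  have e := rep_iterate_of_τ_le hp hpq hcop hτ.ge (hτ.le.trans (model p q hp hpq hcop).τ_lt.le)
  rw [hτ, (model p q hp hpq hcop).mul_τ, sub_self] at e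
  apply rep_injective
  rw [e, rep_zero]

theorem iterate_doubling_zero (m : ℕ) : doubling^[m] (0 : Angle) = 0 :=
  Function.iterate_fixed (by rw [doubling, add_zero]) m

include hp hpq hcop in
theorem iterate_tau_ne {m : ℕ} (hm : 0 < m) : doubling^[m] (tau p q) ≠ tau p q := by
  intro h
  have h1 : doubling^[m * (q - 1)] (tau p q) = tau p q := by
    rw [Function.iterate_mul]
    exact Function.iterate_fixed h _
  have h2 : doubling^[m * (q - 1)] (tau p q) = 0 := by
    obtain ⟨j, rfl⟩ := Nat.exists_eq_add_of_lt hm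
    rw [zero_add, add_mul, one_mul, Function.iterate_add_apply, iterate_tau hp hpq hcop,
      iterate_doubling_zero]
  have h3 := rep_tau hp hpq hcop
  rw [← h1, h2, rep_zero] at h3
  exact (τ_pos (model p q hp hpq hcop)).ne h3

include hp hpq hcop in
-- The orbit of `τ` ends at 0 and never returns to `τ`, so it avoids both halves of `τ`, the only
-- points common to several arcs. Its itinerary is therefore unique, and there is nothing to
-- separate for a degenerate chord.
theorem tau_mem_QML : s(tau p q, tau p q) ∈ QML := by
  have hpos : 0 < rep (tau p q) := by
    rw [rep_tau hp hpq hcop]; exact τ_pos _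
  have h1 := rep_lt_one (tau p q)
  have hne : ∀ n, rep (doubling^[n] (tau p q)) ≠ rep (tau p q) / 2 ∧
      rep (doubling^[n] (tau p q)) ≠ (rep (tau p q) + 1) / 2 := by
    intro n
    have hn := iterate_tau_ne hp hpq hcop (Nat.succ_pos n)
    rw [Function.iterate_succ_apply'] at hn
    refine ⟨fun e => hn ?_, fun e => hn ?_⟩ <;> apply rep_injective
    · rw [rep_doubling_of_lt (by linarith), e]; ring
    · rw [rep_doubling_of_le (by linarith), e]; ring
  have hcases : ∀ n i, doubling^[n] (tau p q) ∈ arc (rep (tau p q)) (rep (tau p q)) i →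
      (i = .left ∧ doubling^[n] (tau p q) ∈ outerHalf (rep (tau p q))) ∨
      (i = .right ∧ doubling^[n] (tau p q) ∈ innerHalf (rep (tau p q))) := by
    intro n i hi
    obtain ⟨g1, g2⟩ := hne n
    cases i
    · exact Or.inl ⟨rfl, hi.imp (fun h => lt_of_le_of_ne h g1) fun h => lt_of_le_of_ne h g2.symm⟩
    · exact absurd (le_antisymm hi.2 hi.1) g1
    · exact Or.inr ⟨rfl, lt_of_le_of_ne hi.1 g1.symm, lt_of_le_of_ne hi.2 g2⟩
    · exact absurd (le_antisymm hi.2 hi.1) g2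
  have hsame : SameArcs (rep (tau p q)) (rep (tau p q)) (tau p q) (tau p q) := by
    intro n
    rw [and_self, and_self]
    rcases le_total (rep (doubling^[n] (tau p q))) (rep (tau p q) / 2) with h | h
    · exact Or.inr (Or.inl h)
    · rcases le_total (rep (doubling^[n] (tau p q))) ((rep (tau p q) + 1) / 2) with h' | h'
      · exact Or.inl ⟨h, h'⟩
      · exact Or.inr (Or.inr h')
  obtain ⟨t, ht, -⟩ := hsame.exists_itinSet
  refine mem_QML_of_itinSet hpos le_rfl (fun _ s s' hs hs' => ?_) ht ht ?_ (by norm_num)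
  · ext1 n
    rcases hcases n _ (hs n) with ⟨e, h⟩ | ⟨e, h⟩ <;>
      rcases hcases n _ (hs' n) with ⟨e', h'⟩ | ⟨e', h'⟩ <;> rw [e, e']
    · exact absurd h (disjoint_innerHalf_outerHalf h')
    · exact absurd h' (disjoint_innerHalf_outerHalf h)
  · intro s _ _ z _ w _ h _
    exact absurd rfl (sbtw_ne h).2.2

end LeafMem

end Surgery

/-! ### Combinatorial veins: preimages of leaves and countability of the exceptions -/

namespace Surgery

open Model

section Veins

theorem zero_mem_of_root_eq {A B : Angle} (h : root = s(A, B)) : A = 0 := by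
  have h' : A ∈ root := h ▸ Sym2.mem_mk_left A B
  simpa [root] using h'

theorem mem_vein_of_le {t A B : Angle} (h : s(A, B) ∈ QML) (hA : 0 < rep A) (h1 : rep A ≤ rep t)
    (h2 : rep t ≤ rep B) : s(A, B) ∈ vein s(t, t) := by
  refine ⟨h, ⟨fun e => ?_, Or.inl rfl⟩, ?_⟩
  · rw [zero_mem_of_root_eq e, rep_zero] at hA
    exact lt_irrefl _ hA
  · by_cases e : s(A, B) = s(t, t)
    · exact Or.inl e
    · refine Or.inr ⟨e, Or.inr fun z hz => ?_⟩
      obtain rfl : z = t := by simpa using hz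
      exact ⟨A, Sym2.mem_mk_left A B, B, Sym2.mem_mk_right A B, h1, h2⟩

theorem eq_or_exists_of_mem_vein {t : Angle} {l : Leaf} (h : l ∈ vein s(t, t)) :
    l = s(t, t) ∨ ∃ A B, l = s(A, B) ∧ s(A, B) ∈ QML ∧ rep A < rep B ∧ rep A ≤ rep t ∧
      rep t ≤ rep B := by
  obtain ⟨hQ, ⟨hroot, -⟩, h | ⟨-, h⟩⟩ := h
  · exact Or.inl h
  · have h := h.resolve_left hroot.symm
    induction l using Sym2.ind with
    | _ A B =>
      obtain ⟨a, ha, b, hb, h1, h2⟩ := h t (by simp)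
      rw [Sym2.mem_iff] at ha hb
      rcases lt_trichotomy (rep A) (rep B) with hlt | heq | hgt
      · refine Or.inr ⟨A, B, rfl, hQ, hlt, ?_, ?_⟩
        · rcases ha with rfl | rfl <;> linarith
        · rcases hb with rfl | rfl <;> linarith
      · left
        obtain rfl : A = B := rep_injective heq
        obtain rfl : a = A := by simpa using ha
        obtain rfl : b = a := by simpa using hb
        rw [rep_injective (le_antisymm h1 h2)]
      · refine Or.inr ⟨B, A, Sym2.eq_swap, Sym2.eq_swap ▸ hQ, hgt, ?_, ?_⟩
        · rcases ha with rfl | rfl <;> linarith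
        · rcases hb with rfl | rfl <;> linarith

/-- The distances to 0 follow the tent map. On the same side of its turning point their difference
doubles, so it must vanish. -/
theorem norm_eq_of_forall {u v : Angle}
    (h : ∀ n, (‖doubling^[n] u‖ ≤ 1 / 4 ∧ ‖doubling^[n] v‖ ≤ 1 / 4) ∨
      (1 / 4 ≤ ‖doubling^[n] u‖ ∧ 1 / 4 ≤ ‖doubling^[n] v‖)) : ‖u‖ = ‖v‖ := by
  by_contra hne
  have hhalf : ∀ z : Angle, ‖z‖ ≤ 1 / 2 := fun z => by
    rw [norm_eq_rep]
    rcases le_total (rep z) (1 / 2) with h' | h'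
    · exact (min_le_left _ _).trans h'
    · exact (min_le_right _ _).trans (by linarith)
  refine not_forall_two_mul_le (f := fun n => |‖doubling^[n] u‖ - ‖doubling^[n] v‖|)
    (abs_pos.2 (sub_ne_zero.2 hne)) (fun n => le_of_eq ?_) fun n => ?_
  · rw [Function.iterate_succ_apply', Function.iterate_succ_apply']
    have hn := h n
    generalize doubling^[n] u = u' at *
    generalize doubling^[n] v = v' at *
    have key : ∀ c : ℝ, ‖doubling u'‖ - ‖doubling v'‖ = c * (‖u'‖ - ‖v'‖) → |c| = 2 →
        2 * |‖u'‖ - ‖v'‖| = |‖doubling u'‖ - ‖doubling v'‖| := by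
      intro c hc hc2
      rw [hc, abs_mul, hc2]
    rcases norm_doubling u' with ⟨a1, a2⟩ | ⟨a1, a2⟩ <;>
      rcases norm_doubling v' with ⟨b1, b2⟩ | ⟨b1, b2⟩
    · exact key 2 (by rw [a2, b2]; ring) (by norm_num)
    · rcases hn with ⟨c1, c2⟩ | ⟨c1, c2⟩
      · exact key 2 (by linarith) (by norm_num)
      · exact key (-2) (by linarith) (by norm_num)
    · rcases hn with ⟨c1, c2⟩ | ⟨c1, c2⟩
      · exact key 2 (by linarith) (by norm_num)
      · exact key (-2) (by linarith) (by norm_num)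
    · exact key (-2) (by rw [a2, b2]; ring) (by norm_num)
  · rw [abs_le]
    have g1 := hhalf (doubling^[n] u)
    have g2 := hhalf (doubling^[n] v)
    have g3 := norm_nonneg (doubling^[n] u)
    have g4 := norm_nonneg (doubling^[n] v)
    constructor <;> linarith

/-- The leaves of the real vein are symmetric. -/
theorem eq_or_exists_of_mem_vein_oneHalf {l : Leaf} (h : l ∈ vein s(oneHalf, oneHalf)) :
    l = s(oneHalf, oneHalf) ∨ ∃ x, l = s(x, -x) ∧ 1 / 3 ≤ rep x ∧ rep x < 1 / 2 ∧
      SameArcs (rep x) (rep (-x)) x (-x) := by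
  rcases eq_or_exists_of_mem_vein h with h | ⟨A, B, rfl, hQ, hlt, hA, hB⟩
  · exact Or.inl h
  · right
    rw [rep_oneHalf] at hA hB
    obtain ⟨hpos, hlen, harcs⟩ := arcs_of_mem_QML hQ hlt
    have hnorm : ‖A‖ = ‖B‖ := by
      -- Since `rep A ≤ 1/2 ≤ rep B`, the right and left arcs lie on different sides of the turning
      -- point `1/4` of the tent map.
      have hr : ∀ z ∈ arc (rep A) (rep B) .right, 1 / 4 ≤ ‖z‖ := fun z hz => by
        rw [norm_eq_rep, le_min_iff]
        constructor <;> linarith [hz.1, hz.2]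
      have hl : ∀ z ∈ arc (rep A) (rep B) .left, ‖z‖ ≤ 1 / 4 := fun z hz => by
        rw [norm_eq_rep, min_le_iff]
        exact hz.imp (fun _ => by linarith) fun _ => by linarith
      exact norm_eq_of_forall fun n => (harcs n).symm.imp
        (fun h => ⟨hl _ h.1, hl _ h.2⟩) fun h => ⟨hr _ h.1, hr _ h.2⟩
    rw [norm_eq_rep, norm_eq_rep, min_eq_left (by linarith), min_eq_right (by linarith)] at hnorm
    obtain rfl : B = -A := by
      apply rep_injective
      rw [rep_neg hpos]; linarith
    exact ⟨A, rfl, by linarith, by linarith, harcs⟩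

theorem oneHalf_mem_vein : s(oneHalf, oneHalf) ∈ vein s(oneHalf, oneHalf) := by
  have h := tau_mem_QML (p := 1) (q := 2) (by norm_num) (by norm_num) (by norm_num)
  rw [tau, surgery_one_two] at h
  exact mem_vein_of_le h (by rw [rep_oneHalf]; norm_num) le_rfl le_rfl

end Veins

section Main

variable {p q : ℕ} (hp : 0 < p) (hpq : p < q) (hcop : Nat.Coprime p q)

include hp hpq hcop in
theorem surgeryLeaf_mem_vein {l : Leaf} (h : l ∈ vein s(oneHalf, oneHalf)) :
    surgeryLeaf p q l ∈ vein s(tau p q, tau p q) := by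
  rcases eq_or_exists_of_mem_vein_oneHalf h with rfl | ⟨x, rfl, hx, hx', harcs⟩
  · exact mem_vein_of_le (tau_mem_QML hp hpq hcop)
      (by rw [rep_surgery_oneHalf hp hpq hcop]; exact τ_pos _) le_rfl le_rfl
  · obtain ⟨h1, h2, h3, -⟩ := surgery_bounds hp hpq hcop hx hx'
    refine mem_vein_of_le (surgery_mem_QML hp hpq hcop hx hx' harcs) ?_ ?_ ?_
    · linarith [(model p q hp hpq hcop).z₀_pos, (model p q hp hpq hcop).z₀_le]
    · rw [rep_tau hp hpq hcop]; exact h2.le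
    · rw [rep_tau hp hpq hcop]; exact h3.le

theorem SameArcs.iterate_eq_zero {a b : ℝ} (h0 : 0 < a) (hab : a < b) (h1 : b < 1) {u v : Angle}
    (h : SameArcs a b u v) {n : ℕ} (hu : doubling^[n] u = 0) : doubling^[n] v = 0 := by
  refine eq_zero_of_forall_left h0 hab h1 fun m => ?_
  have hm := h (m + n)
  rw [Function.iterate_add_apply, Function.iterate_add_apply, hu, iterate_doubling_zero] at hm
  rcases hm with hm | hm
  · have := hm.1.1
    rw [rep_zero] at this
    linarith
  · exact hm.2

theorem iterate_haltedMap_of_forall {x : Angle}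
    (h : ∀ k, ¬ (haltedMap^[k] x = oneThird ∨ haltedMap^[k] x = twoThirds)) (k : ℕ) :
    haltedMap^[k] x = doubling^[k] x := by
  induction k with
  | zero => rfl
  | succ k ih =>
    rw [Function.iterate_succ_apply', haltedMap_of_ne (h k), ih, Function.iterate_succ_apply']

theorem iterate_doubling_neg (n : ℕ) (x : Angle) : doubling^[n] (-x) = -doubling^[n] x := by
  induction n with
  | zero => rfl
  | succ n ih => rw [Function.iterate_succ_apply', ih, doubling_neg, Function.iterate_succ_apply']

/-- Points with conjugate itineraries are symmetric. -/
theorem rep_eq_of_itin_eq_conj {x x' : Angle} (h : itin x' = fun k => (itin x k).conj) :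
    rep x' = 1 - rep x := by
  have h1 := isItin_itin x
  have h2 := isItin_itin x'
  rw [h] at h2
  -- The reflected sequence may take the value 1 and leave the half-open pieces. Being bounded and
  -- satisfying the reflected recursion is enough for uniqueness.
  refine congrFun (eq_of_recursion (M := realModel) (σ := fun k => (itin x k).conj)
    (y' := fun k => 1 - rep (haltedMap^[k] x)) h2.mem_Icc (fun j => ?_) (fun j => (h2 j).2)
    fun j => ?_) 0
  · obtain ⟨g1, g2⟩ := h1.mem_Icc j
    exact ⟨sub_nonneg.2 g2, by linarith⟩
  · have e := (h1 j).2
    beta_reduce at e ⊢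
    generalize itin x j = s at e ⊢
    cases s <;> simp only [len, wt, St.conj, realModel_N, realModel_v] at e ⊢ <;> linarith

include hp hpq hcop in
/-- A leaf of the vein of `τ` whose endpoints are not in the backward orbit of the `α`-portrait is
the image of a leaf of the real vein. -/
theorem mem_image_of_not_isRot {A B : Angle} (hQ : s(A, B) ∈ QML) (hlt : rep A < rep B)
    (hA : rep A ≤ rep (tau p q)) (hB : rep (tau p q) ≤ rep B)
    (hnA : ∀ n, ¬ IsRot p q (doubling^[n] A)) :
    s(A, B) ∈ surgeryLeaf p q '' vein s(oneHalf, oneHalf) := by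
  obtain ⟨hpos, hlen, harcs⟩ := arcs_of_mem_QML hQ hlt
  have harcs : SameArcs (rep A) (rep B) A B := harcs
  have hB1 := rep_lt_one B
  have hne := harcs.iterate_ne hpos hlt hB1 fun e => hlt.ne (congrArg rep e)
  have hτ := rep_tau hp hpq hcop
  have h0 := iterate_tau hp hpq hcop
  have hA' : rep A < (model p q hp hpq hcop).τ := by
    rw [← hτ]
    -- An end equal to `τ` would reach 0 after `q - 1` steps, and the arc condition would send the
    -- other end to 0 at the same time.
    refine lt_of_le_of_ne hA fun e => ?_
    rw [← rep_injective e] at h0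
    exact hne (q - 1) (h0.trans (harcs.iterate_eq_zero hpos hlt hB1 h0).symm)
  have hB' : (model p q hp hpq hcop).τ < rep B := by
    rw [← hτ]
    refine lt_of_le_of_ne hB fun e => ?_
    rw [rep_injective e] at h0
    exact hne (q - 1) ((harcs.symm.iterate_eq_zero hpos hlt hB1 h0).trans h0.symm)
  have hc : Companions (model p q hp hpq hcop).τ A B := by
    refine ⟨fun n => (harcs n).imp
      (fun h => ⟨mem_innerHalf_of_mem_right hA' hB' h.1, mem_innerHalf_of_mem_right hA' hB' h.2⟩)
      fun h => ⟨mem_outerHalf_of_mem_left hA' hB' h.1, mem_outerHalf_of_mem_left hA' hB' h.2⟩,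
      fun n => ?_⟩
    by_contra hcon
    push Not at hcon
    obtain ⟨m, hm⟩ := exists_isRot_of_forall_right hp hpq hcop (z := doubling^[n] A) fun m => by
      rw [← Function.iterate_add_apply]
      rcases harcs (m + n) with h | h
      · exact mem_arc_right_of_mem_innerHalf (mem_innerHalf_of_mem_right hA' hB' h.1)
      · exact absurd (mem_outerHalf_of_mem_left hA' hB' h.1) (hcon m)
    rw [← Function.iterate_add_apply] at hm
    exact hnA _ hm
  -- Ends in the sector at 0 on different sides of 0 would contradict the arc condition at time 0.
  have hsec : (model p q hp hpq hcop).θ₀ < rep A ∧ rep B < (model p q hp hpq hcop).θ₁ := by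
    refine (hc.sector hA' hB').resolve_right fun h => ?_
    have e1 := (model p q hp hpq hcop).two_z₀
    have e2 := (model p q hp hpq hcop).θ₁_le
    rcases harcs 0 with h' | h'
    · have : rep B / 2 ≤ rep A := h'.1.1
      linarith [h.1, h.2]
    · have : rep A ≤ rep A / 2 ∨ (rep B + 1) / 2 ≤ rep A := h'.1
      rcases this with h' | h' <;> linarith
  obtain ⟨σ, hσ0, hσ, hσA, hσB⟩ := hc.exists_isItin ⟨hsec.1, hA'⟩ ⟨hB', hsec.2⟩
  obtain ⟨x, hxσ, hx⟩ := exists_surgery_eq hp hpq hcop hσA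
  obtain ⟨x', hxσ', hx'⟩ := exists_surgery_eq hp hpq hcop hσB
  have hT : rep x ∈ realModel.piece .T0 := by
    have h1 := rep_mem_piece_symbol x
    have h2 : symbol x = .T0 := by rw [← hσ0, ← hxσ]; rfl
    rwa [h2] at h1
  obtain ⟨hx1, hx2⟩ := hT
  rw [realModel_θ₀] at hx1
  rw [realModel_τ] at hx2
  have hneg : x' = -x := by
    apply rep_injective
    rw [rep_eq_of_itin_eq_conj (x := x) (by rw [hxσ', hxσ]), rep_neg (by linarith)]
  have eA : surgery p q x = A := rep_injective (hx 0)
  have eB : surgery p q (-x) = B := by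
    rw [← hneg]
    exact rep_injective (hx' 0)
  have hfree : ∀ k, ¬ (haltedMap^[k] x = oneThird ∨ haltedMap^[k] x = twoThirds) := by
    intro k hk
    have h1 := hσ k
    rw [← hxσ, itin, symbol_eq] at h1
    rcases hk with hk | hk <;> rw [hk] at h1
    · rw [rep_oneThird] at h1; norm_num at h1
    · rw [rep_twoThirds] at h1; norm_num at h1
  -- Each time of the real orbit corresponds to a return time of the image orbit, where membership
  -- in the arcs can be pulled back.
  have hreal : SameArcs (rep x) (rep (-x)) x (-x) := by
    intro k
    obtain ⟨m, e1, e2⟩ := exists_iterate_surgery_eq hp hpq hcop x k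
    rw [iterate_doubling_neg, ← iterate_haltedMap_of_forall hfree]
    have hm := harcs m
    rw [← eA, ← eB, e1, e2, surgery_mem_right_iff hp hpq hcop hx2 hx1,
      surgery_mem_right_iff hp hpq hcop hx2 hx1, surgery_mem_left_iff hp hpq hcop hx1.le hx2,
      surgery_mem_left_iff hp hpq hcop hx1.le hx2] at hm
    exact hm
  refine ⟨s(x, -x), mem_vein_of_le (mem_QML_of_sameArcs hreal hx1.le hx2) (by linarith)
    (by rw [rep_oneHalf]; exact hx2.le) ?_, ?_⟩
  · rw [rep_oneHalf, rep_neg (by linarith)]; linarith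
  · rw [surgeryLeaf, Sym2.map_mk, eA, eB]

/-- Once `u` has reached the portrait it stays in the inner half circle, which keeps `v` in the
closed right arc of `τ`; an orbit confined there meets the portrait. -/
theorem SameArcs.exists_isRot {a b : ℝ} {u v : Angle} (h : SameArcs a b u v)
    (ha : a ≤ (model p q hp hpq hcop).τ) (hb : (model p q hp hpq hcop).τ ≤ b) {n : ℕ}
    (hu : IsRot p q (doubling^[n] u)) : ∃ m, IsRot p q (doubling^[m] v) := by
  obtain ⟨m, hm⟩ := exists_isRot_of_forall_right hp hpq hcop (z := doubling^[n] v) fun m => by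
    have hin := (hu.iterate hp hpq hcop m).mem_innerHalf hp hpq hcop
    rw [← Function.iterate_add_apply] at hin ⊢
    rcases h (m + n) with h' | ⟨h' | h', -⟩
    · exact ⟨by linarith [h'.2.1], by linarith [h'.2.2]⟩
    · linarith [hin.1]
    · linarith [hin.2]
  exact ⟨m + n, by rwa [Function.iterate_add_apply]⟩

include hp hpq hcop in
theorem exists_isRot_of_not_mem_image {l : Leaf} (hl : l ∈ vein s(tau p q, tau p q))
    (h : l ∉ surgeryLeaf p q '' vein s(oneHalf, oneHalf)) :
    ∀ z ∈ l, ∃ n, IsRot p q (doubling^[n] z) := by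
  rcases eq_or_exists_of_mem_vein hl with rfl | ⟨A, B, rfl, hQ, hlt, hA, hB⟩
  · exact absurd ⟨_, oneHalf_mem_vein, rfl⟩ h
  · have hrot : ∃ n, IsRot p q (doubling^[n] A) := by
      by_contra hcon
      exact h (mem_image_of_not_isRot hp hpq hcop hQ hlt hA hB (not_exists.1 hcon))
    have harcs : SameArcs (rep A) (rep B) A B := (arcs_of_mem_QML hQ hlt).2.2
    rw [rep_tau hp hpq hcop] at hA hB
    intro z hz
    rcases Sym2.mem_iff.1 hz with rfl | rfl
    · exact hrot
    · obtain ⟨n, hn⟩ := hrot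
      exact harcs.exists_isRot hp hpq hcop hA hB hn

include hp hpq hcop in
theorem IsRot.mem_alphaPortrait {z : Angle} (h : IsRot p q z) : z ∈ alphaPortrait p q := by
  obtain ⟨r, hr, e⟩ := h
  refine ⟨fun i => rotPt p q i, fun i j hij => rotPt_strictMono hpq hcop hij, fun i => ?_,
    fun i j hij => ?_, ⟨r, hr⟩, ?_⟩
  · obtain ⟨h0, h1⟩ := rotPt_mem_Ioo hp hpq hcop i.2
    exact ⟨h0.le, h1⟩
  · apply rep_injective
    have rc : ∀ i : Fin q, rep ((rotPt p q i : ℝ) : Angle) = rotPt p q i := fun i => by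
      obtain ⟨h0, h1⟩ := rotPt_mem_Ioo hp hpq hcop i.2
      exact rep_coe h0.le h1
    rw [rep_doubling_of_rotPt hp hpq hcop i.2 (rc i), rc, hij]
  · beta_reduce
    rw [← e, coe_rep]

theorem countable_preimage_doubling {S : Set Angle} (h : S.Countable) :
    (doubling ⁻¹' S).Countable := by
  refine ((h.image fun w => ((rep w / 2 : ℝ) : Angle)).union
    (h.image fun w => (((rep w + 1) / 2 : ℝ) : Angle))).mono fun z hz => ?_
  rcases rep_doubling z with ⟨-, e⟩ | ⟨-, e⟩
  · refine Or.inl ⟨doubling z, hz, ?_⟩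
    beta_reduce
    rw [e, mul_div_cancel_left₀ _ (by norm_num), coe_rep]
  · refine Or.inr ⟨doubling z, hz, ?_⟩
    beta_reduce
    rw [e, sub_add_cancel, mul_div_cancel_left₀ _ (by norm_num), coe_rep]

theorem countable_setOf_isRot (p q : ℕ) : {z | ∃ n, IsRot p q (doubling^[n] z)}.Countable := by
  have hpre : ∀ n, (doubling^[n] ⁻¹' {z | IsRot p q z}).Countable := by
    intro n
    induction n with
    | zero =>
      refine (Set.countable_range fun r : ℕ => ((rotPt p q r : ℝ) : Angle)).mono ?_
      rintro z ⟨r, -, e⟩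
      exact ⟨r, by beta_reduce; rw [← e]; exact coe_rep z⟩
    | succ n ih =>
      rw [Function.iterate_succ, Set.preimage_comp]
      exact countable_preimage_doubling ih
  refine (Set.countable_iUnion hpre).mono ?_
  rintro z ⟨n, hn⟩
  exact Set.mem_iUnion.2 ⟨n, hn⟩

theorem countable_leaves {S : Set Angle} (h : S.Countable) :
    {l : Leaf | ∀ z ∈ l, z ∈ S}.Countable := by
  refine ((h.prod h).image fun z => s(z.1, z.2)).mono fun l hl => ?_
  induction l using Sym2.ind with
  | _ A B => exact ⟨(A, B), ⟨hl A (Sym2.mem_mk_left A B), hl B (Sym2.mem_mk_right A B)⟩, rfl⟩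

end Main

end Surgery

/-! ### The main theorem -/

theorem mainTheorem10 (p q : ℕ) (hp : 0 < p) (hpq : p < q) (hcop : Nat.Coprime p q) :
    Set.InjOn (Surgery.surgeryLeaf p q) (Surgery.vein s(Surgery.oneHalf, Surgery.oneHalf)) ∧
    {l ∈ Surgery.vein s(Surgery.tau p q, Surgery.tau p q) |
        ∀ x ∈ l, ∀ n : ℕ, Surgery.doubling^[n] x ∉ Surgery.alphaPortrait p q} ⊆
      Surgery.surgeryLeaf p q '' Surgery.vein s(Surgery.oneHalf, Surgery.oneHalf) ∧
    Surgery.surgeryLeaf p q '' Surgery.vein s(Surgery.oneHalf, Surgery.oneHalf) ⊆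
      Surgery.vein s(Surgery.tau p q, Surgery.tau p q) ∧
    (Surgery.vein s(Surgery.tau p q, Surgery.tau p q) \
      Surgery.surgeryLeaf p q '' Surgery.vein s(Surgery.oneHalf, Surgery.oneHalf)).Countable := by
  refine ⟨(Sym2.map.injective (Surgery.surgery_injective hp hpq hcop)).injOn, ?_, ?_, ?_⟩
  · rintro l ⟨hl, h⟩
    by_contra hcon
    have hrot := Surgery.exists_isRot_of_not_mem_image hp hpq hcop hl hcon
    obtain ⟨n, hn⟩ := hrot _ (Sym2.out_fst_mem l)
    exact h _ (Sym2.out_fst_mem l) n (hn.mem_alphaPortrait hp hpq hcop)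
  · rintro _ ⟨l, hl, rfl⟩
    exact Surgery.surgeryLeaf_mem_vein hp hpq hcop hl
  · refine (Surgery.countable_leaves (Surgery.countable_setOf_isRot p q)).mono ?_
    rintro l ⟨hl, h⟩
    exact Surgery.exists_isRot_of_not_mem_image hp hpq hcop hl h
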